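/- **Arenas and plays.** An arena $A=(M,\lambda,\vdash)$ consists of a set $M$ of moves, a labelling $\lambda$ of each move as an O- or P-move and as a question or an answer, and an enabling relation $\vdash$ between $M\cup\{\star\}$ and $M$ such that: a move $m$ with $\star\vdash m$ (an *initial* move) is an O-question and is enabled only by $\star$; if $m\vdash n$ and $n$ is an answer then $m$ is a question; if $m\vdash n$ with $m\neq\star$ then $m$ and $n$ belong to different participants. A *justified sequence* is a finite sequence of moves in which every non-initial occurrence $n$ has a pointer to an earlier occurrence $m$ (its justifier) with $m\vdash n$, and initial moves have no pointer. Its P-view and O-view are defined by $\ulcorner\epsilon\urcorner=\epsilon$, $\ulcorner sp\urcorner=\ulcorner s\urcorner p$, $\ulcorner si\urcorner=i$ for $i$ initial, $\ulcorner spto\urcorner=\ulcorner s\urcorner po$ if $p$ justifies $o$; and $\llcorner\epsilon\lrcorner=\epsilon$, $\llcorner so\lrcorner=\llcorner s\lrcorner o$, $\llcorner sotp\lrcorner=\llcorner s\lrcorner op$ if $o$ justifies $p$ ($o$ an O-move, $p$ a P-move). A *play* over $A$ is a justified sequence that is alternating, satisfies visibility (the justifier of a P-move lies in the P-view, and that of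 a non-initial O-move in the O-view, of the sequence preceding the move), and is well-bracketed (every answer points to the pending question, i.e. the most recently asked question not yet answered). All plays over $A$ are allowed; they may contain several initial moves. The arena $A\to B$ is the disjoint union of $A$ with O/P exchanged and $B$, with initial moves those of $B$, where in addition initial moves of $B$ enable initial moves of $A$. The game $\Sigma$ has an initial O-question $q$ enabling a P-answer $a$, and plays $\epsilon,q,qa$. The plays of the game $A\to\Sigma$ are the plays over the arena $A\to\Sigma$ whose restrictions to $A$ and $\Sigma$ are plays of $A$ and $\Sigma$. **Strategies.** An *innocent strategy* is a nonempty set $\sigma$ of even-length plays such that $sab\in\sigma$ implies $s\in\sigma$; $sab,sac\in\sigma$ implies $b=c$ (with the same pointer); and if $sab\in\sigma$, $t\in\sigma$, $ta$ is a play and $\ulcorner ta\urcorner=\ulcorner sa\urcorner$, then $tab\in\sigma$, where $b$ is given the pointer for which $\ulcorner tab\urcorner=\ulcorner sab\urcorner$. For $\sigma$ on $A$ and $\alpha$ on $A\to\Sigma$ put $\sigma;\alpha=\{u{\restriction}\Sigma : u\in\alpha,\ u{\restriction}A\in\sigma\}$, and let $\top=\{\epsilon,qa\}$. Write $\sigma\le_{ib}\tau$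 if for every innocent strategy $\alpha$ on $A\to\Sigma$, $\sigma;\alpha=\top$ implies $\tau;\alpha=\top$; and $\sigma=_{ib}\tau$ (*observational equivalence*) if $\sigma\le_{ib}\tau$ and $\tau\le_{ib}\sigma$. **Observations.** A play $s$ is *complete* if every question in it is answered, *single-threaded* if it contains exactly one initial occurrence, and *O-innocent* if whenever $s_1o_1$ and $s_2o_2$ are prefixes of $s$ with $o_1,o_2$ O-moves and $\llcorner s_1\lrcorner=\llcorner s_2\lrcorner$, then $o_1=o_2$, with the same justifier in this view. Let $\mathsf{ovw}(s)=\{\llcorner t\lrcorner : t\text{ a prefix of }s\}$ and $$\mathsf{obs}(\sigma)=\{\mathsf{ovw}(s) : s\in\sigma,\ s\text{ complete, O-innocent and single-threaded}\}.$$ **Theorem.** Let $A$ be an arena and let $\sigma,\tau$ be innocent strategies on $A$. Then $\sigma=_{ib}\tau$ if and only if $\mathsf{obs}(\sigma)=\mathsf{obs}(\tau)$. -/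

import Mathlib

namespace InnocentGames

/-- The two participants: Opponent `O` and Player `P`. -/
inductive Role where
  | O
  | P
  deriving DecidableEq

/-- Exchange of the two participants. -/
def Role.flip : Role → Role
  | .O => .P
  | .P => .O

/-- A move is a question or an answer. -/
inductive Kind where
  | question
  | answer
  deriving DecidableEq

/-- An arena on the set of moves `M`: every move is labelled `O`/`P` and question/answer; `init m`
is `⋆ ⊢ m` and `enables m n` is `m ⊢ n`. -/
structure Arena (M : Type*) where
  role : M → Role
  kind : M → Kind
  init : M → Prop
  enables : M → M → Prop
  init_role : ∀ m, init m → role m = Role.O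
  init_kind : ∀ m, init m → kind m = Kind.question
  init_not_enabled : ∀ m n, init n → ¬ enables m n
  answer_enabled : ∀ m n, enables m n → kind n = Kind.answer → kind m = Kind.question
  enables_role : ∀ m n, enables m n → role m ≠ role n

/-- Sequences of moves with pointers: the entry `(m, some j)` is an occurrence of `m` pointing to
the entry number `j` (counted from `0`), and `(m, none)` is an occurrence without a pointer.
Prefixes of such sequences are prefixes of lists. -/
abbrev JSeq (M : Type*) := List (M × Option ℕ)

/-- The subsequence of `s` at the (increasing) positions `idx`, with its pointers renumbered; a
pointer to an omitted entry is dropped. -/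
def JSeq.select {M : Type*} (idx : List ℕ) (s : JSeq M) : JSeq M :=
  idx.filterMap fun i => s[i]?.map fun x => (x.1, x.2.bind fun j => idx.idxOf? j)

/-- The restriction of `s` to a component: keep the entries whose move has a value under `g`
(and replace the move by this value). -/
def JSeq.project {M N : Type*} (g : M → Option N) (s : JSeq M) : JSeq N :=
  (s.select ((List.range s.length).filter fun i => (s[i]?.bind fun x => g x.1).isSome)).filterMap
    fun x => (g x.1).map fun n => (n, x.2)

section Arena

variable {M : Type*} (A : Arena M)

/-- The positions in `s` of the P-view of the prefix of `s` of length `n`. -/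
def pviewIdx (s : JSeq M) : ℕ → List ℕ
  | 0 => []
  | n + 1 =>
    match s[n]? with
    | none => []
    | some (m, ptr) =>
      match A.role m with
      | Role.P => pviewIdx s n ++ [n]
      | Role.O =>
        match ptr with
        | none => [n]
        | some j => if j < n then pviewIdx s j ++ [j, n] else []

/-- The positions in `s` of the O-view of the prefix of `s` of length `n`. -/
def oviewIdx (s : JSeq M) : ℕ → List ℕ
  | 0 => []
  | n + 1 =>
    match s[n]? with
    | none => []
    | some (m, ptr) =>
      match A.role m with
      | Role.O => oviewIdx s n ++ [n]
      | Role.P =>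
        match ptr with
        | none => []
        | some j => if j < n then oviewIdx s j ++ [j, n] else []

/-- The P-view of `s`. -/
def pview (s : JSeq M) : JSeq M := s.select (pviewIdx A s s.length)

/-- The O-view of `s`. -/
def oview (s : JSeq M) : JSeq M := s.select (oviewIdx A s s.length)

/-- The position in `s` of the pending question of the prefix of `s` of length `n`, if any: that
of `s q` is `q`, and that of `s q t a`, with the answer `a` pointing to `q`, is that of `s`. -/
def pending (s : JSeq M) : ℕ → Option ℕ
  | 0 => none
  | n + 1 =>
    match s[n]? with
    | none => none
    | some (m, ptr) =>
      match A.kind m with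
      | Kind.question => some n
      | Kind.answer =>
        match ptr with
        | none => none
        | some j => if j < n then pending s j else none

/-- The legal positions (well-bracketed plays) of an arena. -/
structure Legal (s : JSeq M) : Prop where
  /-- Initial moves have no pointer; any other move points to an earlier move enabling it. -/
  justified : ∀ (i : ℕ) (m : M) (ptr : Option ℕ), s[i]? = some (m, ptr) →
    (A.init m ∧ ptr = none) ∨
      ∃ (j : ℕ) (m' : M) (ptr' : Option ℕ), ptr = some j ∧ j < i ∧
        s[j]? = some (m', ptr') ∧ A.enables m' m
  /-- The participants alternate (Opponent starts, since initial moves are O-moves). -/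
  alternating : ∀ (i : ℕ) (x y : M × Option ℕ), s[i]? = some x → s[i + 1]? = some y →
    A.role x.1 ≠ A.role y.1
  /-- A P-move points into the P-view of what precedes it. -/
  visible_P : ∀ (i : ℕ) (m : M) (j : ℕ), s[i]? = some (m, some j) → A.role m = Role.P →
    j ∈ pviewIdx A s i
  /-- A non-initial O-move points into the O-view of what precedes it. -/
  visible_O : ∀ (i : ℕ) (m : M) (j : ℕ), s[i]? = some (m, some j) → A.role m = Role.O →
    j ∈ oviewIdx A s i
  /-- An answer points to the pending question. -/
  bracketed : ∀ (i : ℕ) (m : M) (j : ℕ), s[i]? = some (m, some j) →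
    A.kind m = Kind.answer → pending A s i = some j

/-- The set of all plays over the arena `A`. -/
def plays : Set (JSeq M) := {s | Legal A s}

/-- `σ` is an innocent (and well-bracketed) strategy for the game with arena `A` and set of
plays `G`. -/
structure IsInnocentStrategy (G : Set (JSeq M)) (σ : Set (JSeq M)) : Prop where
  nonempty : σ.Nonempty
  subset_plays : σ ⊆ G
  even_length : ∀ s ∈ σ, Even s.length
  prefix_closed : ∀ (s : JSeq M) (a b : M × Option ℕ), s ++ [a, b] ∈ σ → s ∈ σ
  deterministic : ∀ (s : JSeq M) (a b c : M × Option ℕ), s ++ [a, b] ∈ σ →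
    s ++ [a, c] ∈ σ → b = c
  /-- If `s a b` is in `σ`, and `t a'` is a play with `t` in `σ` and the P-view of `s a`, then the
  extension `t a' b'` having the P-view of `s a b` (that is, `b'` is `b`, with the corresponding
  pointer) is in `σ`. -/
  innocent : ∀ (s : JSeq M) (a b : M × Option ℕ) (t : JSeq M) (a' : M × Option ℕ),
    s ++ [a, b] ∈ σ → t ∈ σ → t ++ [a'] ∈ G →
    pview A (t ++ [a']) = pview A (s ++ [a]) →
    ∃ b', t ++ [a', b'] ∈ σ ∧ pview A (t ++ [a', b']) = pview A (s ++ [a, b])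

/-- Every question in `s` has been answered. -/
def Complete (s : JSeq M) : Prop :=
  ∀ (i : ℕ) (m : M) (ptr : Option ℕ), s[i]? = some (m, ptr) → A.kind m = Kind.question →
    ∃ (k : ℕ) (n : M), s[k]? = some (n, some i) ∧ A.kind n = Kind.answer

/-- There is exactly one occurrence of an initial move in `s`. -/
def SingleThreaded (s : JSeq M) : Prop :=
  ∃! i : ℕ, ∃ x : M × Option ℕ, s[i]? = some x ∧ A.init x.1

/-- Opponent's moves in `s`, with their pointers, depend only on the O-view. Pointers are compared
inside the O-view. -/
def OInnocent (s : JSeq M) : Prop :=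
  ∀ (s₁ : JSeq M) (o₁ : M × Option ℕ) (s₂ : JSeq M) (o₂ : M × Option ℕ), s₁ ++ [o₁] <+: s →
    s₂ ++ [o₂] <+: s →
    A.role o₁.1 = Role.O → A.role o₂.1 = Role.O → oview A s₁ = oview A s₂ →
    oview A (s₁ ++ [o₁]) = oview A (s₂ ++ [o₂])

/-- The set of O-views of the prefixes of `s`. -/
def ovw (s : JSeq M) : Set (JSeq M) := {v | ∃ t, t <+: s ∧ v = oview A t}

/-- The observations of a strategy. -/
def obs (σ : Set (JSeq M)) : Set (Set (JSeq M)) :=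
  {X | ∃ s ∈ σ, Complete A s ∧ OInnocent A s ∧ SingleThreaded A s ∧ X = ovw A s}

end Arena

/-- The arena of the function space `A → B`. -/
def Arena.arrow {M N : Type*} (A : Arena M) (B : Arena N) : Arena (M ⊕ N) where
  role := Sum.elim (fun m => (A.role m).flip) B.role
  kind := Sum.elim A.kind B.kind
  init := Sum.elim (fun _ => False) B.init
  enables x y :=
    match x, y with
    | .inl m, .inl m' => A.enables m m'
    | .inr n, .inr n' => B.enables n n'
    | .inr n, .inl m => B.init n ∧ A.init m
    | .inl _, .inr _ => False
  init_role := by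
    rintro (m | n) h
    · exact h.elim
    · exact B.init_role n h
  init_kind := by
    rintro (m | n) h
    · exact h.elim
    · exact B.init_kind n h
  init_not_enabled := by
    rintro (m | n) (m' | n') h
    · exact h.elim
    · exact id
    · exact h.elim
    · exact B.init_not_enabled n n' h
  answer_enabled := by
    rintro (m | n) (m' | n') h h'
    · exact A.answer_enabled m m' h h'
    · exact h.elim
    · exact B.init_kind n h.1
    · exact B.answer_enabled n n' h h'
  enables_role := by
    rintro (m | n) (m' | n') h
    · have := A.enables_role m m' h
      revert this
      simp only [Sum.elim_inl]
      cases A.role m <;> cases A.role m' <;> simp [Role.flip]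
    · exact h.elim
    · simp [B.init_role n h.1, A.init_role m' h.2, Role.flip]
    · exact B.enables_role n n' h

/-- The moves of the game `Σ`. -/
inductive SigmaMove where
  | q
  | a

/-- The arena of the game `Σ`: `⋆ ⊢ q ⊢ a`, where `q` is an O-question and `a` a P-answer. -/
def sigmaArena : Arena SigmaMove where
  role
    | .q => Role.O
    | .a => Role.P
  kind
    | .q => Kind.question
    | .a => Kind.answer
  init m := m = .q
  enables m n := m = .q ∧ n = .a
  init_role := by rintro m rfl; rfl
  init_kind := by rintro m rfl; rfl
  init_not_enabled := by rintro m n rfl ⟨_, h⟩; cases h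
  answer_enabled := by rintro m n ⟨rfl, _⟩ _; rfl
  enables_role := by rintro m n ⟨rfl, rfl⟩ h; cases h

/-- The play `q a` of `Σ`. -/
def sigmaQA : JSeq SigmaMove := [(.q, none), (.a, some 0)]

/-- The plays of `Σ`: `ε`, `q` and `q a`. -/
def sigmaPlays : Set (JSeq SigmaMove) := {[], [(.q, none)], sigmaQA}

/-- The strategy `⊤ = {ε, q a}` on `Σ`. -/
def sigmaTop : Set (JSeq SigmaMove) := {[], sigmaQA}

/-- The restriction of `u` to the left component (a pointer from an initial move of this component
to the other component is dropped). -/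
def restrictLeft {M N : Type*} (u : JSeq (M ⊕ N)) : JSeq M := u.project Sum.getLeft?

/-- The restriction of `u` to the right component. -/
def restrictRight {M N : Type*} (u : JSeq (M ⊕ N)) : JSeq N := u.project Sum.getRight?

section Tests

variable {M : Type*} (A : Arena M)

/-- The plays of the game `A → Σ`. -/
def testPlays : Set (JSeq (M ⊕ SigmaMove)) :=
  {u | Legal (A.arrow sigmaArena) u ∧ restrictLeft u ∈ plays A ∧ restrictRight u ∈ sigmaPlays}

/-- Innocent tests on `A`, that is, innocent strategies for `A → Σ`. -/
def IsInnocentTest (α : Set (JSeq (M ⊕ SigmaMove))) : Prop :=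
  IsInnocentStrategy (A.arrow sigmaArena) (testPlays A) α

/-- The composite `σ;α` of a strategy `σ` for `A` and a strategy `α` for `A → Σ`: let the two
interact in `A`, and hide the moves in `A`. -/
def comp (σ : Set (JSeq M)) (α : Set (JSeq (M ⊕ SigmaMove))) : Set (JSeq SigmaMove) :=
  {v | ∃ u ∈ α, restrictLeft u ∈ σ ∧ v = restrictRight u}

/-- The observational preorder `σ ≤ τ`: every innocent test that succeeds on `σ` succeeds
on `τ`. -/
def ObsLE (σ τ : Set (JSeq M)) : Prop :=
  ∀ α, IsInnocentTest A α → comp σ α = sigmaTop → comp τ α = sigmaTop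

/-- Observational equivalence. -/
def ObsEquiv (σ τ : Set (JSeq M)) : Prop := ObsLE A σ τ ∧ ObsLE A τ σ

end Tests

end InnocentGames

open InnocentGames

/-!
A play of `A → Σ` is `q s` or `q s a`, where `s` is a play of `A` and the P-views of the test are
the O-views of `s`. So a test amounts to a deterministic set `V` of O-views, which Opponent follows
in `A`, and a set `F` of O-views at which the test answers; it succeeds on `σ` if and only if some play
`s ∈ σ` follows `V` and ends, with no question pending, with an O-view in `F`
(`comp_eq_sigmaTop_iff`, `append_finalEntry_mem_iff`). An innocent strategy, likewise, is a
deterministic set of P-views (`IsInnocentStrategy.mem_iff`).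

Equivalent strategies have the same observations. If `s ∈ σ` is observable, its O-views form an
innocent test, which answers at the final O-view of `s`; this O-view has no continuation in `ovw s`
because `s` is complete. The test succeeds on `σ`, hence on some `t ∈ τ`, which is again observable
and satisfies `ovw t ⊆ ovw s`. In the same way `t` leads to some `u ∈ σ` with `ovw u ⊆ ovw t`. The
plays `s` and `u` belong to the same strategy and face the same Opponent, so they are equal, and
`ovw s = ovw t` (`obs_subset_of_obsEquiv`).

Conversely, let `obs σ ⊆ obs τ`, and let a test `(V, F)` succeed on `σ` with the play `s`. Each
initial move of `s` begins a thread, made up of the moves whose chain of pointers ends there. By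
visibility Player stays in the thread in which Opponent has just moved, so a thread has the P-views
of the whole play, and is a play of `σ`. Player's part in `s` can therefore be changed from `σ` to
`τ` one thread at a time (`exists_run_of_obs_subset`). The thread `t` in question is complete and
single-threaded, and it is O-innocent: although the test sees the other threads, what it does in `t`
depends only on the O-view of `t`, given that Player is innocent in the other threads as well
(`IsRun.viewDet_thread`). So there is `t' ∈ τ` with `ovw t' = ovw t`, and the interaction can be
repeated with `t'` in the place of `t` (`IsRun.exists_replace`). When it has come to an O-view of
`t'`, the same O-view occurs in `t`, and the moves of the other threads that follow in `s` can be
copied, up to Opponent's next move in the thread. In the end this yields a play with the final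
O-view of `s`.

Both of these facts rest on the *core* of a position relative to a thread (`IsCore`): the moves
reached from the last one by going back from Player's moves in the thread to their justifiers, and
from all other moves to their predecessors. The core contains the O-view of the position and, at a
move of another thread, the P-view, hence all that the participants can see (`IsCore.ov_last`,
`IsCore.pv_last`); its part in the thread is the O-view of the thread (`IsCore.ov_thread`). Since
the participants are deterministic, the core is determined by this O-view (`IsCoreRun.eq`).
-/

namespace InnocentGames

/-! ### Sequences with pointers and their views -/

section Basics

variable {M : Type*} {A : Arena M} {s t : JSeq M}

/-- The O-view of the prefix of `s` of length `n`. -/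
def ov (A : Arena M) (s : JSeq M) (n : ℕ) : JSeq M := s.select (oviewIdx A s n)

/-- The P-view of the prefix of `s` of length `n`. -/
def pv (A : Arena M) (s : JSeq M) (n : ℕ) : JSeq M := s.select (pviewIdx A s n)

/-- Every pointer of `s` goes to an earlier position. -/
def PtrLt (s : JSeq M) : Prop := ∀ (i : ℕ) (m : M) (j : ℕ), s[i]? = some (m, some j) → j < i

theorem oviewIdx_of_O {n : ℕ} {m : M} {p : Option ℕ} (h : s[n]? = some (m, p))
    (hm : A.role m = .O) : oviewIdx A s (n + 1) = oviewIdx A s n ++ [n] := by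
  rw [oviewIdx]; simp [h, hm]

theorem oviewIdx_of_P {n j : ℕ} {m : M} (h : s[n]? = some (m, some j))
    (hm : A.role m = .P) (hj : j < n) : oviewIdx A s (n + 1) = oviewIdx A s j ++ [j, n] := by
  rw [oviewIdx]; simp [h, hm, hj]

theorem pviewIdx_of_P {n : ℕ} {m : M} {p : Option ℕ} (h : s[n]? = some (m, p))
    (hm : A.role m = .P) : pviewIdx A s (n + 1) = pviewIdx A s n ++ [n] := by
  rw [pviewIdx]; simp [h, hm]

theorem pviewIdx_of_O {n j : ℕ} {m : M} (h : s[n]? = some (m, some j))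
    (hm : A.role m = .O) (hj : j < n) : pviewIdx A s (n + 1) = pviewIdx A s j ++ [j, n] := by
  rw [pviewIdx]; simp [h, hm, hj]

theorem pviewIdx_of_none {n : ℕ} {m : M} (h : s[n]? = some (m, none))
    (hm : A.role m = .O) : pviewIdx A s (n + 1) = [n] := by
  rw [pviewIdx]; simp [h, hm]

theorem pending_of_question {n : ℕ} {m : M} {p : Option ℕ} (h : s[n]? = some (m, p))
    (hm : A.kind m = .question) : pending A s (n + 1) = some n := by
  rw [pending]; simp [h, hm]

theorem pending_of_answer {n j : ℕ} {m : M} (h : s[n]? = some (m, some j))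
    (hm : A.kind m = .answer) (hj : j < n) : pending A s (n + 1) = pending A s j := by
  rw [pending]; simp [h, hm, hj]

theorem oviewIdx_congr {n : ℕ} (h : ∀ i < n, s[i]? = t[i]?) :
    oviewIdx A s n = oviewIdx A t n := by
  induction n using Nat.strong_induction_on with
  | _ n ih =>
    cases n with
    | zero => rw [oviewIdx, oviewIdx]
    | succ n =>
      rw [oviewIdx, oviewIdx, h n (by omega), ih n (by omega) fun i hi => h i (by omega)]
      split
      · rfl
      · split
        · rfl
        · split
          · rfl
          · split
            · rw [ih _ (by omega) fun i hi => h i (by omega)]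
            · rfl

theorem pviewIdx_congr {n : ℕ} (h : ∀ i < n, s[i]? = t[i]?) :
    pviewIdx A s n = pviewIdx A t n := by
  induction n using Nat.strong_induction_on with
  | _ n ih =>
    cases n with
    | zero => rw [pviewIdx, pviewIdx]
    | succ n =>
      rw [pviewIdx, pviewIdx, h n (by omega), ih n (by omega) fun i hi => h i (by omega)]
      split
      · rfl
      · split
        · rfl
        · split
          · rfl
          · split
            · rw [ih _ (by omega) fun i hi => h i (by omega)]
            · rfl

theorem pending_congr {n : ℕ} (h : ∀ i < n, s[i]? = t[i]?) :
    pending A s n = pending A t n := by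
  induction n using Nat.strong_induction_on with
  | _ n ih =>
    cases n with
    | zero => rw [pending, pending]
    | succ n =>
      rw [pending, pending, h n (by omega)]
      split
      · rfl
      · split
        · rfl
        · split
          · rfl
          · split
            · rw [ih _ (by omega) fun i hi => h i (by omega)]
            · rfl

theorem lt_of_mem_oviewIdx {n i : ℕ} (h : i ∈ oviewIdx A s n) : i < n := by
  induction n using Nat.strong_induction_on with
  | _ n ih =>
    cases n with
    | zero => simp [oviewIdx] at h
    | succ n =>
      rw [oviewIdx] at h
      split at h
      · simp at h
      · split at h
        · rcases List.mem_append.1 h with h | h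
          · have := ih n (by omega) h
            omega
          · simp at h; omega
        · split at h
          · simp at h
          · split at h
            · rcases List.mem_append.1 h with h | h
              · have := ih _ (by omega) h
                omega
              · simp at h; omega
            · simp at h

theorem lt_of_mem_pviewIdx {n i : ℕ} (h : i ∈ pviewIdx A s n) : i < n := by
  induction n using Nat.strong_induction_on with
  | _ n ih =>
    cases n with
    | zero => simp [pviewIdx] at h
    | succ n =>
      rw [pviewIdx] at h
      split at h
      · simp at h
      · split at h
        · rcases List.mem_append.1 h with h | h
          · have := ih n (by omega) h
            omega
          · simp at h; omega
        · split at h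
          · simp at h; omega
          · split at h
            · rcases List.mem_append.1 h with h | h
              · have := ih _ (by omega) h
                omega
              · simp at h; omega
            · simp at h

theorem getElem?_append_lt {l : JSeq M} {i : ℕ} (h : i < s.length) : (s ++ l)[i]? = s[i]? :=
  List.getElem?_append_left h

theorem lt_length_of_getElem? {i : ℕ} {x : M × Option ℕ} (h : s[i]? = some x) : i < s.length :=
  (List.getElem?_eq_some_iff.1 h).1

theorem exists_getElem? {i : ℕ} (h : i < s.length) : ∃ m p, s[i]? = some (m, p) :=
  ⟨s[i].1, s[i].2, List.getElem?_eq_getElem h⟩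

theorem oviewIdx_append {l : JSeq M} {n : ℕ} (h : n ≤ s.length) :
    oviewIdx A (s ++ l) n = oviewIdx A s n :=
  oviewIdx_congr fun _ hi => getElem?_append_lt (hi.trans_le h)

theorem pviewIdx_append {l : JSeq M} {n : ℕ} (h : n ≤ s.length) :
    pviewIdx A (s ++ l) n = pviewIdx A s n :=
  pviewIdx_congr fun _ hi => getElem?_append_lt (hi.trans_le h)

theorem pending_append {l : JSeq M} {n : ℕ} (h : n ≤ s.length) :
    pending A (s ++ l) n = pending A s n :=
  pending_congr fun _ hi => getElem?_append_lt (hi.trans_le h)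

theorem select_congr {l : List ℕ} (h : ∀ i ∈ l, s[i]? = t[i]?) : s.select l = t.select l :=
  List.filterMap_congr fun i hi => by rw [h i hi]

theorem ov_congr {n : ℕ} (h : ∀ i < n, s[i]? = t[i]?) : ov A s n = ov A t n := by
  rw [ov, ov, oviewIdx_congr h]
  exact select_congr fun i hi => h i (lt_of_mem_oviewIdx hi)

theorem pv_congr {n : ℕ} (h : ∀ i < n, s[i]? = t[i]?) : pv A s n = pv A t n := by
  rw [pv, pv, pviewIdx_congr h]
  exact select_congr fun i hi => h i (lt_of_mem_pviewIdx hi)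

theorem ov_append {l : JSeq M} {n : ℕ} (h : n ≤ s.length) : ov A (s ++ l) n = ov A s n :=
  ov_congr fun _ hi => getElem?_append_lt (hi.trans_le h)

theorem pv_append {l : JSeq M} {n : ℕ} (h : n ≤ s.length) : pv A (s ++ l) n = pv A s n :=
  pv_congr fun _ hi => getElem?_append_lt (hi.trans_le h)

theorem getElem?_take_lt {n i : ℕ} (h : i < n) : (s.take n)[i]? = s[i]? := by
  rw [List.getElem?_take]; simp [h]

theorem oview_take {n : ℕ} (h : n ≤ s.length) : oview A (s.take n) = ov A s n := by
  change ov A (s.take n) (s.take n).length = _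
  rw [List.length_take, min_eq_left h]
  exact ov_congr fun _ hi => getElem?_take_lt hi

theorem pview_take {n : ℕ} (h : n ≤ s.length) : pview A (s.take n) = pv A s n := by
  change pv A (s.take n) (s.take n).length = _
  rw [List.length_take, min_eq_left h]
  exact pv_congr fun _ hi => getElem?_take_lt hi

theorem idxOf?_map_of_injOn {c : ℕ → ℕ} {S : Set ℕ} (hc : Set.InjOn c S) {l : List ℕ}
    (hl : ∀ i ∈ l, i ∈ S) {j : ℕ} (hj : j ∈ S) : (l.map c).idxOf? (c j) = l.idxOf? j := by
  induction l with
  | nil => rfl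
  | cons a l ih =>
    rw [List.map_cons, List.idxOf?_cons, List.idxOf?_cons, ih fun i hi => hl i (by simp [hi])]
    have : (c a == c j) = (a == j) := by
      rw [Bool.eq_iff_iff, beq_iff_eq, beq_iff_eq]
      exact hc.eq_iff (hl a (by simp)) hj
    rw [this]

/-- A renumbering of positions that is injective on the positions concerned, and preserves moves
and pointers, does not change the selected subsequence. -/
theorem select_map {l : List ℕ} {c : ℕ → ℕ} {S : Set ℕ} (hc : Set.InjOn c S)
    (hl : ∀ i ∈ l, i ∈ S) (h : ∀ i ∈ l, ∃ m p, s[i]? = some (m, p) ∧ (∀ j, p = some j → j ∈ S) ∧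
      t[c i]? = some (m, p.map c)) : t.select (l.map c) = s.select l := by
  unfold JSeq.select
  rw [List.filterMap_map]
  refine List.filterMap_congr fun i hi => ?_
  obtain ⟨m, p, h1, h2, h3⟩ := h i hi
  simp only [Function.comp, h1, h3, Option.map_some]
  cases p with
  | none => rfl
  | some j => simp [idxOf?_map_of_injOn hc hl (h2 j rfl)]

theorem idxOf?_append_of_ne {l : List ℕ} {n j : ℕ} (h : j ≠ n) :
    (l ++ [n]).idxOf? j = l.idxOf? j := by
  induction l with
  | nil => simp [h.symm]
  | cons a l ih => rw [List.cons_append, List.idxOf?_cons, List.idxOf?_cons, ih]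

theorem select_snoc (hw : PtrLt s) {l : List ℕ} {n : ℕ} (hl : ∀ i ∈ l, i < n) {m : M}
    {p : Option ℕ} (hn : s[n]? = some (m, p)) :
    s.select (l ++ [n]) = s.select l ++ [(m, p.bind fun j => l.idxOf? j)] := by
  unfold JSeq.select
  rw [List.filterMap_append]
  congr 1
  · refine List.filterMap_congr fun i hi => ?_
    rcases h : s[i]? with _ | ⟨m', _ | j⟩
    · rfl
    · rfl
    · have h1 := hw i m' j h
      have h2 := hl i hi
      simp [idxOf?_append_of_ne (l := l) (show j ≠ n by omega)]
  · cases p with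
    | none => simp [hn]
    | some j =>
      have h1 := hw n m j hn
      simp [hn, idxOf?_append_of_ne (l := l) (show j ≠ n by omega)]

theorem ov_succ_of_O (hw : PtrLt s) {n : ℕ} {m : M} {p : Option ℕ} (h : s[n]? = some (m, p))
    (hm : A.role m = .O) :
    ov A s (n + 1) = ov A s n ++ [(m, p.bind fun j => (oviewIdx A s n).idxOf? j)] := by
  rw [ov, oviewIdx_of_O h hm, select_snoc hw (fun i hi => lt_of_mem_oviewIdx hi) h, ov]

theorem pv_succ_of_P (hw : PtrLt s) {n : ℕ} {m : M} {p : Option ℕ} (h : s[n]? = some (m, p))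
    (hm : A.role m = .P) :
    pv A s (n + 1) = pv A s n ++ [(m, p.bind fun j => (pviewIdx A s n).idxOf? j)] := by
  rw [pv, pviewIdx_of_P h hm, select_snoc hw (fun i hi => lt_of_mem_pviewIdx hi) h, pv]

theorem idxOf?_inj {l : List ℕ} {j j' : ℕ} (hj : j ∈ l) (h : l.idxOf? j = l.idxOf? j') :
    j = j' := by
  induction l with
  | nil => simp at hj
  | cons a l ih =>
    rw [List.idxOf?_cons, List.idxOf?_cons] at h
    by_cases h1 : a = j <;> by_cases h2 : a = j'
    · rw [← h1, h2]
    · simp [h1] at h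
      exact h
    · simp [h2] at h
      exact h.symm
    · have hj' : j ∈ l := by simpa [Ne.symm h1] using hj
      simp only [beq_iff_eq, h1, h2, if_false] at h
      exact ih hj' (Option.map_injective (fun _ _ => Nat.succ.inj) h)

/-- Pointers into a list of positions are determined by their renumbering. -/
theorem bind_idxOf?_inj {l : List ℕ} {p p' : Option ℕ} (hp : ∀ j, p = some j → j ∈ l)
    (hp' : ∀ j, p' = some j → j ∈ l)
    (h : (p.bind fun j => l.idxOf? j) = p'.bind fun j => l.idxOf? j) : p = p' := by
  rcases p with _ | j <;> rcases p' with _ | j'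
  · rfl
  · have := (List.idxOf?_eq_none_iff (l := l) (a := j')).1 (by simpa using h.symm)
    exact absurd (hp' j' rfl) this
  · have := (List.idxOf?_eq_none_iff (l := l) (a := j)).1 (by simpa using h)
    exact absurd (hp j rfl) this
  · rw [idxOf?_inj (hp j rfl) (by simpa using h)]

end Basics

section LegalFacts

variable {M : Type*} {A : Arena M} {s t : JSeq M}

theorem Legal.ptrLt (hs : Legal A s) : PtrLt s := by
  intro i m j h
  rcases hs.justified i m _ h with ⟨_, h⟩ | ⟨j', _, _, h, h', _⟩
  · simp at h
  · obtain rfl := Option.some.inj h; exact h'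

theorem Legal.role_iff (hs : Legal A s) {i : ℕ} {m : M} {p : Option ℕ} (h : s[i]? = some (m, p)) :
    A.role m = .O ↔ Even i := by
  induction i generalizing m p with
  | zero =>
    rcases hs.justified 0 m p h with ⟨h1, _⟩ | ⟨j, _, _, _, h1, _⟩
    · simp [A.init_role m h1]
    · omega
  | succ i ih =>
    obtain ⟨m', p', h'⟩ := exists_getElem? (s := s) (i := i) (by
      have := lt_length_of_getElem? h; omega)
    have h1 := hs.alternating i _ _ h' h
    have h2 := ih h'
    rw [Nat.even_add_one, ← h2]
    revert h1
    simp only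
    cases A.role m <;> cases A.role m' <;> simp

theorem Legal.role_O (hs : Legal A s) {i : ℕ} {m : M} {p : Option ℕ} (h : s[i]? = some (m, p))
    (hi : Even i) : A.role m = .O := (hs.role_iff h).2 hi

theorem Legal.role_P (hs : Legal A s) {i : ℕ} {m : M} {p : Option ℕ} (h : s[i]? = some (m, p))
    (hi : ¬ Even i) : A.role m = .P := by
  have := mt (hs.role_iff h).1 hi
  cases h : A.role m <;> simp_all

theorem Legal.init_iff (hs : Legal A s) {i : ℕ} {m : M} {p : Option ℕ} (h : s[i]? = some (m, p)) :
    A.init m ↔ p = none := by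
  rcases hs.justified i m p h with ⟨h1, h2⟩ | ⟨j, m', p', rfl, h2, h3, h4⟩
  · simp [h1, h2]
  · simpa using fun hi => A.init_not_enabled m' m hi h4

/-- Initial moves belong to Opponent, so Player's moves have pointers; they go to even positions, as
a move and its justifier belong to different participants. -/
theorem Legal.exists_ptr_of_P (hs : Legal A s) {i : ℕ} {m : M} {p : Option ℕ}
    (h : s[i]? = some (m, p)) (hi : ¬ Even i) : ∃ j, p = some j ∧ j < i ∧ Even j := by
  rcases hs.justified i m p h with ⟨h1, h2⟩ | ⟨j, m', p', rfl, h2, h3, h4⟩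
  · exact absurd ((hs.role_iff h).1 (A.init_role m h1)) hi
  · refine ⟨j, rfl, h2, (hs.role_iff h3).1 ?_⟩
    have := A.enables_role m' m h4
    rw [hs.role_P h hi] at this
    cases h : A.role m' <;> simp_all

theorem Legal.odd_ptr_of_O (hs : Legal A s) {i j : ℕ} {m : M}
    (h : s[i]? = some (m, some j)) (hi : Even i) : j < i ∧ ¬ Even j := by
  rcases hs.justified i m _ h with ⟨h1, h2⟩ | ⟨j', m', p', h1, h2, h3, h4⟩
  · simp at h2
  · obtain rfl := Option.some.inj h1
    refine ⟨h2, fun hj => ?_⟩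
    have := A.enables_role m' m h4
    rw [hs.role_O h hi, hs.role_O h3 hj] at this
    exact this rfl

theorem Legal.append_left {l : JSeq M} (hs : Legal A (s ++ l)) : Legal A s where
  justified i m p h := by
    have hi := lt_length_of_getElem? h
    rcases hs.justified i m p (by rwa [getElem?_append_lt hi]) with h1 | ⟨j, m', p', h1, h2, h3, h4⟩
    · exact Or.inl h1
    · exact Or.inr ⟨j, m', p', h1, h2, by rwa [getElem?_append_lt (h2.trans hi)] at h3, h4⟩
  alternating i x y hx hy := by
    have hi := lt_length_of_getElem? hx
    have hi' := lt_length_of_getElem? hy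
    exact hs.alternating i x y (by rwa [getElem?_append_lt hi]) (by rwa [getElem?_append_lt hi'])
  visible_P i m j h hm := by
    have hi := lt_length_of_getElem? h
    have := hs.visible_P i m j (by rwa [getElem?_append_lt hi]) hm
    rwa [pviewIdx_append hi.le] at this
  visible_O i m j h hm := by
    have hi := lt_length_of_getElem? h
    have := hs.visible_O i m j (by rwa [getElem?_append_lt hi]) hm
    rwa [oviewIdx_append hi.le] at this
  bracketed i m j h hm := by
    have hi := lt_length_of_getElem? h
    have := hs.bracketed i m j (by rwa [getElem?_append_lt hi]) hm
    rwa [pending_append hi.le] at this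

theorem Legal.of_prefix (ht : Legal A t) (h : s <+: t) : Legal A s := by
  obtain ⟨l, rfl⟩ := h; exact ht.append_left

theorem Legal.take (hs : Legal A s) (n : ℕ) : Legal A (s.take n) :=
  hs.of_prefix (List.take_prefix n s)

theorem legal_nil : Legal A ([] : JSeq M) := by
  constructor <;> simp

theorem Legal.snoc (hs : Legal A s) {m : M} {p : Option ℕ}
    (hj : (A.init m ∧ p = none) ∨ ∃ (j : ℕ) (m' : M) (p' : Option ℕ), p = some j ∧
      s[j]? = some (m', p') ∧ A.enables m' m)
    (hr : A.role m = .O ↔ Even s.length)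
    (hP : ∀ j, p = some j → A.role m = .P → j ∈ pviewIdx A s s.length)
    (hO : ∀ j, p = some j → A.role m = .O → j ∈ oviewIdx A s s.length)
    (hb : ∀ j, p = some j → A.kind m = .answer → pending A s s.length = some j) :
    Legal A (s ++ [(m, p)]) := by
  have key : ∀ i x, (s ++ [(m, p)])[i]? = some x → (i < s.length ∧ s[i]? = some x) ∨
      (i = s.length ∧ x = (m, p)) := by
    intro i x h
    rcases lt_trichotomy i s.length with hi | hi | hi
    · rw [getElem?_append_lt hi] at h
      exact Or.inl ⟨hi, h⟩
    · subst hi; simp at h; exact Or.inr ⟨rfl, h.symm⟩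
    · have := lt_length_of_getElem? h
      simp at this; omega
  constructor
  · intro i m₁ p₁ h
    rcases key i _ h with ⟨hi, h⟩ | ⟨rfl, he⟩
    · rcases hs.justified i _ _ h with h1 | ⟨j, m', p', h1, h2, h3, h4⟩
      · exact Or.inl h1
      · exact Or.inr ⟨j, m', p', h1, h2, by rwa [getElem?_append_lt (h2.trans hi)], h4⟩
    · cases he
      rcases hj with h1 | ⟨j, m', p', h1, h2, h3⟩
      · exact Or.inl h1
      · have := lt_length_of_getElem? h2
        exact Or.inr ⟨j, m', p', h1, this, by rwa [getElem?_append_lt this], h3⟩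
  · intro i x y hx hy
    rcases key i _ hx with ⟨hi, hx⟩ | ⟨rfl, hx⟩
    · rcases key _ _ hy with ⟨hi', hy⟩ | ⟨hi', hy⟩
      · exact hs.alternating i x y hx hy
      · subst hy
        have := hs.role_iff hx
        rw [← hi', Nat.even_add_one, ← this] at hr
        intro h
        rw [h] at hr
        simp at hr
    · have := lt_length_of_getElem? hy
      simp at this
  · intro i m₁ j h hm
    rcases key i _ h with ⟨hi, h⟩ | ⟨rfl, he⟩
    · rw [pviewIdx_append hi.le]; exact hs.visible_P i _ j h hm
    · cases he; rw [pviewIdx_append le_rfl]; exact hP j rfl hm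
  · intro i m₁ j h hm
    rcases key i _ h with ⟨hi, h⟩ | ⟨rfl, he⟩
    · rw [oviewIdx_append hi.le]; exact hs.visible_O i _ j h hm
    · cases he; rw [oviewIdx_append le_rfl]; exact hO j rfl hm
  · intro i m₁ j h hm
    rcases key i _ h with ⟨hi, h⟩ | ⟨rfl, he⟩
    · rw [pending_append hi.le]; exact hs.bracketed i _ j h hm
    · cases he; rw [pending_append le_rfl]; exact hb j rfl hm

end LegalFacts

/-! ### Pending questions -/

section PendingQuestions

variable {M : Type*} {A : Arena M} {s t : JSeq M}

theorem Legal.answer_ptr (hs : Legal A s) {i : ℕ} {m : M} {p : Option ℕ}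
    (h : s[i]? = some (m, p)) (hm : A.kind m = .answer) :
    ∃ j, p = some j ∧ j < i ∧ pending A s i = some j := by
  rcases hs.justified i m p h with ⟨h1, _⟩ | ⟨j, _, _, rfl, h2, _⟩
  · rw [A.init_kind m h1] at hm; simp at hm
  · exact ⟨j, rfl, h2, hs.bracketed i m j h hm⟩

/-- The pending question after a last move: either this move itself is a question, or it is an
answer to the previous pending question `j`, and what was pending before `j` is pending again. -/
theorem Legal.pending_succ (hs : Legal A s) {n : ℕ} (hn : n < s.length) :
    (∃ m p, s[n]? = some (m, p) ∧ A.kind m = .question ∧ pending A s (n + 1) = some n) ∨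
    ∃ m j, s[n]? = some (m, some j) ∧ A.kind m = .answer ∧ j < n ∧ pending A s n = some j ∧
      pending A s (n + 1) = pending A s j := by
  obtain ⟨m, p, h⟩ := exists_getElem? hn
  cases hk : A.kind m with
  | question => exact Or.inl ⟨m, p, h, hk, pending_of_question h hk⟩
  | answer =>
    obtain ⟨j, rfl, h1, h2⟩ := hs.answer_ptr h hk
    exact Or.inr ⟨m, j, h, hk, h1, h2, pending_of_answer h hk h1⟩

theorem Legal.pending_spec (hs : Legal A s) {n j : ℕ} (hn : n ≤ s.length)
    (h : pending A s n = some j) :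
    j < n ∧ ∃ m p, s[j]? = some (m, p) ∧ A.kind m = .question := by
  induction n using Nat.strong_induction_on with
  | _ n ih =>
    cases n with
    | zero => simp [pending] at h
    | succ n =>
      rcases hs.pending_succ hn with ⟨m, p, h1, h2, h3⟩ | ⟨m, j', h1, h2, h3, h4, h5⟩
      · obtain rfl : n = j := by rw [h3] at h; exact Option.some.inj h
        exact ⟨by omega, m, p, h1, h2⟩
      · have := ih j' (by omega) (by omega) (h5 ▸ h)
        exact ⟨by omega, this.2⟩

/-- As long as a question is pending, the question pending at any time since it was asked is this
one or a later one. -/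
theorem Legal.pending_between (hs : Legal A s) {n j : ℕ} (hn : n ≤ s.length)
    (h : pending A s n = some j) {k : ℕ} (hk : j < k) (hkn : k ≤ n) :
    ∃ p, pending A s k = some p ∧ j ≤ p := by
  induction n using Nat.strong_induction_on generalizing j with
  | _ n ih =>
    rcases eq_or_lt_of_le hkn with rfl | hkn
    · exact ⟨j, h, le_rfl⟩
    cases n with
    | zero => simp [pending] at h
    | succ n =>
      rcases hs.pending_succ hn with ⟨m, p, h1, h2, h3⟩ | ⟨m, j', h1, h2, h3, h4, h5⟩
      · obtain rfl : n = j := by rw [h3] at h; exact Option.some.inj h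
        omega
      · rw [h5] at h
        have hj := (hs.pending_spec (by omega) h).1
        rcases le_or_gt k j' with hk' | hk'
        · exact ih j' (by omega) (by omega) h hk hk'
        · obtain ⟨p, hp, hp'⟩ := ih n (by omega) (by omega) h4 hk' (by omega)
          exact ⟨p, hp, by omega⟩

/-- A pending question has not been answered. -/
theorem Legal.pending_unanswered (hs : Legal A s) {n j : ℕ} (hn : n ≤ s.length)
    (h : pending A s n = some j) {k : ℕ} {m : M} (hk : k < n) (hkm : s[k]? = some (m, some j)) :
    A.kind m = .question := by
  by_contra hm
  have hm : A.kind m = .answer := by cases h : A.kind m <;> simp_all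
  obtain ⟨j', h1, h2, h3⟩ := hs.answer_ptr hkm hm
  obtain rfl := Option.some.inj h1
  obtain ⟨p, hp, hp'⟩ := hs.pending_between hn h (k := k + 1) (by omega) (by omega)
  rw [pending_of_answer hkm hm h2] at hp
  have := (hs.pending_spec (by omega) hp).1
  omega

/-- Every question asked after the pending one has been answered. -/
theorem Legal.answered (hs : Legal A s) {n : ℕ} (hn : n ≤ s.length) {i : ℕ} {m : M}
    {p : Option ℕ} (hin : i < n) (hi : s[i]? = some (m, p)) (hm : A.kind m = .question)
    (h : ∀ j, pending A s n = some j → j < i) :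
    ∃ (k : ℕ) (m' : M), s[k]? = some (m', some i) ∧ A.kind m' = .answer := by
  induction n using Nat.strong_induction_on with
  | _ n ih =>
    cases n with
    | zero => omega
    | succ n =>
      rcases hs.pending_succ hn with ⟨m', p', h1, h2, h3⟩ | ⟨m', j', h1, h2, h3, h4, h5⟩
      · have := h n h3
        omega
      · rcases lt_trichotomy i j' with hj | rfl | hj
        · exact ih j' (by omega) (by omega) hj (by rwa [← h5])
        · exact ⟨n, m', h1, h2⟩
        · refine ih n (by omega) (by omega) ?_ ?_
          · rcases eq_or_lt_of_le (Nat.lt_succ_iff.1 hin) with rfl | h'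
            · rw [h1] at hi
              cases hi
              rw [h2] at hm; cases hm
            · exact h'
          · intro j hj'
            rw [h4] at hj'
            cases hj'
            exact hj

theorem Legal.complete_iff (hs : Legal A s) : Complete A s ↔ pending A s s.length = none := by
  constructor
  · intro hc
    by_contra hne
    obtain ⟨j, hj⟩ := Option.ne_none_iff_exists'.1 hne
    obtain ⟨h1, m, p, h2, h3⟩ := hs.pending_spec le_rfl hj
    obtain ⟨k, m', h4, h5⟩ := hc j m p h2 h3
    have := hs.pending_unanswered le_rfl hj (lt_length_of_getElem? h4) h4
    rw [h5] at this; cases this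
  · intro h i m p hi hm
    exact hs.answered le_rfl (lt_length_of_getElem? hi) hi hm (by simp [h])

/-- The O-view grows from one position with nothing pending to a later one: the last answer closes a
question asked while nothing was pending, and the O-view jumps back to that question. -/
theorem Legal.length_oviewIdx_lt (hs : Legal A s) {n n' : ℕ} (hn' : n' ≤ s.length) (h : n < n')
    (hp : pending A s n = none) (hp' : pending A s n' = none) (he' : Even n') :
    (oviewIdx A s n).length < (oviewIdx A s n').length := by
  induction n' using Nat.strong_induction_on with
  | _ n' ih =>
    cases n' with
    | zero => omega
    | succ n' =>
      rcases hs.pending_succ hn' with ⟨m, p, h1, h2, h3⟩ | ⟨m, j, h1, h2, h3, h4, h5⟩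
      · rw [h3] at hp'; simp at hp'
      · have ho : ¬ Even n' := by rwa [← Nat.even_add_one]
        rw [oviewIdx_of_P h1 (hs.role_P h1 ho) h3]
        have hj : Even j := by
          obtain ⟨j', h6, _, h7⟩ := hs.exists_ptr_of_P h1 ho
          rwa [Option.some.inj h6]
        have hnj : n ≤ j := by
          by_contra hc
          obtain ⟨p, hp1, _⟩ := hs.pending_between (by omega) h4 (k := n) (by omega) (by omega)
          rw [hp] at hp1; simp at hp1
        rcases eq_or_lt_of_le hnj with rfl | hnj
        · simp
        · have := ih j (by omega) (by omega) hnj (h5 ▸ hp') hj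
          simp; omega

theorem length_select {l : List ℕ} (h : ∀ i ∈ l, i < s.length) :
    (s.select l).length = l.length := by
  induction l with
  | nil => rfl
  | cons i l ih =>
    unfold JSeq.select
    have : ∀ (l' : List ℕ) (f : ℕ → Option ℕ), (∀ i ∈ l', i < s.length) →
        (l'.filterMap fun i => s[i]?.map fun x => (x.1, x.2.bind f)).length = l'.length := by
      intro l' f hl'
      induction l' with
      | nil => rfl
      | cons a l' ih' =>
        have ha := hl' a (by simp)
        rw [List.filterMap_cons]
        simp only [List.getElem?_eq_getElem ha, Option.map_some, List.length_cons]
        rw [ih' fun i hi => hl' i (by simp [hi])]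
    exact this _ _ h

theorem length_ov {n : ℕ} (h : n ≤ s.length) : (ov A s n).length = (oviewIdx A s n).length :=
  length_select fun _ hi => (lt_of_mem_oviewIdx hi).trans_le h

theorem idxOf?_append_of_mem {l l' : List ℕ} {j : ℕ} (h : j ∈ l) :
    (l ++ l').idxOf? j = l.idxOf? j := by
  induction l with
  | nil => simp at h
  | cons a l ih =>
    rw [List.cons_append, List.idxOf?_cons, List.idxOf?_cons]
    by_cases ha : a = j
    · simp [ha]
    · rw [ih (by simpa [Ne.symm ha] using h)]

theorem idxOf?_snoc {l : List ℕ} {j : ℕ} (h : j ∉ l) :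
    (l ++ [j]).idxOf? j = some l.length := by
  induction l with
  | nil => simp
  | cons a l ih =>
    have ha : a ≠ j := fun hc => h (by simp [hc])
    rw [List.cons_append, List.idxOf?_cons, ih fun hc => h (by simp [hc])]
    simp [ha]

/-- Both views grow by a justifier and a move that it justifies; the pending question can then be
read off the longer view if it could be read off the shorter one. -/
theorem pending_select_step (hs : Legal A s) {l : List ℕ} {j n : ℕ} (hl : ∀ i ∈ l, i < j)
    (hn : n < s.length) {m : M} (h : s[n]? = some (m, some j))
    (hp : ∀ k, pending A s j = some k → k ∈ l)
    (ih : pending A (s.select l) l.length = (pending A s j).bind fun k => l.idxOf? k) :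
    (∀ k, pending A s (n + 1) = some k → k ∈ l ++ [j, n]) ∧
    pending A (s.select (l ++ [j, n])) (l ++ [j, n]).length =
      (pending A s (n + 1)).bind fun k => (l ++ [j, n]).idxOf? k := by
  have hjn := hs.ptrLt n m j h
  obtain ⟨mj, pj, hj⟩ := exists_getElem? (s := s) (i := j) (by omega)
  have e1 : s.select (l ++ [j]) = s.select l ++ [_] := select_snoc hs.ptrLt hl hj
  have hl' : ∀ i ∈ l ++ [j], i < n := by
    intro i hi
    rcases List.mem_append.1 hi with hi | hi
    · have := hl i hi; omega
    · simp at hi; omega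
  have e2 : s.select (l ++ [j] ++ [n]) = s.select (l ++ [j]) ++ [_] := select_snoc hs.ptrLt hl' h
  have hjl : j ∉ l := fun hc => by have := hl j hc; omega
  have hnl : n ∉ l ++ [j] := fun hc => by have := hl' n hc; omega
  have hlen : (s.select (l ++ [j])).length = l.length + 1 := by
    rw [length_select fun i hi => (hl' i hi).trans hn]; simp
  have hlen' : (s.select l).length = l.length :=
    length_select fun i hi => (hl i hi).trans (hjn.trans hn)
  rw [show l ++ [j, n] = l ++ [j] ++ [n] by simp]
  set v := s.select (l ++ [j] ++ [n])
  have hvn : v[l.length + 1]? = some (m, some l.length) := by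
    rw [e2, ← hlen, List.getElem?_concat_length]
    simp [idxOf?_snoc hjl]
  rw [show (l ++ [j] ++ [n]).length = l.length + 1 + 1 by simp]
  rcases hs.pending_succ hn with ⟨m', p, h1, h2, h3⟩ | ⟨m', j', h1, h2, h3, h4, h5⟩
  · rw [h] at h1; cases h1
    rw [h3, pending_of_question hvn h2]
    simp [idxOf?_snoc hnl, -List.append_assoc]
  · rw [h] at h1; cases h1
    rw [h5, pending_of_answer hvn h2 (by omega)]
    refine ⟨fun k hk => by simp [hp k hk], ?_⟩
    have : pending A v l.length = pending A (s.select l) l.length := by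
      rw [e2, e1, List.append_assoc, pending_append hlen'.ge]
    rw [this, ih]
    cases hq : pending A s j with
    | none => rfl
    | some k =>
      have := hp k hq
      simp only [Option.bind_some]
      rw [List.append_assoc, idxOf?_append_of_mem this]

/-- At Opponent's turn, the pending question lies in the O-view and is determined by it. -/
theorem Legal.pending_ov (hs : Legal A s) {n : ℕ} (hn : n ≤ s.length) (he : Even n) :
    (∀ k, pending A s n = some k → k ∈ oviewIdx A s n) ∧
    pending A (ov A s n) (oviewIdx A s n).length =
      (pending A s n).bind fun k => (oviewIdx A s n).idxOf? k := by
  induction n using Nat.strong_induction_on with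
  | _ n ih =>
    cases n with
    | zero => simp [pending, oviewIdx]
    | succ n =>
      obtain ⟨m, p, h⟩ := exists_getElem? (s := s) (i := n) (by omega)
      have ho : ¬ Even n := by rwa [← Nat.even_add_one]
      obtain ⟨j, rfl, h1, h2⟩ := hs.exists_ptr_of_P h ho
      have := ih j (by omega) (by omega) h2
      rw [ov, oviewIdx_of_P h (hs.role_P h ho) h1]
      exact pending_select_step hs (fun i hi => lt_of_mem_oviewIdx hi) (by omega) h this.1 this.2

/-- At Player's turn, the pending question lies in the P-view and is determined by it. -/
theorem Legal.pending_pv (hs : Legal A s) {n : ℕ} (hn : n ≤ s.length) (he : ¬ Even n) :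
    (∀ k, pending A s n = some k → k ∈ pviewIdx A s n) ∧
    pending A (pv A s n) (pviewIdx A s n).length =
      (pending A s n).bind fun k => (pviewIdx A s n).idxOf? k := by
  induction n using Nat.strong_induction_on with
  | _ n ih =>
    cases n with
    | zero => simp [pending, pviewIdx]
    | succ n =>
      obtain ⟨m, p, h⟩ := exists_getElem? (s := s) (i := n) (by omega)
      have ho : Even n := by rw [Nat.even_add_one] at he; simpa using he
      rw [pv]
      cases p with
      | none =>
        have hq := A.init_kind m ((hs.init_iff h).2 rfl)
        rw [pviewIdx_of_none h (hs.role_O h ho), pending_of_question h hq]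
        refine ⟨by simp, ?_⟩
        have : (s.select [n])[0]? = some (m, none) := by simp [JSeq.select, h]
        rw [show [n].length = 0 + 1 from rfl, pending_of_question this hq]
        simp
      | some j =>
        obtain ⟨h1, h2⟩ := hs.odd_ptr_of_O h ho
        have := ih j (by omega) (by omega) h2
        rw [pviewIdx_of_O h (hs.role_O h ho) h1]
        exact pending_select_step hs (fun i hi => lt_of_mem_pviewIdx hi) (by omega) h this.1 this.2

theorem getElem?_select {l : List ℕ} (h : ∀ i ∈ l, i < s.length) (k : ℕ) :
    (s.select l)[k]? = (l[k]?).bind fun i => s[i]?.map fun x =>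
      (x.1, x.2.bind fun j => l.idxOf? j) := by
  unfold JSeq.select
  generalize (fun j => l.idxOf? j) = f
  induction l generalizing k with
  | nil => simp
  | cons a l ih =>
    have ha := h a (by simp)
    rw [List.filterMap_cons]
    simp only [List.getElem?_eq_getElem ha, Option.map_some]
    cases k with
    | zero => simp [List.getElem?_eq_getElem ha]
    | succ k => simpa using ih (fun i hi => h i (by simp [hi])) k

theorem pairwise_lt_oviewIdx (n : ℕ) : (oviewIdx A s n).Pairwise (· < ·) := by
  induction n using Nat.strong_induction_on with
  | _ n ih =>
    cases n with
    | zero => simp [oviewIdx]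
    | succ n =>
      rw [oviewIdx]
      split
      · simp
      · split
        · rw [List.pairwise_append]
          refine ⟨ih n (by omega), by simp, fun a ha b hb => ?_⟩
          have := lt_of_mem_oviewIdx ha
          simp at hb; omega
        · split
          · simp
          · split
            · rename_i j _ hj
              rw [List.pairwise_append]
              refine ⟨ih j (by omega), by simp [hj], fun a ha b hb => ?_⟩
              have := lt_of_mem_oviewIdx ha
              simp at hb; omega
            · simp

theorem pairwise_lt_pviewIdx (n : ℕ) : (pviewIdx A s n).Pairwise (· < ·) := by
  induction n using Nat.strong_induction_on with
  | _ n ih =>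
    cases n with
    | zero => simp [pviewIdx]
    | succ n =>
      rw [pviewIdx]
      split
      · simp
      · split
        · rw [List.pairwise_append]
          refine ⟨ih n (by omega), by simp, fun a ha b hb => ?_⟩
          have := lt_of_mem_pviewIdx ha
          simp at hb; omega
        · split
          · simp
          · split
            · rename_i j _ hj
              rw [List.pairwise_append]
              refine ⟨ih j (by omega), by simp [hj], fun a ha b hb => ?_⟩
              have := lt_of_mem_pviewIdx ha
              simp at hb; omega
            · simp

theorem nodup_oviewIdx (n : ℕ) : (oviewIdx A s n).Nodup :=
  (pairwise_lt_oviewIdx n).imp fun h => h.ne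

theorem nodup_pviewIdx (n : ℕ) : (pviewIdx A s n).Nodup :=
  (pairwise_lt_pviewIdx n).imp fun h => h.ne

theorem idxOf?_getElem {l : List ℕ} (hl : l.Nodup) {k : ℕ} {j : ℕ} (h : l[k]? = some j) :
    l.idxOf? j = some k := by
  obtain ⟨h1, h2⟩ := List.getElem?_eq_some_iff.1 h
  rw [List.idxOf?_eq_some_iff]
  refine ⟨h1, h2, fun i hi hc => ?_⟩
  have := (List.Nodup.getElem_inj_iff hl).1 (hc.trans h2.symm)
  omega

/-- Positions with the same number in equal views carry the same move. -/
theorem exists_of_select_eq {l l' : List ℕ} (h : ∀ i ∈ l, i < s.length)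
    (h' : ∀ i ∈ l', i < t.length) (hl' : l'.Nodup) (heq : s.select l = t.select l') {j : ℕ}
    (hj : j ∈ l) {m : M} {p : Option ℕ} (hm : s[j]? = some (m, p)) :
    ∃ j' ∈ l', l'.idxOf? j' = l.idxOf? j ∧ ∃ p', t[j']? = some (m, p') := by
  obtain ⟨k, hk⟩ := Option.isSome_iff_exists.1 (List.isSome_idxOf?.2 hj)
  obtain ⟨hk1, hk2, -⟩ := List.idxOf?_eq_some_iff.1 hk
  have e1 := getElem?_select h k
  have hlk : l[k]? = some j := by rw [List.getElem?_eq_getElem hk1, hk2]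
  rw [heq, getElem?_select h', hlk, Option.bind_some, hm, Option.map_some] at e1
  obtain ⟨j', h1, h2⟩ := Option.bind_eq_some_iff.1 e1
  obtain ⟨⟨m', p'⟩, h3, h4⟩ := Option.map_eq_some_iff.1 h2
  refine ⟨j', List.mem_of_getElem? h1, (idxOf?_getElem hl' h1).trans hk.symm, p', ?_⟩
  rw [h3, show m' = m from (Prod.mk.inj h4).1]

theorem length_select_eq_of_eq {l l' : List ℕ} (h : ∀ i ∈ l, i < s.length)
    (h' : ∀ i ∈ l', i < t.length) (heq : s.select l = t.select l') : l.length = l'.length := by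
  rw [← length_select h, heq, length_select h']

/-- A pointer that has, in a view, the same number as `j'` is a pointer to `j'`. -/
theorem eq_some_of_bind_idxOf? {l l' : List ℕ} {q q' : Option ℕ} {j j' : ℕ} (hj : j' ∈ l')
    (hjj : l'.idxOf? j' = l.idxOf? j) (hq : q = some j)
    (h : (q.bind fun k => l.idxOf? k) = q'.bind fun k => l'.idxOf? k) : q' = some j' := by
  subst hq
  cases q' with
  | none =>
    have := List.isSome_idxOf?.2 hj
    rw [hjj] at this
    simp at h
    simp_all
  | some k => rw [idxOf?_inj hj (hjj.trans (by simpa using h))]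

/-- Opponent can repeat a move at any position with the same O-view. -/
theorem Legal.exists_snoc_of_ov_eq (hs : Legal A s) (ht : Legal A t) {n : ℕ} (he : Even n)
    (het : Even t.length) (hv : ov A s n = ov A t t.length) {m : M} {p : Option ℕ}
    (h : s[n]? = some (m, p)) :
    ∃ p', Legal A (t ++ [(m, p')]) ∧
      ov A (t ++ [(m, p')]) (t.length + 1) = ov A s (n + 1) ∧
      ((p = none ∧ p' = none) ∨ ∃ j j', p = some j ∧ p' = some j' ∧ j ∈ oviewIdx A s n ∧
        j' ∈ oviewIdx A t t.length ∧
        (oviewIdx A t t.length).idxOf? j' = (oviewIdx A s n).idxOf? j) := by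
  have hn := lt_length_of_getElem? h
  have hm := hs.role_O h he
  have hl : ∀ i ∈ oviewIdx A s n, i < s.length := fun i hi => (lt_of_mem_oviewIdx hi).trans hn
  have hl' : ∀ i ∈ oviewIdx A t t.length, i < t.length := fun i hi => lt_of_mem_oviewIdx hi
  have fin : ∀ p', Legal A (t ++ [(m, p')]) →
      (p.bind fun j => (oviewIdx A s n).idxOf? j) =
        (p'.bind fun j => (oviewIdx A t t.length).idxOf? j) →
      ov A (t ++ [(m, p')]) (t.length + 1) = ov A s (n + 1) := by
    intro p' hp' hpp
    rw [ov_succ_of_O hs.ptrLt h hm, ov_succ_of_O hp'.ptrLt (m := m) (p := p') (by simp) hm, hv,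
      ov_append le_rfl, oviewIdx_append le_rfl, hpp]
  rcases hs.justified n m p h with ⟨h1, rfl⟩ | ⟨j, m', p₁, rfl, h2, h3, h4⟩
  · have : Legal A (t ++ [(m, none)]) := ht.snoc (Or.inl ⟨h1, rfl⟩) (by simp [hm, het])
      (by simp) (by simp) (by simp)
    exact ⟨none, this, fin _ this rfl, Or.inl ⟨rfl, rfl⟩⟩
  · have hjv := hs.visible_O n m j h hm
    obtain ⟨j', h5, h6, p', h7⟩ := exists_of_select_eq hl hl' (nodup_oviewIdx _) hv hjv h3
    have : Legal A (t ++ [(m, some j')]) := by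
      refine ht.snoc (Or.inr ⟨j', m', p', rfl, h7, h4⟩) (by simp [hm, het]) ?_ ?_ ?_
      · intro _ _ hc; rw [hm] at hc; cases hc
      · intro _ hj _; cases hj; exact h5
      · intro _ hj hk; cases hj
        have e1 := (hs.pending_ov hn.le he).2
        have e2 := (ht.pending_ov le_rfl het).2
        refine eq_some_of_bind_idxOf? h5 h6 (hs.bracketed n m j h hk) ?_
        rw [← e1, ← e2, hv, length_select_eq_of_eq hl hl' hv]
    exact ⟨some j', this, fin _ this (by simp [h6]), Or.inr ⟨j, j', rfl, rfl, hjv, h5, h6⟩⟩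

/-- Player can repeat a move at any position with the same P-view. -/
theorem Legal.exists_snoc_of_pv_eq (hs : Legal A s) (ht : Legal A t) {n : ℕ} (he : ¬ Even n)
    (het : ¬ Even t.length) (hv : pv A s n = pv A t t.length) {m : M} {p : Option ℕ}
    (h : s[n]? = some (m, p)) :
    ∃ j j', Legal A (t ++ [(m, some j')]) ∧
      pv A (t ++ [(m, some j')]) (t.length + 1) = pv A s (n + 1) ∧
      p = some j ∧ j ∈ pviewIdx A s n ∧ j' ∈ pviewIdx A t t.length ∧
      (pviewIdx A t t.length).idxOf? j' = (pviewIdx A s n).idxOf? j := by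
  have hn := lt_length_of_getElem? h
  have hm := hs.role_P h he
  have hl : ∀ i ∈ pviewIdx A s n, i < s.length := fun i hi => (lt_of_mem_pviewIdx hi).trans hn
  have hl' : ∀ i ∈ pviewIdx A t t.length, i < t.length := fun i hi => lt_of_mem_pviewIdx hi
  obtain ⟨j, rfl, -, -⟩ := hs.exists_ptr_of_P h he
  rcases hs.justified n m _ h with ⟨h1, h2⟩ | ⟨j, m', p₁, hj, h2, h3, h4⟩
  · cases h2
  · cases hj
    have hjv := hs.visible_P n m j h hm
    obtain ⟨j', h5, h6, p', h7⟩ := exists_of_select_eq hl hl' (nodup_pviewIdx _) hv hjv h3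
    have hL : Legal A (t ++ [(m, some j')]) := by
      refine ht.snoc (Or.inr ⟨j', m', p', rfl, h7, h4⟩) (by simp [hm, het]) ?_ ?_ ?_
      · intro _ hj _; cases hj; exact h5
      · intro _ _ hc; rw [hm] at hc; cases hc
      · intro _ hj hk; cases hj
        have e1 := (hs.pending_pv hn.le he).2
        have e2 := (ht.pending_pv le_rfl het).2
        refine eq_some_of_bind_idxOf? h5 h6 (hs.bracketed n m j h hk) ?_
        rw [← e1, ← e2, hv, length_select_eq_of_eq hl hl' hv]
    refine ⟨j, j', hL, ?_, rfl, hjv, h5, h6⟩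
    rw [pv_succ_of_P hs.ptrLt h hm, pv_succ_of_P hL.ptrLt (m := m) (p := some j') (by simp) hm, hv,
      pv_append le_rfl, pviewIdx_append le_rfl]
    simp [h6]

/-- Whether a question is pending at Opponent's turn depends only on the O-view. -/
theorem Legal.pending_eq_none_of_ov_eq (hs : Legal A s) (ht : Legal A t) {n n' : ℕ}
    (hn : n ≤ s.length) (hn' : n' ≤ t.length) (he : Even n) (he' : Even n')
    (hv : ov A s n = ov A t n') (h : pending A s n = none) : pending A t n' = none := by
  have e1 := (hs.pending_ov hn he).2
  have e2 := (ht.pending_ov hn' he').2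
  have e3 := (ht.pending_ov hn' he').1
  rw [hv, ← length_ov hn, hv, length_ov hn', e2, h] at e1
  cases hq : pending A t n' with
  | none => rfl
  | some k =>
    rw [hq] at e1
    have := List.isSome_idxOf?.2 (e3 k hq)
    simp at e1
    simp_all

end PendingQuestions

/-! ### Innocent strategies as sets of views -/

section ViewSets

variable {M : Type*} {A : Arena M} {s t : JSeq M} {Φ V : Set (JSeq M)} {G σ : Set (JSeq M)}

/-- A set of views is deterministic if every view has at most one continuation in it. -/
def ViewDet (Φ : Set (JSeq M)) : Prop :=
  ∀ (v : JSeq M) (x y : M × Option ℕ), v ++ [x] ∈ Φ → v ++ [y] ∈ Φ → x = y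

/-- All P-views of `s` reached by Player's moves are in `Φ`. -/
def POk (A : Arena M) (Φ : Set (JSeq M)) (s : JSeq M) : Prop :=
  ∀ i < s.length, ¬ Even i → pv A s (i + 1) ∈ Φ

/-- All O-views of `s` reached by Opponent's moves are in `V`. -/
def OOk (A : Arena M) (V : Set (JSeq M)) (s : JSeq M) : Prop :=
  ∀ i < s.length, Even i → ov A s (i + 1) ∈ V

theorem viewDet_singleton (w : JSeq M) : ViewDet {w} := by
  intro v x y hx hy
  have : v ++ [x] = v ++ [y] := by
    rw [Set.mem_singleton_iff] at hx hy; rw [hx, hy]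
  simpa using this

/-- A deterministic set of O-views determines Opponent's next move. Only the visibility of this move
is needed, so that the lemma applies to sequences that are not legal. -/
theorem eq_of_ov_mem (hV : ViewDet V) (hs : PtrLt s) (ht : PtrLt t) {n : ℕ}
    (hst : ∀ i < n, s[i]? = t[i]?) {m m' : M} {p p' : Option ℕ} (h : s[n]? = some (m, p))
    (h' : t[n]? = some (m', p')) (hm : A.role m = .O) (hm' : A.role m' = .O)
    (hp : ∀ j, p = some j → j ∈ oviewIdx A s n) (hp' : ∀ j, p' = some j → j ∈ oviewIdx A t n)
    (hv : ov A s (n + 1) ∈ V) (hv' : ov A t (n + 1) ∈ V) : (m, p) = (m', p') := by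
  rw [ov_succ_of_O hs h hm, ov_congr hst] at hv
  rw [ov_succ_of_O ht h' hm'] at hv'
  obtain ⟨h1, h2⟩ := Prod.mk.inj (hV _ _ _ hv hv')
  rw [oviewIdx_congr hst] at h2 hp
  rw [h1, bind_idxOf?_inj hp hp' h2]

/-- A deterministic set of P-views determines Player's next move; see `eq_of_ov_mem`. -/
theorem eq_of_pv_mem (hΦ : ViewDet Φ) (hs : PtrLt s) (ht : PtrLt t) {n : ℕ}
    (hst : ∀ i < n, s[i]? = t[i]?) {m m' : M} {p p' : Option ℕ} (h : s[n]? = some (m, p))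
    (h' : t[n]? = some (m', p')) (hm : A.role m = .P) (hm' : A.role m' = .P)
    (hp : ∀ j, p = some j → j ∈ pviewIdx A s n) (hp' : ∀ j, p' = some j → j ∈ pviewIdx A t n)
    (hv : pv A s (n + 1) ∈ Φ) (hv' : pv A t (n + 1) ∈ Φ) : (m, p) = (m', p') := by
  rw [pv_succ_of_P hs h hm, pv_congr hst] at hv
  rw [pv_succ_of_P ht h' hm'] at hv'
  obtain ⟨h1, h2⟩ := Prod.mk.inj (hΦ _ _ _ hv hv')
  rw [pviewIdx_congr hst] at h2 hp
  rw [h1, bind_idxOf?_inj hp hp' h2]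

theorem Legal.eq_of_ov_mem (hV : ViewDet V) (hs : Legal A s) (ht : Legal A t) {n : ℕ}
    (he : Even n) (hst : ∀ i < n, s[i]? = t[i]?) {x y : M × Option ℕ} (h : s[n]? = some x)
    (h' : t[n]? = some y) (hv : ov A s (n + 1) ∈ V) (hv' : ov A t (n + 1) ∈ V) : x = y := by
  obtain ⟨m, p⟩ := x
  obtain ⟨m', p'⟩ := y
  refine InnocentGames.eq_of_ov_mem hV hs.ptrLt ht.ptrLt hst h h' (hs.role_O h he)
    (ht.role_O h' he) ?_ ?_ hv hv'
  · rintro j rfl; exact hs.visible_O _ _ _ h (hs.role_O h he)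
  · rintro j rfl; exact ht.visible_O _ _ _ h' (ht.role_O h' he)

theorem Legal.eq_of_pv_mem (hΦ : ViewDet Φ) (hs : Legal A s) (ht : Legal A t) {n : ℕ}
    (he : ¬ Even n) (hst : ∀ i < n, s[i]? = t[i]?) {x y : M × Option ℕ} (h : s[n]? = some x)
    (h' : t[n]? = some y) (hv : pv A s (n + 1) ∈ Φ) (hv' : pv A t (n + 1) ∈ Φ) : x = y := by
  obtain ⟨m, p⟩ := x
  obtain ⟨m', p'⟩ := y
  refine InnocentGames.eq_of_pv_mem hΦ hs.ptrLt ht.ptrLt hst h h' (hs.role_P h he)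
    (ht.role_P h' he) ?_ ?_ hv hv'
  · rintro j rfl; exact hs.visible_P _ _ _ h (hs.role_P h he)
  · rintro j rfl; exact ht.visible_P _ _ _ h' (ht.role_P h' he)

theorem eq_nil_or_snoc_pair {α : Type*} {l : List α} (h : Even l.length) :
    l = [] ∨ ∃ l' a b, l = l' ++ [a, b] ∧ Even l'.length := by
  rcases List.eq_nil_or_concat l with rfl | ⟨l₁, b, rfl⟩
  · exact Or.inl rfl
  · rcases List.eq_nil_or_concat l₁ with rfl | ⟨l₂, a, rfl⟩
    · simp at h
    · refine Or.inr ⟨l₂, a, b, by simp, ?_⟩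
      simp only [List.concat_eq_append, List.length_append, List.length_singleton] at h
      rwa [Nat.even_add_one, Nat.even_add_one, not_not] at h

theorem pview_append_pair {a b : M × Option ℕ} (hab : Legal A (s ++ [a, b]))
    (he : Even s.length) : ∃ x, pview A (s ++ [a, b]) = pview A (s ++ [a]) ++ [x] := by
  obtain ⟨m, p⟩ := b
  have h : (s ++ [a, (m, p)])[s.length + 1]? = some (m, p) := by
    rw [List.getElem?_append_right (by omega)]; simp
  have e : pview A (s ++ [a, (m, p)]) = pv A (s ++ [a, (m, p)]) (s.length + 1 + 1) := by
    change pv A _ (List.length _) = _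
    simp
  have e' : pview A (s ++ [a]) = pv A (s ++ [a, (m, p)]) (s.length + 1) := by
    rw [show s ++ [a, (m, p)] = s ++ [a] ++ [(m, p)] by simp, pv_append (s := s ++ [a]) (by simp)]
    change pv A _ (List.length _) = _
    simp
  rw [e, e', pv_succ_of_P hab.ptrLt h (hab.role_P h (by rwa [Nat.even_add_one, not_not]))]
  exact ⟨_, rfl⟩

theorem pview_append_pair_inj {a b c : M × Option ℕ} (hb : Legal A (s ++ [a, b]))
    (hc : Legal A (s ++ [a, c])) (he : Even s.length)
    (h : pview A (s ++ [a, b]) = pview A (s ++ [a, c])) : b = c := by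
  have e : ∀ x, pview A (s ++ [a, x]) = pv A (s ++ [a, x]) (s.length + 1 + 1) := by
    intro x
    change pv A _ (List.length _) = _
    simp
  refine hb.eq_of_pv_mem (viewDet_singleton _) hc (n := s.length + 1)
    (by rwa [Nat.even_add_one, not_not]) ?_ ?_ ?_ rfl ?_
  · intro i hi
    rw [show s ++ [a, b] = s ++ [a] ++ [b] by simp, show s ++ [a, c] = s ++ [a] ++ [c] by simp,
      getElem?_append_lt (s := s ++ [a]) (by simpa using hi),
      getElem?_append_lt (s := s ++ [a]) (by simpa using hi)]
  · rw [List.getElem?_append_right (by omega)]; simp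
  · rw [List.getElem?_append_right (by omega)]; simp
  · rw [Set.mem_singleton_iff, ← e, ← e, h]

theorem IsInnocentStrategy.mem_of_append (hσ : IsInnocentStrategy A G σ) (l : JSeq M)
    (h : s ++ l ∈ σ) (he : Even s.length) : s ∈ σ := by
  induction hn : l.length using Nat.strong_induction_on generalizing l with
  | _ n ih =>
    have hel : Even l.length := by
      have := hσ.even_length _ h
      rw [List.length_append, Nat.even_add] at this
      exact this.1 he
    rcases eq_nil_or_snoc_pair hel with rfl | ⟨l', a, b, rfl, -⟩
    · simpa using h
    · refine ih l'.length ?_ l' (hσ.prefix_closed _ a b (by simpa using h)) rfl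
      simp at hn; omega

theorem IsInnocentStrategy.take_mem (hσ : IsInnocentStrategy A G σ) (h : s ∈ σ) {n : ℕ}
    (hn : n ≤ s.length) (he : Even n) : s.take n ∈ σ :=
  hσ.mem_of_append (s.drop n) (by rwa [List.take_append_drop])
    (by rwa [List.length_take, min_eq_left hn])

theorem IsInnocentStrategy.nil_mem (hσ : IsInnocentStrategy A G σ) : [] ∈ σ := by
  obtain ⟨s, hs⟩ := hσ.nonempty
  exact hσ.mem_of_append s (by simpa using hs) (by simp)

theorem IsInnocentStrategy.viewDet (hσ : IsInnocentStrategy A G σ) (hG : G ⊆ plays A)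
    (hGp : ∀ s l, s ++ l ∈ G → s ∈ G) : ViewDet (pview A '' σ) := by
  rintro v x y ⟨s, hs, hsv⟩ ⟨u, hu, huv⟩
  rcases eq_nil_or_snoc_pair (hσ.even_length s hs) with rfl | ⟨s₀, a, b, rfl, h₀⟩
  · simp [pview, pviewIdx, JSeq.select] at hsv
  rcases eq_nil_or_snoc_pair (hσ.even_length u hu) with rfl | ⟨u₀, c, d, rfl, h₁⟩
  · simp [pview, pviewIdx, JSeq.select] at huv
  have ls := hG (hσ.subset_plays hs)
  have lu := hG (hσ.subset_plays hu)
  obtain ⟨x', hx'⟩ := pview_append_pair ls h₀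
  obtain ⟨y', hy'⟩ := pview_append_pair lu h₁
  have hs' := hsv.symm.trans hx'
  have hu' := huv.symm.trans hy'
  obtain ⟨h1, h2⟩ := List.append_inj' hs' rfl
  obtain ⟨h3, h4⟩ := List.append_inj' hu' rfl
  obtain ⟨b', hb', hb''⟩ := hσ.innocent s₀ a b u₀ c hs (hσ.prefix_closed _ _ _ hu)
    (hGp _ [d] (by simpa using hσ.subset_plays hu)) (h3.symm.trans h1)
  obtain rfl := hσ.deterministic _ _ _ _ hb' hu
  have := hsv.symm.trans (hb''.symm.trans huv)
  simpa using this

/-- An innocent strategy is determined by the set of its P-views. -/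
theorem IsInnocentStrategy.mem_iff (hσ : IsInnocentStrategy A G σ) (hG : G ⊆ plays A)
    (hGp : ∀ s l, s ++ l ∈ G → s ∈ G) :
    s ∈ σ ↔ s ∈ G ∧ Even s.length ∧ POk A (pview A '' σ) s := by
  constructor
  · intro h
    refine ⟨hσ.subset_plays h, hσ.even_length s h, fun i hi ho => ?_⟩
    exact ⟨s.take (i + 1), hσ.take_mem h hi (by rwa [Nat.even_add_one]), pview_take hi⟩
  · rintro ⟨h1, h2, h3⟩
    induction hn : s.length using Nat.strong_induction_on generalizing s with
    | _ n ih =>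
      rcases eq_nil_or_snoc_pair h2 with rfl | ⟨s₀, a, b, rfl, h₀⟩
      · exact hσ.nil_mem
      · have ls := hG h1
        have hs₀ : s₀ ∈ σ := by
          refine ih s₀.length (by simp at hn; omega) (hGp _ _ h1) h₀ (fun i hi ho => ?_) rfl
          have := h3 i (by simp; omega) ho
          rwa [pv_append (by omega)] at this
        obtain ⟨u, hu, hu'⟩ := h3 (s₀.length + 1) (by simp) (by rwa [Nat.even_add_one, not_not])
        have e : pv A (s₀ ++ [a, b]) (s₀.length + 1 + 1) = pview A (s₀ ++ [a, b]) := by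
          change _ = pv A _ (List.length _)
          simp
        rw [e] at hu'
        have lu := hG (hσ.subset_plays hu)
        obtain ⟨x, hx⟩ := pview_append_pair ls h₀
        rcases eq_nil_or_snoc_pair (hσ.even_length u hu) with rfl | ⟨u₀, c, d, rfl, h₁⟩
        · rw [hx] at hu'
          simp [pview, pviewIdx, JSeq.select] at hu'
        obtain ⟨y, hy⟩ := pview_append_pair lu h₁
        rw [hx, hy] at hu'
        obtain ⟨h4, h5⟩ := List.append_inj' hu' rfl
        obtain ⟨b', hb', hb''⟩ := hσ.innocent u₀ c d s₀ a hu hs₀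
          (hGp _ [b] (by simpa using h1)) h4.symm
        have : b' = b := pview_append_pair_inj (hG (hσ.subset_plays hb')) ls h₀
          (by rw [hb'', hx, hy, h4, h5])
        rwa [← this]

/-- A deterministic set of views, on positions where Player's replies can be copied between
positions with the same P-view, gives an innocent strategy. -/
theorem isInnocentStrategy_of_views (hG : G ⊆ plays A) (hGp : ∀ s l, s ++ l ∈ G → s ∈ G)
    (hG₀ : [] ∈ G) (hΦ : ViewDet Φ)
    (hext : ∀ (s : JSeq M) (a b : M × Option ℕ) (t : JSeq M) (a' : M × Option ℕ),
      s ++ [a, b] ∈ G → t ++ [a'] ∈ G → Even s.length → Even t.length →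
      pview A (t ++ [a']) = pview A (s ++ [a]) →
      ∃ b', t ++ [a', b'] ∈ G ∧ pview A (t ++ [a', b']) = pview A (s ++ [a, b])) :
    IsInnocentStrategy A G {s | s ∈ G ∧ Even s.length ∧ POk A Φ s} := by
  have e : ∀ (s : JSeq M) (a b : M × Option ℕ),
      pv A (s ++ [a, b]) (s.length + 1 + 1) = pview A (s ++ [a, b]) := by
    intro s a b
    change _ = pv A _ (List.length _)
    simp
  have pre : ∀ (s : JSeq M) (a b : M × Option ℕ), POk A Φ (s ++ [a, b]) → POk A Φ s := by
    intro s a b h i hi ho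
    have := h i (by simp; omega) ho
    rwa [pv_append (by omega)] at this
  have ev : ∀ (s : JSeq M) (a b : M × Option ℕ), Even (s ++ [a, b]).length → Even s.length := by
    intro s a b h
    simpa [Nat.even_add] using h
  have last : ∀ (s : JSeq M) (a b : M × Option ℕ), Even s.length → POk A Φ (s ++ [a, b]) →
      pview A (s ++ [a, b]) ∈ Φ := by
    intro s a b he h
    rw [← e]
    exact h _ (by simp) (by rwa [Nat.even_add_one, not_not])
  constructor
  · exact ⟨[], hG₀, by simp, fun i hi => by simp at hi⟩
  · exact fun s hs => hs.1
  · exact fun s hs => hs.2.1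
  · rintro s a b ⟨h1, h2, h3⟩
    exact ⟨hGp _ _ h1, ev _ _ _ h2, pre _ _ _ h3⟩
  · rintro s a b c ⟨h1, h2, h3⟩ ⟨h4, h5, h6⟩
    have he := ev _ _ _ h2
    have l1 := hG h1
    have l4 := hG h4
    have m1 := last _ _ _ he h3
    have m4 := last _ _ _ he h6
    obtain ⟨x, hx⟩ := pview_append_pair l1 he
    obtain ⟨y, hy⟩ := pview_append_pair l4 he
    rw [hx] at m1
    rw [hy] at m4
    exact pview_append_pair_inj l1 l4 he (by rw [hx, hy, hΦ _ _ _ m1 m4])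
  · rintro s a b t a' ⟨h1, h2, h3⟩ ⟨h4, h5, h6⟩ h7 h8
    have he := ev _ _ _ h2
    obtain ⟨b', hb', hb''⟩ := hext s a b t a' h1 h7 he h5 h8
    refine ⟨b', ⟨hb', by simpa [Nat.even_add] using h5, fun i hi ho => ?_⟩, hb''⟩
    rcases Nat.lt_or_ge i t.length with hi' | hi'
    · rw [pv_append (by omega)]; exact h6 i hi' ho
    · have : i = t.length + 1 := by
        have : i ≠ t.length := by rintro rfl; exact ho h5
        simp at hi; omega
      subst this
      rw [e, hb'']
      exact last _ _ _ he h3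

theorem plays_append {s l : JSeq M} (h : s ++ l ∈ plays A) : s ∈ plays A := h.append_left

end ViewSets

/-! ### Plays of the game `A → Σ` -/

section Lift

variable {M : Type*} {A : Arena M} {s t : JSeq M}

/-- An entry of a sequence over `A`, in a sequence over `A → Σ` that has one more move at its
beginning; initial moves of `A` get a pointer to that move. -/
def liftEntry (x : M × Option ℕ) : (M ⊕ SigmaMove) × Option ℕ :=
  (.inl x.1, some (x.2.elim 0 Nat.succ))

/-- The sequence `q s` over `A → Σ`. -/
def lift (s : JSeq M) : JSeq (M ⊕ SigmaMove) := (.inr .q, none) :: s.map liftEntry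

/-- The answer `a` of `Σ`, pointing to the first move. -/
def finalEntry (M : Type*) : (M ⊕ SigmaMove) × Option ℕ := (.inr .a, some 0)

theorem liftEntry_injective : Function.Injective (liftEntry (M := M)) := by
  rintro ⟨m, _ | j⟩ ⟨m', _ | j'⟩ h <;> simp_all [liftEntry]

theorem lift_injective : Function.Injective (lift (M := M)) := by
  intro s t h
  exact List.map_injective_iff.2 liftEntry_injective (List.cons.inj h).2

theorem length_lift : (lift s).length = s.length + 1 := by simp [lift]

theorem getElem?_lift_zero : (lift s)[0]? = some (.inr .q, none) := rfl

theorem getElem?_lift_succ (n : ℕ) : (lift s)[n + 1]? = s[n]?.map liftEntry := by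
  simp [lift]

theorem lift_append_singleton (x : M × Option ℕ) : lift (s ++ [x]) = lift s ++ [liftEntry x] := by
  simp [lift]

theorem lift_ne_append_finalEntry : lift t ≠ lift s ++ [finalEntry M] := by
  intro h
  have := congrArg (fun u => u[s.length + 1]?) h
  simp only [getElem?_lift_succ] at this
  rw [← length_lift, List.getElem?_concat_length] at this
  rcases h : t[s.length]? with _ | x <;> simp [h, liftEntry, finalEntry] at this

theorem arrow_role_inl (m : M) : (A.arrow sigmaArena).role (.inl m) = (A.role m).flip := rfl

theorem arrow_role_inl_O {m : M} : (A.arrow sigmaArena).role (.inl m) = .O ↔ A.role m = .P := by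
  rw [arrow_role_inl]; cases A.role m <;> simp [Role.flip]

theorem arrow_role_inl_P {m : M} : (A.arrow sigmaArena).role (.inl m) = .P ↔ A.role m = .O := by
  rw [arrow_role_inl]; cases A.role m <;> simp [Role.flip]

/-- The participants are exchanged in `A → Σ`, so the P-view of `q s` is `q` followed by the O-view
of `s`. -/
theorem pviewIdx_lift (hs : Legal A s) {n : ℕ} (hn : n ≤ s.length) :
    pviewIdx (A.arrow sigmaArena) (lift s) (n + 1) = 0 :: (oviewIdx A s n).map Nat.succ := by
  induction n using Nat.strong_induction_on with
  | _ n ih =>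
    cases n with
    | zero => rw [pviewIdx_of_none getElem?_lift_zero rfl]; simp [oviewIdx]
    | succ n =>
      obtain ⟨m, p, h⟩ := exists_getElem? (s := s) (i := n) (by omega)
      have h' : (lift s)[n + 1]? = some (.inl m, some (p.elim 0 Nat.succ)) := by
        rw [getElem?_lift_succ, h]; rfl
      by_cases he : Even n
      · rw [pviewIdx_of_P h' (arrow_role_inl_P.2 (hs.role_O h he)), ih n (by omega) (by omega),
          oviewIdx_of_O h (hs.role_O h he)]
        simp
      · obtain ⟨j, rfl, h1, h2⟩ := hs.exists_ptr_of_P h he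
        rw [pviewIdx_of_O h' (arrow_role_inl_O.2 (hs.role_P h he)) (by simpa using h1),
          oviewIdx_of_P h (hs.role_P h he) h1]
        simp only [Option.elim_some, Nat.succ_eq_add_one]
        rw [ih j (by omega) (by omega)]
        simp

theorem oviewIdx_lift (hs : Legal A s) {n : ℕ} (hn : n ≤ s.length) :
    oviewIdx (A.arrow sigmaArena) (lift s) (n + 1) = 0 :: (pviewIdx A s n).map Nat.succ := by
  induction n using Nat.strong_induction_on with
  | _ n ih =>
    cases n with
    | zero => rw [oviewIdx_of_O getElem?_lift_zero rfl]; simp [oviewIdx, pviewIdx]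
    | succ n =>
      obtain ⟨m, p, h⟩ := exists_getElem? (s := s) (i := n) (by omega)
      have h' : (lift s)[n + 1]? = some (.inl m, some (p.elim 0 Nat.succ)) := by
        rw [getElem?_lift_succ, h]; rfl
      by_cases he : Even n
      · have hr := arrow_role_inl_P.2 (hs.role_O h he)
        cases p with
        | none =>
          rw [oviewIdx_of_P h' hr (by simp), pviewIdx_of_none h (hs.role_O h he)]
          simp [oviewIdx]
        | some j =>
          obtain ⟨h1, h2⟩ := hs.odd_ptr_of_O h he
          rw [oviewIdx_of_P h' hr (by simpa using h1), pviewIdx_of_O h (hs.role_O h he) h1]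
          simp only [Option.elim_some, Nat.succ_eq_add_one]
          rw [ih j (by omega) (by omega)]
          simp
      · rw [oviewIdx_of_O h' (arrow_role_inl_O.2 (hs.role_P h he)), ih n (by omega) (by omega),
          pviewIdx_of_P h (hs.role_P h he)]
        simp

/-- When nothing is pending in `s`, the pending question of `q s` is `q`. -/
theorem pending_lift (hs : Legal A s) {n : ℕ} (hn : n ≤ s.length) :
    pending (A.arrow sigmaArena) (lift s) (n + 1) =
      some ((pending A s n).elim 0 Nat.succ) := by
  induction n using Nat.strong_induction_on with
  | _ n ih =>
    cases n with
    | zero => rw [pending_of_question getElem?_lift_zero rfl]; simp [pending]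
    | succ n =>
      rcases hs.pending_succ hn with ⟨m, p, h1, h2, h3⟩ | ⟨m, j, h1, h2, h3, h4, h5⟩
      · have h' : (lift s)[n + 1]? = some (.inl m, some (p.elim 0 Nat.succ)) := by
          rw [getElem?_lift_succ, h1]; rfl
        rw [h3, pending_of_question h' h2]
        rfl
      · have h' : (lift s)[n + 1]? = some (.inl m, some (j + 1)) := by
          rw [getElem?_lift_succ, h1]; rfl
        rw [h5, pending_of_answer h' h2 (by omega), ih j (by omega) (by omega)]

theorem Legal.lift (hs : Legal A s) : Legal (A.arrow sigmaArena) (lift s) := by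
  have key : ∀ i x, (InnocentGames.lift s)[i + 1]? = some x →
      ∃ m p, s[i]? = some (m, p) ∧ x = (.inl m, some (p.elim 0 Nat.succ)) := by
    intro i x h
    rw [getElem?_lift_succ] at h
    obtain ⟨⟨m, p⟩, h1, h2⟩ := Option.map_eq_some_iff.1 h
    exact ⟨m, p, h1, h2.symm⟩
  constructor
  · rintro (_ | i) m p h
    · rw [getElem?_lift_zero] at h; cases h; exact Or.inl ⟨rfl, rfl⟩
    · obtain ⟨m, p, h1, h2⟩ := key i _ h
      cases h2
      refine Or.inr ?_
      rcases hs.justified i m p h1 with ⟨h3, rfl⟩ | ⟨j, m', p', rfl, h4, h5, h6⟩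
      · exact ⟨0, _, _, rfl, by omega, getElem?_lift_zero, ⟨rfl, h3⟩⟩
      · exact ⟨j + 1, .inl m', _, rfl, by omega, by rw [getElem?_lift_succ, h5]; rfl, h6⟩
  · rintro (_ | i) x y hx hy
    · rw [getElem?_lift_zero] at hx; cases hx
      obtain ⟨m, p, h1, h2⟩ := key 0 _ hy
      cases h2
      have := arrow_role_inl_P.2 (hs.role_O h1 (by simp))
      simp only [this]
      intro hc; cases hc
    · obtain ⟨m, p, h1, h2⟩ := key i _ hx
      obtain ⟨m', p', h1', h2'⟩ := key (i + 1) _ hy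
      cases h2; cases h2'
      have := hs.alternating i _ _ h1 h1'
      simp only [arrow_role_inl]
      revert this
      simp only
      cases A.role m <;> cases A.role m' <;> simp [Role.flip]
  · rintro (_ | i) m j h hm
    · rw [getElem?_lift_zero] at h; cases h
    · have hi := lt_length_of_getElem? h
      rw [length_lift] at hi
      obtain ⟨m, p, h1, h2⟩ := key i _ h
      cases h2
      rw [pviewIdx_lift hs (by omega)]
      have hO := arrow_role_inl_P.1 hm
      cases p with
      | none => simp
      | some j => simpa using hs.visible_O i m j h1 hO
  · rintro (_ | i) m j h hm
    · rw [getElem?_lift_zero] at h; cases h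
    · have hi := lt_length_of_getElem? h
      rw [length_lift] at hi
      obtain ⟨m, p, h1, h2⟩ := key i _ h
      cases h2
      rw [oviewIdx_lift hs (by omega)]
      have hO := arrow_role_inl_O.1 hm
      cases p with
      | none => simp
      | some j => simpa using hs.visible_P i m j h1 hO
  · rintro (_ | i) m j h hm
    · rw [getElem?_lift_zero] at h; cases h
    · have hi := lt_length_of_getElem? h
      rw [length_lift] at hi
      obtain ⟨m, p, h1, h2⟩ := key i _ h
      cases h2
      rw [pending_lift hs (by omega)]
      obtain ⟨j, rfl, -, h4⟩ := hs.answer_ptr h1 hm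
      rw [h4]

theorem legal_lift_append_finalEntry_iff (hs : Legal A s) :
    Legal (A.arrow sigmaArena) (lift s ++ [finalEntry M]) ↔
      Even s.length ∧ pending A s s.length = none := by
  constructor
  · intro h
    have hl : (lift s ++ [finalEntry M])[s.length + 1]? = some (.inr .a, some 0) := by
      rw [← length_lift, List.getElem?_concat_length]; rfl
    have h1 := h.role_iff hl
    have h2 := h.bracketed _ _ _ hl rfl
    rw [pending_append (by rw [length_lift]), pending_lift hs le_rfl] at h2
    constructor
    · by_contra hc
      have := h1.2 (by rwa [Nat.even_add_one])
      cases this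
    · cases hp : pending A s s.length with
      | none => rfl
      | some j => rw [hp] at h2; simp at h2
  · rintro ⟨h1, h2⟩
    refine hs.lift.snoc (Or.inr ⟨0, .inr .q, none, rfl, getElem?_lift_zero, rfl, rfl⟩) ?_ ?_ ?_ ?_
    · rw [length_lift, Nat.even_add_one]
      constructor
      · intro h; cases h
      · intro h; exact absurd h1 h
    · intro j hj _; cases hj
      rw [length_lift, pviewIdx_lift hs le_rfl]; simp
    · intro _ _ h; cases h
    · intro j hj _; cases hj
      rw [length_lift, pending_lift hs le_rfl, h2]; rfl

/-- The O-view of a legal position is closed under pointers. -/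
theorem Legal.mem_oviewIdx_of_ptr (hs : Legal A s) {n : ℕ} (hn : n ≤ s.length) {i j : ℕ} {m : M}
    (hi : i ∈ oviewIdx A s n) (h : s[i]? = some (m, some j)) : j ∈ oviewIdx A s n := by
  induction n using Nat.strong_induction_on with
  | _ n ih =>
    cases n with
    | zero => simp [oviewIdx] at hi
    | succ n =>
      obtain ⟨mn, pn, hn'⟩ := exists_getElem? (s := s) (i := n) (by omega)
      by_cases he : Even n
      · rw [oviewIdx_of_O hn' (hs.role_O hn' he), List.mem_append] at hi ⊢
        rcases hi with hi | hi
        · exact Or.inl (ih n (by omega) (by omega) hi)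
        · obtain rfl : i = n := by simpa using hi
          exact Or.inl (hs.visible_O _ _ _ h (hs.role_O h he))
      · obtain ⟨k, rfl, h1, h2⟩ := hs.exists_ptr_of_P hn' he
        rw [oviewIdx_of_P hn' (hs.role_P hn' he) h1, List.mem_append] at hi ⊢
        rcases hi with hi | hi
        · exact Or.inl (ih k (by omega) (by omega) hi)
        · simp only [List.mem_cons, List.not_mem_nil, or_false] at hi
          rcases hi with rfl | rfl
          · exact Or.inl (hs.visible_O _ _ _ h (hs.role_O h h2))
          · rw [hn'] at h; cases h
            simp

theorem select_lift {l : List ℕ}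
    (hl' : ∀ i ∈ l, ∀ m j, s[i]? = some (m, some j) → j ∈ l) :
    (lift s).select (0 :: l.map Nat.succ) = lift (s.select l) := by
  have idx : ∀ j ∈ l, (0 :: l.map Nat.succ).idxOf? (j + 1) = (l.idxOf? j).map Nat.succ := by
    intro j _
    rw [List.idxOf?_cons]
    have := idxOf?_map_of_injOn (c := Nat.succ) (S := Set.univ) Nat.succ_injective.injOn
      (l := l) (fun _ _ => trivial) (j := j) trivial
    simp only [Nat.succ_eq_add_one] at this ⊢
    rw [this]
    simp
  unfold JSeq.select
  rw [List.filterMap_cons, getElem?_lift_zero]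
  simp only [Option.map_some, Option.bind_none, lift, List.map_filterMap, List.filterMap_map]
  congr 1
  refine List.filterMap_congr fun i hi => ?_
  have e := getElem?_lift_succ (s := s) i
  simp only [lift] at e
  simp only [Function.comp, Nat.succ_eq_add_one, e]
  rcases h : s[i]? with _ | ⟨m, _ | j⟩
  · rfl
  · simp [liftEntry, List.idxOf?_cons]
  · have hj := hl' i hi m j h
    obtain ⟨k, hk⟩ := Option.isSome_iff_exists.1 (List.isSome_idxOf?.2 hj)
    have := idx j hj
    simp [liftEntry, this, hk]

theorem pview_lift (hs : Legal A s) : pview (A.arrow sigmaArena) (lift s) = lift (oview A s) := by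
  rw [pview, length_lift, pviewIdx_lift hs le_rfl, oview]
  exact select_lift fun i hi m j h => hs.mem_oviewIdx_of_ptr le_rfl hi h

theorem pview_lift_append_finalEntry (hs : Legal A s) :
    pview (A.arrow sigmaArena) (lift s ++ [finalEntry M]) =
      lift (oview A s) ++ [finalEntry M] := by
  have hl : (lift s ++ [finalEntry M])[s.length + 1]? = some (.inr .a, some 0) := by
    rw [← length_lift, List.getElem?_concat_length]; rfl
  have hw : PtrLt (lift s ++ [finalEntry M]) := by
    intro i m j h
    rcases Nat.lt_or_ge i (lift s).length with hi | hi
    · rw [getElem?_append_lt hi] at h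
      exact hs.lift.ptrLt i m j h
    · have := lt_length_of_getElem? h
      simp at this
      obtain rfl : i = s.length + 1 := by rw [length_lift] at *; omega
      rw [hl] at h; cases h; omega
  change pv _ _ (List.length _) = _
  rw [List.length_append, length_lift, List.length_singleton, pv_succ_of_P hw hl rfl,
    pv_append (by rw [length_lift]), pviewIdx_append (by rw [length_lift]), pviewIdx_lift hs le_rfl,
    ← pview_lift hs, pview, length_lift, pv]
  rfl

end Lift

/-! ### Restriction to the components -/

section Restriction

variable {M N : Type*} {s : JSeq M}

/-- The positions kept by `JSeq.project`. -/
def projIdx (g : M → Option N) (s : JSeq M) : List ℕ :=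
  (List.range s.length).filter fun i => (s[i]?.bind fun x => g x.1).isSome

theorem projIdx_append_singleton (g : M → Option N) (x : M × Option ℕ) :
    projIdx g (s ++ [x]) = projIdx g s ++ if (g x.1).isSome then [s.length] else [] := by
  unfold projIdx
  rw [List.length_append, List.length_singleton, List.range_succ, List.filter_append]
  congr 1
  · refine List.filter_congr fun i hi => ?_
    rw [getElem?_append_lt (List.mem_range.1 hi)]
  · simp [List.filter_singleton]

theorem lt_of_mem_projIdx {g : M → Option N} {i : ℕ} (h : i ∈ projIdx g s) : i < s.length :=
  List.mem_range.1 (List.mem_filter.1 h).1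

theorem project_eq (g : M → Option N) : s.project g = (s.select (projIdx g s)).filterMap
    fun x => (g x.1).map fun n => (n, x.2) := rfl

theorem project_append_of_none {g : M → Option N} {x : M × Option ℕ} (h : g x.1 = none) :
    (s ++ [x]).project g = s.project g := by
  rw [project_eq, project_eq, projIdx_append_singleton]
  simp only [h, Option.isSome_none, Bool.false_eq_true, if_false, List.append_nil]
  rw [select_congr fun i hi => getElem?_append_lt (lt_of_mem_projIdx hi)]

theorem project_append_of_some {g : M → Option N} {x : M × Option ℕ} {n : N} (h : g x.1 = some n)
    (hw : PtrLt (s ++ [x])) :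
    (s ++ [x]).project g =
      s.project g ++ [(n, x.2.bind fun j => (projIdx g s).idxOf? j)] := by
  rw [project_eq, project_eq, projIdx_append_singleton]
  simp only [h, Option.isSome_some, if_true]
  have hx : (s ++ [x])[s.length]? = some (x.1, x.2) := by simp
  rw [select_snoc hw (fun i hi => lt_of_mem_projIdx hi) hx, List.filterMap_append,
    select_congr fun i hi => getElem?_append_lt (lt_of_mem_projIdx hi)]
  simp [h]

theorem PtrLt.append_left {l : JSeq M} (h : PtrLt (s ++ l)) : PtrLt s := by
  intro i m j hi
  exact h i m j (by rwa [getElem?_append_lt (lt_length_of_getElem? hi)])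

theorem project_prefix (g : M → Option N) (l : JSeq M) (hw : PtrLt (s ++ l)) :
    s.project g <+: (s ++ l).project g := by
  induction l using List.reverseRecOn with
  | nil => simp
  | append_singleton l x ih =>
    rw [← List.append_assoc] at hw ⊢
    have := ih hw.append_left
    cases h : g x.1 with
    | none => rwa [project_append_of_none h]
    | some n =>
      rw [project_append_of_some h hw]
      exact this.trans (List.prefix_append _ _)

theorem project_left_lift (hw : PtrLt (lift s)) :
    projIdx Sum.getLeft? (lift s) = (List.range s.length).map Nat.succ ∧
      restrictLeft (lift s) = s := by
  induction s using List.reverseRecOn with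
  | nil => exact ⟨rfl, rfl⟩
  | append_singleton s x ih =>
    rw [lift_append_singleton] at hw ⊢
    obtain ⟨ih1, ih2⟩ := ih hw.append_left
    have hg : Sum.getLeft? (liftEntry x).1 = some x.1 := rfl
    constructor
    · rw [projIdx_append_singleton, ih1, hg, length_lift]
      simp [List.range_succ]
    · rw [restrictLeft, project_append_of_some hg hw, ← restrictLeft, ih2, ih1]
      obtain ⟨m, _ | j⟩ := x
      · simp [liftEntry]
      · have hj := hw (s.length + 1) (.inl m) (j + 1) (by
          rw [← length_lift, List.getElem?_concat_length]; rfl)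
        have : ((List.range s.length).map Nat.succ).idxOf? (j + 1) = some j := by
          refine idxOf?_getElem (List.nodup_range.map Nat.succ_injective) ?_
          rw [List.getElem?_map, List.getElem?_range (by omega)]
          rfl
        simp [liftEntry, this]

theorem project_right_lift :
    projIdx Sum.getRight? (lift s) = [0] ∧ restrictRight (lift s) = [(.q, none)] := by
  induction s using List.reverseRecOn with
  | nil => exact ⟨rfl, rfl⟩
  | append_singleton s x ih =>
    rw [lift_append_singleton]
    have hg : Sum.getRight? (liftEntry x).1 = none := rfl
    constructor
    · rw [projIdx_append_singleton, ih.1, hg]; rfl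
    · rw [restrictRight, project_append_of_none hg]; exact ih.2

theorem restrictLeft_lift_append_finalEntry (hw : PtrLt (lift s)) :
    restrictLeft (lift s ++ [finalEntry M]) = s := by
  rw [restrictLeft, project_append_of_none rfl]
  exact (project_left_lift hw).2

theorem restrictRight_lift_append_finalEntry (hw : PtrLt (lift s ++ [finalEntry M])) :
    restrictRight (lift s ++ [finalEntry M]) = sigmaQA := by
  have hg : Sum.getRight? (finalEntry M).1 = some .a := rfl
  rw [restrictRight, project_append_of_some hg hw, ← restrictRight, project_right_lift.1,
    project_right_lift.2]
  rfl

end Restriction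

/-! ### Tests as sets of O-views -/

section Tests

variable {M : Type*} {A : Arena M} {s t : JSeq M}

theorem sigmaPlays_of_prefix {v w : JSeq SigmaMove} (h : v <+: w) (hw : w ∈ sigmaPlays) :
    v ∈ sigmaPlays := by
  obtain ⟨l, rfl⟩ := h
  rcases v with _ | ⟨a, _ | ⟨b, _ | ⟨c, v⟩⟩⟩ <;> simp_all [sigmaPlays, sigmaQA]
  tauto

theorem testPlays_append {u l : JSeq (M ⊕ SigmaMove)} (h : u ++ l ∈ testPlays A) :
    u ∈ testPlays A := by
  obtain ⟨h1, h2, h3⟩ := h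
  refine ⟨h1.append_left, ?_, sigmaPlays_of_prefix (project_prefix _ l h1.ptrLt) h3⟩
  exact Legal.of_prefix h2 (project_prefix _ l h1.ptrLt)

theorem testPlays_subset : testPlays A ⊆ plays (A.arrow sigmaArena) := fun _ h => h.1

theorem nil_mem_testPlays : [] ∈ testPlays A := ⟨legal_nil, legal_nil, Or.inl rfl⟩

/-- Plays of `A → Σ` are `ε`, `q s` or `q s a`. After `a`, the O-view is `q a`, and neither of these
moves enables a move of `A` that is to be made by the environment of `A → Σ`. -/
theorem shape_of_legal {u : JSeq (M ⊕ SigmaMove)} (hu : Legal (A.arrow sigmaArena) u)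
    (hr : restrictRight u ∈ sigmaPlays) :
    u = [] ∨ ∃ s : JSeq M, u = lift s ∨ u = lift s ++ [finalEntry M] := by
  induction u using List.reverseRecOn with
  | nil => exact Or.inl rfl
  | append_singleton u x ih =>
    refine Or.inr ?_
    obtain ⟨n, p⟩ := x
    have hx : (u ++ [(n, p)])[u.length]? = some (n, p) := by simp
    rcases ih hu.append_left (sigmaPlays_of_prefix (project_prefix _ _ hu.ptrLt) hr) with
      rfl | ⟨s, rfl | rfl⟩
    · rcases hu.justified 0 n p hx with ⟨h1, rfl⟩ | ⟨j, _, _, _, h1, _⟩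
      · rcases n with m | n
        · exact h1.elim
        · obtain rfl : n = .q := h1
          exact ⟨[], Or.inl rfl⟩
      · omega
    · have hg : Legal (A.arrow sigmaArena) (lift s) := hu.append_left
      rcases n with m | n
      · rcases hu.justified _ _ p hx with ⟨h1, -⟩ | ⟨j, m', p', rfl, h2, h3, h4⟩
        · exact h1.elim
        · cases j with
          | zero => exact ⟨s ++ [(m, none)], Or.inl (by rw [lift_append_singleton]; rfl)⟩
          | succ j => exact ⟨s ++ [(m, some j)], Or.inl (by rw [lift_append_singleton]; rfl)⟩
      · have hgr : Sum.getRight? (Sum.inr n : M ⊕ SigmaMove) = some n := rfl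
        rw [restrictRight, project_append_of_some hgr hu.ptrLt, ← restrictRight,
          project_right_lift.2, project_right_lift.1] at hr
        have hn : n = .a := by
          simp [sigmaPlays, sigmaQA] at hr
          exact hr.1
        subst hn
        rcases hu.justified _ _ p hx with ⟨h1, -⟩ | ⟨j, m', p', rfl, h2, h3, h4⟩
        · cases h1
        · refine ⟨s, Or.inr ?_⟩
          rw [getElem?_append_lt h2] at h3
          cases j with
          | zero => rfl
          | succ j =>
            rw [getElem?_lift_succ] at h3
            obtain ⟨y, -, hy⟩ := Option.map_eq_some_iff.1 h3
            cases hy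
            exact h4.elim
    · exfalso
      have hl : (lift s ++ [finalEntry M] ++ [(n, p)])[s.length + 1]? = some (.inr .a, some 0) := by
        rw [getElem?_append_lt (by simp [length_lift]), ← length_lift,
          List.getElem?_concat_length]; rfl
      rcases n with m | n
      · rcases hu.justified _ _ p hx with ⟨h1, -⟩ | ⟨j, m', p', rfl, h2, h3, h4⟩
        · exact h1.elim
        · have hodd : ¬ Even (s.length + 1) := fun hc => by
            have := hu.role_O hl hc
            cases this
          have hO : (A.arrow sigmaArena).role (.inl m) = .O := by
            refine hu.role_O hx ?_
            simp only [List.length_append, length_lift, List.length_singleton]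
            rwa [Nat.even_add_one]
          have hv := hu.visible_O _ _ _ hx hO
          simp only [List.length_append, length_lift, List.length_singleton] at hv
          rw [oviewIdx_of_P hl rfl (by omega)] at hv
          simp only [oviewIdx, List.nil_append, List.mem_cons, List.not_mem_nil, or_false] at hv
          rcases hv with rfl | rfl
          · have : m' = .inr .q := by
              rw [List.append_assoc, getElem?_append_lt (by simp [length_lift]),
                getElem?_lift_zero] at h3
              exact (Prod.mk.inj (Option.some.inj h3)).1.symm
            subst this
            have := A.init_role m h4.2
            rw [arrow_role_inl_O, this] at hO
            cases hO
          · rw [hl] at h3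
            cases h3
            cases h4.1
      · have hgr : Sum.getRight? (Sum.inr n : M ⊕ SigmaMove) = some n := rfl
        rw [restrictRight, project_append_of_some hgr hu.ptrLt, ← restrictRight,
          restrictRight_lift_append_finalEntry hu.append_left.ptrLt] at hr
        simp [sigmaPlays, sigmaQA] at hr

theorem mem_testPlays_cases {u : JSeq (M ⊕ SigmaMove)} (hu : u ∈ testPlays A) :
    u = [] ∨ (∃ s, Legal A s ∧ u = lift s) ∨
      ∃ s, Legal A s ∧ Even s.length ∧ pending A s s.length = none ∧
        u = lift s ++ [finalEntry M] := by
  rcases shape_of_legal hu.1 hu.2.2 with rfl | ⟨s, rfl | rfl⟩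
  · exact Or.inl rfl
  · have := hu.2.1
    rw [(project_left_lift hu.1.ptrLt).2] at this
    exact Or.inr (Or.inl ⟨s, this, rfl⟩)
  · have := hu.2.1
    rw [restrictLeft_lift_append_finalEntry hu.1.append_left.ptrLt] at this
    obtain ⟨h1, h2⟩ := (legal_lift_append_finalEntry_iff this).1 hu.1
    exact Or.inr (Or.inr ⟨s, this, h1, h2, rfl⟩)

theorem lift_mem_testPlays (hs : Legal A s) : lift s ∈ testPlays A := by
  refine ⟨hs.lift, ?_, ?_⟩
  · rw [(project_left_lift hs.lift.ptrLt).2]; exact hs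
  · rw [project_right_lift.2]; exact Or.inr (Or.inl rfl)

theorem lift_append_finalEntry_mem_testPlays (hs : Legal A s) (he : Even s.length)
    (hp : pending A s s.length = none) : lift s ++ [finalEntry M] ∈ testPlays A := by
  have h := (legal_lift_append_finalEntry_iff hs).2 ⟨he, hp⟩
  refine ⟨h, ?_, ?_⟩
  · rw [restrictLeft_lift_append_finalEntry hs.lift.ptrLt]; exact hs
  · rw [restrictRight_lift_append_finalEntry h.ptrLt]; exact Or.inr (Or.inr rfl)

/-- A test succeeds on a strategy if and only if some play of the strategy makes it answer. -/
theorem comp_eq_sigmaTop_iff {σ : Set (JSeq M)} (hσ : IsInnocentStrategy A (plays A) σ)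
    {α : Set (JSeq (M ⊕ SigmaMove))} (hα : IsInnocentTest A α) :
    comp σ α = sigmaTop ↔ ∃ s ∈ σ, lift s ++ [finalEntry M] ∈ α := by
  constructor
  · intro h
    have : sigmaQA ∈ comp σ α := by rw [h]; exact Or.inr rfl
    obtain ⟨u, hu, h1, h2⟩ := this
    have hL := hα.subset_plays hu
    rcases mem_testPlays_cases hL with rfl | ⟨s, hs, rfl⟩ | ⟨s, hs, -, -, rfl⟩
    · cases h2
    · rw [project_right_lift.2] at h2; cases h2
    · rw [restrictLeft_lift_append_finalEntry hs.lift.ptrLt] at h1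
      exact ⟨s, h1, hu⟩
  · rintro ⟨s, hs, hsα⟩
    have hL := hα.subset_plays hsα
    ext v
    constructor
    · rintro ⟨u, hu, h1, rfl⟩
      have hU := hα.subset_plays hu
      rcases mem_testPlays_cases hU with rfl | ⟨t, ht, rfl⟩ | ⟨t, ht, -, -, rfl⟩
      · exact Or.inl rfl
      · rw [(project_left_lift ht.lift.ptrLt).2] at h1
        have e1 := hσ.even_length _ h1
        have e2 := hα.even_length _ hu
        rw [length_lift, Nat.even_add_one] at e2
        exact absurd e1 e2
      · rw [restrictRight_lift_append_finalEntry hU.1.ptrLt]; exact Or.inr rfl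
    · rintro (rfl | rfl)
      · exact ⟨[], hα.nil_mem, hσ.nil_mem, rfl⟩
      · refine ⟨_, hsα, ?_, (restrictRight_lift_append_finalEntry hL.1.ptrLt).symm⟩
        rwa [restrictLeft_lift_append_finalEntry hL.1.append_left.ptrLt]

/-- The P-views of a test in the play `q s a` are the O-views of `s` reached by Opponent's moves,
and the final O-view followed by `a`. -/
theorem pOk_lift_append_finalEntry_iff {Φ : Set (JSeq (M ⊕ SigmaMove))} (hs : Legal A s)
    (he : Even s.length) :
    POk (A.arrow sigmaArena) Φ (lift s ++ [finalEntry M]) ↔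
      OOk A {v | lift v ∈ Φ} s ∧ lift (oview A s) ++ [finalEntry M] ∈ Φ := by
  have hlen : (lift s ++ [finalEntry M]).length = s.length + 1 + 1 := by simp [length_lift]
  have e1 : ∀ i < s.length, pv (A.arrow sigmaArena) (lift s ++ [finalEntry M]) (i + 1 + 1) =
      lift (ov A s (i + 1)) := by
    intro i hi
    rw [pv_append (by rw [length_lift]; omega), ← oview_take hi, ← pview_lift (hs.take _),
      ← pview_take (by rw [length_lift]; omega)]
    simp [lift]
  have e2 : pv (A.arrow sigmaArena) (lift s ++ [finalEntry M]) (s.length + 1 + 1) =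
      lift (oview A s) ++ [finalEntry M] := by
    rw [← pview_lift_append_finalEntry hs, pview, hlen]; rfl
  constructor
  · intro h
    refine ⟨fun i hi hie => ?_, ?_⟩
    · have := h (i + 1) (by rw [hlen]; omega) (by rwa [Nat.even_add_one, not_not])
      rwa [e1 i hi] at this
    · have := h (s.length + 1) (by rw [hlen]; omega) (by rwa [Nat.even_add_one, not_not])
      rwa [e2] at this
  · rintro ⟨h1, h2⟩ i hi hio
    cases i with
    | zero => simp at hio
    | succ i =>
      rw [Nat.even_add_one, not_not] at hio
      rw [hlen] at hi
      rcases Nat.lt_or_ge i s.length with hi' | hi'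
      · rw [e1 i hi']; exact h1 i hi' hio
      · obtain rfl : i = s.length := by omega
        rwa [e2]

/-- The O-views that end with a move which the test `α` makes in `A`, as Opponent. -/
def testViews (α : Set (JSeq (M ⊕ SigmaMove))) (A : Arena M) : Set (JSeq M) :=
  {v | lift v ∈ pview (A.arrow sigmaArena) '' α}

/-- The O-views after which the test `α` answers in `Σ`. -/
def testFinal (α : Set (JSeq (M ⊕ SigmaMove))) (A : Arena M) : Set (JSeq M) :=
  {v | lift v ++ [finalEntry M] ∈ pview (A.arrow sigmaArena) '' α}

theorem viewDet_testViews {α : Set (JSeq (M ⊕ SigmaMove))} (hα : IsInnocentTest A α) :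
    ViewDet (testViews α A) := by
  intro v x y hx hy
  simp only [testViews, Set.mem_ofPred_eq, lift_append_singleton] at hx hy
  exact liftEntry_injective
    (hα.viewDet testPlays_subset (fun _ _ => testPlays_append) _ _ _ hx hy)

/-- The test `α` answers after `s` if and only if Opponent's moves in `s` follow the views of `α`,
which answers at the final O-view; well-bracketing requires that nothing is pending in `s`. -/
theorem append_finalEntry_mem_iff {α : Set (JSeq (M ⊕ SigmaMove))} (hα : IsInnocentTest A α)
    (hs : Legal A s) (he : Even s.length) : lift s ++ [finalEntry M] ∈ α ↔
      OOk A (testViews α A) s ∧ oview A s ∈ testFinal α A ∧ pending A s s.length = none := by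
  rw [hα.mem_iff testPlays_subset (fun _ _ => testPlays_append),
    pOk_lift_append_finalEntry_iff hs he]
  constructor
  · rintro ⟨h1, -, h2, h3⟩
    exact ⟨h2, h3, ((legal_lift_append_finalEntry_iff hs).1 h1.1).2⟩
  · rintro ⟨h1, h2, h3⟩
    exact ⟨lift_append_finalEntry_mem_testPlays hs he h3,
      by simpa [length_lift, Nat.even_add_one] using he, h1, h2⟩

/-- The P-views of the test that follows the O-views in `V`, and answers at those in `F`. -/
def viewTestViews (V F : Set (JSeq M)) : Set (JSeq (M ⊕ SigmaMove)) :=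
  lift '' V ∪ (fun v => lift v ++ [finalEntry M]) '' F

/-- The test that follows the O-views in `V`, and answers at those in `F`. -/
def viewTest (A : Arena M) (V F : Set (JSeq M)) : Set (JSeq (M ⊕ SigmaMove)) :=
  {u | u ∈ testPlays A ∧ Even u.length ∧ POk (A.arrow sigmaArena) (viewTestViews V F) u}

theorem viewDet_viewTestViews {V F : Set (JSeq M)} (hV : ViewDet V) (hV₀ : [] ∉ V)
    (hVF : ∀ v x, v ++ [x] ∈ V → v ∉ F) : ViewDet (viewTestViews V F) := by
  have key : ∀ v ∈ V, ∃ v' x, v = v' ++ [x] := by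
    intro v hv
    rcases List.eq_nil_or_concat v with rfl | ⟨v', x, rfl⟩
    · exact absurd hv hV₀
    · exact ⟨v', x, by simp⟩
  rintro w x y (⟨v, hv, hx⟩ | ⟨v, hv, hx⟩) (⟨v', hv', hy⟩ | ⟨v', hv', hy⟩)
  · obtain ⟨v, a, rfl⟩ := key v hv
    obtain ⟨v', b, rfl⟩ := key v' hv'
    rw [lift_append_singleton] at hx hy
    obtain ⟨h1, h2⟩ := List.append_inj' hx rfl
    obtain ⟨h3, h4⟩ := List.append_inj' hy rfl
    obtain rfl := lift_injective (h1.trans h3.symm)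
    rw [hV _ _ _ hv hv'] at h2
    exact (List.cons.inj (h2.symm.trans h4)).1
  · obtain ⟨v, a, rfl⟩ := key v hv
    rw [lift_append_singleton] at hx
    obtain ⟨h1, h2⟩ := List.append_inj' hx rfl
    obtain ⟨h3, h4⟩ := List.append_inj' hy rfl
    obtain rfl := lift_injective (h1.trans h3.symm)
    exact absurd hv' (hVF _ _ hv)
  · obtain ⟨v', a, rfl⟩ := key v' hv'
    rw [lift_append_singleton] at hy
    obtain ⟨h1, h2⟩ := List.append_inj' hx rfl
    obtain ⟨h3, h4⟩ := List.append_inj' hy rfl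
    obtain rfl := lift_injective (h1.trans h3.symm)
    exact absurd hv (hVF _ _ hv')
  · obtain ⟨h1, h2⟩ := List.append_inj' hx rfl
    obtain ⟨h3, h4⟩ := List.append_inj' hy rfl
    exact (List.cons.inj (h2.symm.trans h4)).1

/-- The condition on `V` and `F` says that the test does not have to choose between a move in `A`
and the answer. -/
theorem isInnocentTest_viewTest {V F : Set (JSeq M)} (hV : ViewDet V) (hV₀ : [] ∉ V)
    (hVF : ∀ v x, v ++ [x] ∈ V → v ∉ F) : IsInnocentTest A (viewTest A V F) := by
  refine isInnocentStrategy_of_views testPlays_subset (fun _ _ => testPlays_append)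
    nil_mem_testPlays (viewDet_viewTestViews hV hV₀ hVF) ?_
  -- At its turn, the test is at a position `lift s` with `s` of even length.
  have key : ∀ (u : JSeq (M ⊕ SigmaMove)) a, u ++ [a] ∈ testPlays A → Even u.length →
      ∃ s, Legal A s ∧ Even s.length ∧ u ++ [a] = lift s := by
    intro u a h he
    rcases mem_testPlays_cases h with h | ⟨s, hs, h⟩ | ⟨s, hs, h1, -, h⟩
    · simp at h
    · refine ⟨s, hs, ?_, h⟩
      have := congrArg List.length h
      simp only [List.length_append, List.length_singleton, length_lift] at this
      rwa [← Nat.succ.inj this]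
    · have := congrArg List.length h
      simp only [List.length_append, List.length_singleton, length_lift] at this
      rw [Nat.succ.inj this, Nat.even_add_one] at he
      exact absurd h1 he
  intro u a b w a' hu hw hue hwe hv
  have hu' : u ++ [a] ++ [b] ∈ testPlays A := by simpa using hu
  obtain ⟨s, hs, hse, h1⟩ := key u a (testPlays_append hu') hue
  obtain ⟨t, ht, hte, h2⟩ := key w a' hw hwe
  have e1 : ∀ x, u ++ [a, x] = lift s ++ [x] := by intro x; rw [← h1]; simp
  have e2 : ∀ x, w ++ [a', x] = lift t ++ [x] := by intro x; rw [← h2]; simp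
  rw [h1, h2, pview_lift hs, pview_lift ht] at hv
  have hv := lift_injective hv
  rw [e1] at hu
  rcases mem_testPlays_cases hu with h | ⟨s', hs', h⟩ | ⟨s', hs', -, hp, h⟩
  · simp at h
  · rcases List.eq_nil_or_concat s' with rfl | ⟨s'', ⟨m, p⟩, rfl⟩
    · have := congrArg List.length h
      simp [length_lift] at this
    · rw [List.concat_eq_append] at h hs'
      rw [lift_append_singleton] at h
      obtain ⟨h3, h4⟩ := List.append_inj' h rfl
      obtain rfl := lift_injective h3
      have hsm : (s ++ [(m, p)])[s.length]? = some (m, p) := by simp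
      obtain ⟨p', h5, h6, -⟩ := hs'.exists_snoc_of_ov_eq ht hse hte
        (by rw [ov_append le_rfl]; exact hv.symm) hsm
      refine ⟨liftEntry (m, p'), ?_, ?_⟩
      · rw [e2, ← lift_append_singleton]
        exact lift_mem_testPlays h5
      · rw [e1, e2, h4, ← lift_append_singleton, ← lift_append_singleton, pview_lift h5,
          pview_lift hs', oview, oview, List.length_append, List.length_append]
        exact congrArg lift h6
  · obtain ⟨h3, h4⟩ := List.append_inj' h rfl
    obtain rfl := lift_injective h3
    obtain rfl := (List.cons.inj h4).1
    have hpt : pending A t t.length = none :=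
      hs.pending_eq_none_of_ov_eq ht le_rfl le_rfl hse hte hv.symm hp
    refine ⟨finalEntry M, ?_, ?_⟩
    · rw [e2]; exact lift_append_finalEntry_mem_testPlays ht hte hpt
    · rw [e1, e2, pview_lift_append_finalEntry hs, pview_lift_append_finalEntry ht, hv]

theorem append_finalEntry_mem_viewTest_iff {V F : Set (JSeq M)} (hs : Legal A s)
    (he : Even s.length) : lift s ++ [finalEntry M] ∈ viewTest A V F ↔
      OOk A V s ∧ oview A s ∈ F ∧ pending A s s.length = none := by
  have e1 : {v | lift v ∈ viewTestViews V F} = V := by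
    ext v
    constructor
    · rintro (⟨v', h1, h2⟩ | ⟨v', h1, h2⟩)
      · rwa [← lift_injective h2]
      · exact absurd h2.symm lift_ne_append_finalEntry
    · exact fun h => Or.inl ⟨v, h, rfl⟩
  have e2 : lift (oview A s) ++ [finalEntry M] ∈ viewTestViews V F ↔ oview A s ∈ F := by
    constructor
    · rintro (⟨v', h1, h2⟩ | ⟨v', h1, h2⟩)
      · exact absurd h2 lift_ne_append_finalEntry
      · obtain ⟨h3, -⟩ := List.append_inj' h2 rfl
        rwa [← lift_injective h3]
    · exact fun h => Or.inr ⟨_, h, rfl⟩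
  rw [viewTest, Set.mem_ofPred_eq, pOk_lift_append_finalEntry_iff hs he, e1, e2]
  constructor
  · rintro ⟨h1, -, h2, h3⟩
    exact ⟨h2, h3, ((legal_lift_append_finalEntry_iff hs).1 h1.1).2⟩
  · rintro ⟨h1, h2, h3⟩
    exact ⟨lift_append_finalEntry_mem_testPlays hs he h3,
      by simpa [length_lift, Nat.even_add_one] using he, h1, h2⟩

end Tests

/-! ### Equivalent strategies have the same observations -/

section Observations

variable {M : Type*} {A : Arena M} {s t : JSeq M} {V : Set (JSeq M)} {σ τ : Set (JSeq M)}

theorem Legal.even_length_oviewIdx (hs : Legal A s) {n : ℕ} (hn : n ≤ s.length) :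
    Even (oviewIdx A s n).length ↔ Even n := by
  induction n using Nat.strong_induction_on with
  | _ n ih =>
    cases n with
    | zero => simp [oviewIdx]
    | succ n =>
      obtain ⟨m, p, h⟩ := exists_getElem? (s := s) (i := n) (by omega)
      by_cases he : Even n
      · rw [oviewIdx_of_O h (hs.role_O h he), List.length_append, List.length_singleton,
          Nat.even_add_one, Nat.even_add_one, ih n (by omega) (by omega)]
      · obtain ⟨j, rfl, h1, h2⟩ := hs.exists_ptr_of_P h he
        rw [oviewIdx_of_P h (hs.role_P h he) h1, List.length_append]
        have := ih j (by omega) (by omega)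
        simp [he, this, h2, Nat.even_add_one]

theorem Legal.even_length_ov (hs : Legal A s) {n : ℕ} (hn : n ≤ s.length) :
    Even (ov A s n).length ↔ Even n := by
  rw [length_ov hn, hs.even_length_oviewIdx hn]

theorem Legal.even_iff_of_ov_eq (hs : Legal A s) (ht : Legal A t) {n k : ℕ} (hn : n ≤ s.length)
    (hk : k ≤ t.length) (h : ov A s n = ov A t k) : Even n ↔ Even k := by
  rw [← hs.even_length_ov hn, h, ht.even_length_ov hk]

theorem ov_zero : ov A s 0 = [] := by rw [ov, oviewIdx]; rfl

theorem Legal.oviewIdx_ne_nil (hs : Legal A s) {n : ℕ} (hn : n < s.length) :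
    oviewIdx A s (n + 1) ≠ [] := by
  obtain ⟨m, p, h⟩ := exists_getElem? hn
  by_cases he : Even n
  · rw [oviewIdx_of_O h (hs.role_O h he)]; simp
  · obtain ⟨j, rfl, h1, h2⟩ := hs.exists_ptr_of_P h he
    rw [oviewIdx_of_P h (hs.role_P h he) h1]; simp

theorem Legal.ov_eq_nil_iff (hs : Legal A s) {n : ℕ} (hn : n ≤ s.length) :
    ov A s n = [] ↔ n = 0 := by
  constructor
  · intro h
    cases n with
    | zero => rfl
    | succ n =>
      have := congrArg List.length h
      rw [length_ov hn] at this
      exact absurd (List.length_eq_zero_iff.1 this) (hs.oviewIdx_ne_nil hn)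
  · rintro rfl; exact ov_zero

theorem mem_ovw_iff {v : JSeq M} : v ∈ ovw A s ↔ ∃ n ≤ s.length, v = ov A s n := by
  constructor
  · rintro ⟨t, ⟨l, rfl⟩, rfl⟩
    exact ⟨t.length, by simp, (ov_append le_rfl).symm⟩
  · rintro ⟨n, hn, rfl⟩
    exact ⟨s.take n, List.take_prefix n s, (oview_take hn).symm⟩

theorem Legal.exists_ov_succ (hs : Legal A s) {i : ℕ} (hi : i < s.length) (he : Even i) :
    ∃ x, ov A s (i + 1) = ov A s i ++ [x] := by
  obtain ⟨m, p, h⟩ := exists_getElem? hi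
  exact ⟨_, ov_succ_of_O hs.ptrLt h (hs.role_O h he)⟩

/-- The O-views of `s` that end with a move of Opponent. -/
def oViews (A : Arena M) (s : JSeq M) : Set (JSeq M) :=
  {v | ∃ i < s.length, Even i ∧ v = ov A s (i + 1)}

theorem oOk_oViews : OOk A (oViews A s) s := fun i hi he => ⟨i, hi, he, rfl⟩

/-- Opponent is innocent in `s` if and only if the O-views of `s` are deterministic. -/
theorem Legal.oInnocent_iff (hs : Legal A s) : OInnocent A s ↔ ViewDet (oViews A s) := by
  constructor
  · rintro h v x y ⟨i, hi, hie, hx⟩ ⟨j, hj, hje, hy⟩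
    obtain ⟨x', hx'⟩ := hs.exists_ov_succ hi hie
    obtain ⟨y', hy'⟩ := hs.exists_ov_succ hj hje
    obtain ⟨hx1, hx2⟩ := List.append_inj' (hx.trans hx') rfl
    obtain ⟨hy1, hy2⟩ := List.append_inj' (hy.trans hy') rfl
    have e : ∀ k (hk : k < s.length), s.take k ++ [s[k]] = s.take (k + 1) := fun k hk => by simp
    have := h (s.take i) s[i] (s.take j) s[j] (by rw [e i hi]; exact List.take_prefix _ _)
      (by rw [e j hj]; exact List.take_prefix _ _)
      (hs.role_O (i := i) (p := s[i].2) (by simp) hie)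
      (hs.role_O (i := j) (p := s[j].2) (by simp) hje)
      (by rw [oview_take hi.le, oview_take hj.le, ← hx1, ← hy1])
    rw [e i hi, e j hj, oview_take hi, oview_take hj, ← hx, ← hy] at this
    simpa using this
  · rintro h s₁ o₁ s₂ o₂ h₁ h₂ r₁ r₂ hv
    have key : ∀ (s₁ : JSeq M) (o₁ : M × Option ℕ), s₁ ++ [o₁] <+: s → A.role o₁.1 = .O →
        oview A (s₁ ++ [o₁]) ∈ oViews A s ∧ ∃ x, oview A (s₁ ++ [o₁]) = oview A s₁ ++ [x] := by
      rintro s₁ ⟨m, p⟩ h₁ r₁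
      have hL := hs.of_prefix h₁
      have hm : (s₁ ++ [(m, p)])[s₁.length]? = some (m, p) := by simp
      obtain ⟨l, rfl⟩ := h₁
      have e : oview A (s₁ ++ [(m, p)]) = ov A (s₁ ++ [(m, p)] ++ l) (s₁.length + 1) := by
        rw [ov_append (by simp), oview, List.length_append]; rfl
      refine ⟨⟨s₁.length, by simp, (hL.role_iff hm).1 r₁, e⟩, ?_⟩
      have := ov_succ_of_O hL.ptrLt hm r₁
      rw [e, ov_append (by simp), this, ov_append le_rfl]
      exact ⟨_, rfl⟩
    obtain ⟨m1, x1, e1⟩ := key s₁ o₁ h₁ r₁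
    obtain ⟨m2, x2, e2⟩ := key s₂ o₂ h₂ r₂
    rw [e1] at m1
    rw [e2, ← hv] at m2
    rw [e1, e2, ← hv, h _ _ _ m1 m2]

theorem Legal.exists_init_zero (hs : Legal A s) (h : 0 < s.length) :
    ∃ m, s[0]? = some (m, none) ∧ A.init m := by
  obtain ⟨m, p, h0⟩ := exists_getElem? h
  rcases hs.justified 0 m p h0 with ⟨h1, rfl⟩ | ⟨j, _, _, _, h1, _⟩
  · exact ⟨m, h0, h1⟩
  · omega

theorem Legal.singleThreaded_iff (hs : Legal A s) : SingleThreaded A s ↔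
    0 < s.length ∧ ∀ i m, s[i]? = some (m, none) → i = 0 := by
  constructor
  · rintro ⟨i, ⟨x, hx, hi⟩, hu⟩
    have hlen : 0 < s.length := by have := lt_length_of_getElem? hx; omega
    obtain ⟨m₀, h0, h1⟩ := hs.exists_init_zero hlen
    refine ⟨hlen, fun k m hk => ?_⟩
    rw [hu k ⟨_, hk, (hs.init_iff hk).2 rfl⟩, hu 0 ⟨_, h0, h1⟩]
  · rintro ⟨h1, h2⟩
    obtain ⟨m, h3, h4⟩ := hs.exists_init_zero h1
    refine ⟨0, ⟨_, h3, h4⟩, ?_⟩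
    rintro k ⟨⟨m', p⟩, h5, h6⟩
    obtain rfl := (hs.init_iff h5).1 h6
    exact h2 k m' h5

/-- In a complete position, no O-view of a proper prefix with Opponent to move is the O-view of the
whole. -/
theorem Legal.ov_ne_of_complete (hs : Legal A s) (hc : pending A s s.length = none)
    (hl : Even s.length) {i : ℕ} (hi : i < s.length) (he : Even i) :
    ov A s i ≠ ov A s s.length := by
  intro h
  have := hs.pending_eq_none_of_ov_eq hs le_rfl hi.le hl he h.symm hc
  have := hs.length_oviewIdx_lt le_rfl hi this hc hl
  rw [← length_ov hi.le, ← length_ov le_rfl, h] at this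
  omega

theorem nil_notMem_oViews (hs : Legal A s) : [] ∉ oViews A s := by
  rintro ⟨i, hi, he, h⟩
  have := (hs.ov_eq_nil_iff hi).1 h.symm
  omega

/-- The final O-view of a complete play has no continuation among its O-views, so that a test can
answer there. -/
theorem oViews_final (hs : Legal A s) (hc : pending A s s.length = none) (hl : Even s.length) :
    ∀ v x, v ++ [x] ∈ oViews A s → v ≠ oview A s := by
  rintro v x ⟨i, hi, he, h⟩ rfl
  obtain ⟨y, hy⟩ := hs.exists_ov_succ hi he
  obtain ⟨h1, -⟩ := List.append_inj' (h.trans hy) rfl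
  exact hs.ov_ne_of_complete hc hl hi he h1.symm

/-- A play whose Opponent follows the O-views of a single-threaded play is single-threaded. -/
theorem singleThreaded_of_oOk (hs : Legal A s) (ht : Legal A t) (h1 : SingleThreaded A s)
    (ht₀ : 0 < t.length) (h : OOk A (oViews A s) t) : SingleThreaded A t := by
  rw [ht.singleThreaded_iff]
  rw [hs.singleThreaded_iff] at h1
  refine ⟨ht₀, fun i m hi => ?_⟩
  have hlt := lt_length_of_getElem? hi
  have hrole := A.init_role m ((ht.init_iff hi).2 rfl)
  have he := (ht.role_iff hi).1 hrole
  obtain ⟨k, hk, hke, hv⟩ := h i hlt he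
  obtain ⟨m', p', hm'⟩ := exists_getElem? hk
  have hr' := hs.role_O hm' hke
  rw [ov_succ_of_O ht.ptrLt hi hrole, ov_succ_of_O hs.ptrLt hm' hr'] at hv
  obtain ⟨e1, e2⟩ := List.append_inj' hv rfl
  have e3 := (Prod.mk.inj (List.cons.inj e2).1).2
  have : none = p' := bind_idxOf?_inj (by simp)
    (by rintro j rfl; exact hs.visible_O _ _ _ hm' hr') e3
  subst this
  obtain rfl := h1.2 k m' hm'
  rw [ov_zero] at e1
  exact (ht.ov_eq_nil_iff hlt.le).1 e1

theorem ovw_subset_of_oOk (hs : Legal A s) (ht : Legal A t) (h : OOk A (oViews A s) t)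
    (hf : oview A t = oview A s) : ovw A t ⊆ ovw A s := by
  intro v hv
  rw [mem_ovw_iff] at hv ⊢
  obtain ⟨n, hn, rfl⟩ := hv
  by_cases he : Even n
  · rcases eq_or_lt_of_le hn with rfl | hn
    · exact ⟨s.length, le_rfl, hf⟩
    · obtain ⟨x, hx⟩ := ht.exists_ov_succ hn he
      obtain ⟨k, hk, hke, hv⟩ := h n hn he
      obtain ⟨y, hy⟩ := hs.exists_ov_succ hk hke
      obtain ⟨h1, -⟩ := List.append_inj' (hx.symm.trans (hv.trans hy)) rfl
      exact ⟨k, hk.le, h1⟩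
  · cases n with
    | zero => simp at he
    | succ n =>
      rw [Nat.even_add_one, not_not] at he
      obtain ⟨k, hk, hke, hv⟩ := h n hn he
      exact ⟨k + 1, hk, hv⟩

/-- Two plays of an innocent strategy against the same deterministic Opponent agree as long as both
go on. -/
theorem getElem?_eq_of_oOk (hσ : IsInnocentStrategy A (plays A) σ) (hs : s ∈ σ) (ht : t ∈ σ)
    (hV : ViewDet V) (hsV : OOk A V s) (htV : OOk A V t) (n : ℕ) (hns : n < s.length)
    (hnt : n < t.length) : s[n]? = t[n]? := by
  have ls := hσ.subset_plays hs
  have lt := hσ.subset_plays ht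
  have hG : ∀ s l, s ++ l ∈ plays A → s ∈ plays A := fun _ _ h => plays_append h
  induction n using Nat.strong_induction_on with
  | _ n ih =>
    have hst : ∀ i < n, s[i]? = t[i]? := fun i hi => ih i hi (by omega) (by omega)
    obtain ⟨m, p, h⟩ := exists_getElem? hns
    obtain ⟨m', p', h'⟩ := exists_getElem? hnt
    rw [h, h']
    by_cases he : Even n
    · rw [ls.eq_of_ov_mem hV lt he hst h h' (hsV n hns he) (htV n hnt he)]
    · rw [ls.eq_of_pv_mem (hσ.viewDet le_rfl hG) lt he hst h h'
        (((hσ.mem_iff le_rfl hG).1 hs).2.2 n hns he) (((hσ.mem_iff le_rfl hG).1 ht).2.2 n hnt he)]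

/-- Two plays of an innocent strategy against the same deterministic Opponent are equal if they end
with the same O-view, at which Opponent has no move. -/
theorem eq_of_oOk (hσ : IsInnocentStrategy A (plays A) σ) (hs : s ∈ σ) (ht : t ∈ σ)
    (hV : ViewDet V) (hsV : OOk A V s) (htV : OOk A V t)
    (hF : ∀ v x, v ++ [x] ∈ V → v ≠ oview A s) (hst : oview A t = oview A s) : s = t := by
  have ls := hσ.subset_plays hs
  have lt := hσ.subset_plays ht
  have key := getElem?_eq_of_oOk hσ hs ht hV hsV htV
  have hlen : s.length = t.length := by
    rcases lt_trichotomy s.length t.length with h | h | h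
    · exfalso
      have he := hσ.even_length s hs
      obtain ⟨x, hx⟩ := lt.exists_ov_succ h he
      have := htV s.length h he
      rw [hx] at this
      refine hF _ _ this ?_
      exact (ov_congr fun i hi => key i hi (by omega)).symm
    · exact h
    · exfalso
      have he := hσ.even_length t ht
      obtain ⟨x, hx⟩ := ls.exists_ov_succ h he
      have := hsV t.length h he
      rw [hx] at this
      refine hF _ _ this ?_
      rw [← hst]
      exact ov_congr fun i hi => key i (by omega) hi
  refine List.ext_getElem? fun n => ?_
  rcases Nat.lt_or_ge n s.length with hn | hn
  · exact key n hn (by omega)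
  · rw [List.getElem?_eq_none hn, List.getElem?_eq_none (by omega)]

/-- The test built from an observable play `s` of `σ` succeeds on `σ`; if it succeeds on `τ`, it
does so on an observable play whose O-views are among those of `s`. -/
theorem exists_of_obsLE (hσ : IsInnocentStrategy A (plays A) σ)
    (hτ : IsInnocentStrategy A (plays A) τ) (h : ObsLE A σ τ) (hs : s ∈ σ) (hc : Complete A s)
    (ho : OInnocent A s) (h1 : SingleThreaded A s) :
    ∃ t ∈ τ, Complete A t ∧ OInnocent A t ∧ SingleThreaded A t ∧ OOk A (oViews A s) t ∧
      oview A t = oview A s := by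
  have ls : Legal A s := hσ.subset_plays hs
  have he := hσ.even_length s hs
  rw [ls.complete_iff] at hc
  rw [ls.oInnocent_iff] at ho
  have hVF := oViews_final ls hc he
  have hα : IsInnocentTest A (viewTest A (oViews A s) {oview A s}) :=
    isInnocentTest_viewTest ho (nil_notMem_oViews ls) hVF
  have := h _ hα ((comp_eq_sigmaTop_iff hσ hα).2
    ⟨s, hs, (append_finalEntry_mem_viewTest_iff ls he).2 ⟨oOk_oViews, rfl, hc⟩⟩)
  obtain ⟨t, ht, htα⟩ := (comp_eq_sigmaTop_iff hτ hα).1 this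
  have lt : Legal A t := hτ.subset_plays ht
  obtain ⟨h2, h3, h4⟩ := (append_finalEntry_mem_viewTest_iff lt (hτ.even_length t ht)).1 htα
  have ht₀ : 0 < t.length := by
    by_contra hc'
    have e := (ls.ov_eq_nil_iff (n := s.length) le_rfl).1 (by
      have : oview A s = [] := by
        rw [← show oview A t = oview A s from h3]
        exact (lt.ov_eq_nil_iff le_rfl).2 (by omega)
      exact this)
    have := (ls.singleThreaded_iff.1 h1).1
    omega
  refine ⟨t, ht, lt.complete_iff.2 h4, lt.oInnocent_iff.2 ?_, singleThreaded_of_oOk ls lt h1 ht₀ h2,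
    h2, h3⟩
  rintro v x y ⟨i, hi, hie, hx⟩ ⟨j, hj, hje, hy⟩
  exact ho v x y (hx ▸ h2 i hi hie) (hy ▸ h2 j hj hje)

/-- A single test gives only `ovw t ⊆ ovw s`, where `t` is the play of `τ` that passes the test
built from the play `s` of `σ`. The test built from `t` leads back to a play of `σ` with still fewer
O-views, and this play is `s`. -/
theorem obs_subset_of_obsEquiv (hσ : IsInnocentStrategy A (plays A) σ)
    (hτ : IsInnocentStrategy A (plays A) τ) (h : ObsEquiv A σ τ) : obs A σ ⊆ obs A τ := by
  rintro X ⟨s, hs, hc, ho, h1, rfl⟩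
  obtain ⟨t, ht, htc, hto, ht1, htV, htf⟩ := exists_of_obsLE hσ hτ h.1 hs hc ho h1
  obtain ⟨u, hu, huc, huo, hu1, huV, huf⟩ := exists_of_obsLE hτ hσ h.2 ht htc hto ht1
  have ls : Legal A s := hσ.subset_plays hs
  have lt : Legal A t := hτ.subset_plays ht
  have lu : Legal A u := hσ.subset_plays hu
  have huV' : OOk A (oViews A s) u := by
    intro i hi he
    obtain ⟨k, hk, hke, hv⟩ := huV i hi he
    rw [hv]; exact htV k hk hke
  obtain rfl : s = u := eq_of_oOk hσ hs hu (ls.oInnocent_iff.1 ho) oOk_oViews huV'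
    (oViews_final ls (ls.complete_iff.1 hc) (hσ.even_length s hs)) (huf.trans htf)
  exact ⟨t, ht, htc, hto, ht1,
    (ovw_subset_of_oOk lt ls huV huf).antisymm (ovw_subset_of_oOk ls lt htV htf)⟩

end Observations

/-! ### Threads -/

section Threads

variable {M : Type*} {A : Arena M} {s t : JSeq M} {r : ℕ}

/-- The position at which the chain of pointers from position `i` of `s` ends. -/
def root (s : JSeq M) (i : ℕ) : ℕ :=
  match s[i]? with
  | some (_, some j) => if j < i then root s j else i
  | _ => i
termination_by i

theorem root_of_none {i : ℕ} {m : M} (h : s[i]? = some (m, none)) : root s i = i := by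
  rw [root, h]

theorem root_of_some {i j : ℕ} {m : M} (h : s[i]? = some (m, some j)) (hj : j < i) :
    root s i = root s j := by
  rw [root, h]; simp [hj]

theorem root_congr {i : ℕ} (h : ∀ k ≤ i, s[k]? = t[k]?) : root s i = root t i := by
  induction i using Nat.strong_induction_on with
  | _ i ih =>
    rw [root, root, h i le_rfl]
    split
    · split
      · rename_i j _ hj
        exact ih _ (by omega) fun k hk => h k (by omega)
      · rfl
    · rfl

theorem root_append {l : JSeq M} {i : ℕ} (h : i < s.length) : root (s ++ l) i = root s i :=
  root_congr fun _ hk => getElem?_append_lt (by omega)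

theorem root_le (i : ℕ) : root s i ≤ i := by
  induction i using Nat.strong_induction_on with
  | _ i ih =>
    rw [root]
    split
    · split
      · rename_i j _ hj
        exact (ih _ hj).trans hj.le
      · rfl
    · rfl

/-- The positions of the thread of `s` that begins at position `r`. -/
def threadIdx (s : JSeq M) (r : ℕ) : List ℕ :=
  (List.range s.length).filter fun i => root s i = r

/-- The thread of `s` that begins at position `r`. -/
def thread (s : JSeq M) (r : ℕ) : JSeq M := s.select (threadIdx s r)

/-- The number of moves in the thread beginning at `r` among the first `n` moves of `s`. -/
def threadCount (s : JSeq M) (r n : ℕ) : ℕ := Nat.count (fun i => root s i = r) n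

theorem threadCount_succ_of_eq {n : ℕ} (h : root s n = r) :
    threadCount s r (n + 1) = threadCount s r n + 1 := by
  simp [threadCount, Nat.count_succ, h]

theorem threadCount_succ_of_ne {n : ℕ} (h : root s n ≠ r) :
    threadCount s r (n + 1) = threadCount s r n := by
  simp [threadCount, Nat.count_succ, h]

theorem threadCount_mono {i j : ℕ} (h : i ≤ j) : threadCount s r i ≤ threadCount s r j :=
  Nat.count_monotone _ h

theorem threadCount_lt {i j : ℕ} (hi : root s i = r) (h : i < j) :
    threadCount s r i < threadCount s r j := Nat.count_strict_mono hi h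

theorem threadCount_inj {i j : ℕ} (hi : root s i = r) (hj : root s j = r)
    (h : threadCount s r i = threadCount s r j) : i = j := Nat.count_injective hi hj h

theorem threadCount_congr {n : ℕ} (h : ∀ i < n, s[i]? = t[i]?) :
    threadCount s r n = threadCount t r n := by
  induction n with
  | zero => simp [threadCount]
  | succ n ih =>
    have e : root s n = root t n := root_congr fun k hk => h k (by omega)
    have := ih fun i hi => h i (by omega)
    by_cases hr : root s n = r
    · rw [threadCount_succ_of_eq hr, threadCount_succ_of_eq (e ▸ hr), this]
    · rw [threadCount_succ_of_ne hr, threadCount_succ_of_ne (e ▸ hr), this]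

theorem threadCount_append {l : JSeq M} {n : ℕ} (h : n ≤ s.length) :
    threadCount (s ++ l) r n = threadCount s r n :=
  threadCount_congr fun _ hi => getElem?_append_lt (hi.trans_le h)

theorem length_filter_range (p : ℕ → Prop) [DecidablePred p] (n : ℕ) :
    ((List.range n).filter fun i => p i).length = Nat.count p n := by
  induction n with
  | zero => simp
  | succ n ih =>
    rw [List.range_succ, List.filter_append, List.length_append, ih, Nat.count_succ,
      List.filter_singleton]
    by_cases h : p n <;> simp [h]

theorem getElem?_filter_range (p : ℕ → Prop) [DecidablePred p] {n j : ℕ} (hj : j < n) (h : p j) :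
    ((List.range n).filter fun i => p i)[Nat.count p j]? = some j := by
  induction n with
  | zero => omega
  | succ n ih =>
    rw [List.range_succ, List.filter_append]
    rcases Nat.lt_succ_iff_lt_or_eq.1 hj with hj | rfl
    · rw [List.getElem?_append_left]
      · exact ih hj
      · rw [length_filter_range]; exact Nat.count_strict_mono h hj
    · rw [← length_filter_range p j, List.filter_singleton]
      simp [h]

theorem length_threadIdx : (threadIdx s r).length = threadCount s r s.length :=
  length_filter_range _ _

theorem mem_threadIdx {i : ℕ} : i ∈ threadIdx s r ↔ i < s.length ∧ root s i = r := by
  simp [threadIdx]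

theorem nodup_threadIdx : (threadIdx s r).Nodup := List.nodup_range.filter _

theorem getElem?_threadIdx {i : ℕ} (hi : i < s.length) (h : root s i = r) :
    (threadIdx s r)[threadCount s r i]? = some i := getElem?_filter_range _ hi h

theorem idxOf?_threadIdx {i : ℕ} (hi : i < s.length) (h : root s i = r) :
    (threadIdx s r).idxOf? i = some (threadCount s r i) :=
  idxOf?_getElem nodup_threadIdx (getElem?_threadIdx hi h)

theorem length_thread : (thread s r).length = threadCount s r s.length := by
  rw [thread, length_select fun i hi => (mem_threadIdx.1 hi).1, length_threadIdx]

theorem getElem?_thread (hw : PtrLt s) {i : ℕ} {m : M} {p : Option ℕ} (h : s[i]? = some (m, p))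
    (hi : root s i = r) :
    (thread s r)[threadCount s r i]? = some (m, p.map (threadCount s r)) := by
  have hlt := lt_length_of_getElem? h
  rw [thread, getElem?_select fun i hi => (mem_threadIdx.1 hi).1, getElem?_threadIdx hlt hi,
    Option.bind_some, h, Option.map_some]
  cases p with
  | none => rfl
  | some j =>
    have hj := hw _ _ _ h
    rw [Option.bind_some, idxOf?_threadIdx (hj.trans hlt) (by rw [← root_of_some h hj, hi])]
    rfl

theorem exists_of_lt_length_thread {k : ℕ} (h : k < (thread s r).length) :
    ∃ i < s.length, root s i = r ∧ threadCount s r i = k := by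
  rw [length_thread, ← length_threadIdx] at h
  have hi := mem_threadIdx.1 (List.getElem_mem h)
  refine ⟨_, hi.1, hi.2, ?_⟩
  have := idxOf?_threadIdx hi.1 hi.2
  rw [idxOf?_getElem nodup_threadIdx (List.getElem?_eq_getElem h)] at this
  exact (Option.some.inj this).symm

theorem threadIdx_append_singleton (x : M × Option ℕ) : threadIdx (s ++ [x]) r =
    threadIdx s r ++ if root (s ++ [x]) s.length = r then [s.length] else [] := by
  unfold threadIdx
  rw [List.length_append, List.length_singleton, List.range_succ, List.filter_append]
  congr 1
  · refine List.filter_congr fun i hi => ?_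
    rw [root_append (List.mem_range.1 hi)]
  · simp [List.filter_singleton]

theorem thread_append_of_ne {x : M × Option ℕ} (h : root (s ++ [x]) s.length ≠ r) :
    thread (s ++ [x]) r = thread s r := by
  rw [thread, threadIdx_append_singleton, if_neg h, List.append_nil,
    select_congr fun i hi => getElem?_append_lt (mem_threadIdx.1 hi).1, thread]

theorem thread_append_of_eq {m : M} {p : Option ℕ} (hw : PtrLt (s ++ [(m, p)]))
    (h : root (s ++ [(m, p)]) s.length = r) :
    thread (s ++ [(m, p)]) r = thread s r ++ [(m, p.map (threadCount s r))] := by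
  have hx : (s ++ [(m, p)])[s.length]? = some (m, p) := by simp
  rw [thread, threadIdx_append_singleton, if_pos h,
    select_snoc hw (fun i hi => (mem_threadIdx.1 hi).1) hx,
    select_congr fun i hi => getElem?_append_lt (mem_threadIdx.1 hi).1, thread]
  cases p with
  | none => rfl
  | some j =>
    have hj := hw _ _ _ hx
    rw [Option.bind_some, idxOf?_threadIdx hj]
    · rfl
    · rw [← h, root_of_some hx hj, root_append hj]

theorem thread_prefix {l : JSeq M} : PtrLt (s ++ l) → thread s r <+: thread (s ++ l) r := by
  induction l using List.reverseRecOn with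
  | nil => simp
  | append_singleton l x ih =>
    intro hw
    rw [← List.append_assoc] at hw ⊢
    refine (ih hw.append_left).trans ?_
    by_cases h : root (s ++ l ++ [x]) (s ++ l).length = r
    · obtain ⟨m, p⟩ := x
      rw [thread_append_of_eq hw h]
      exact List.prefix_append _ _
    · rw [thread_append_of_ne h]

/-- At Player's turn, the P-view lies in a single thread, that of Opponent's last move. -/
theorem Legal.root_of_mem_pviewIdx (hs : Legal A s) {n : ℕ} (hn : n ≤ s.length) (ho : ¬ Even n)
    {k : ℕ} (hk : k ∈ pviewIdx A s n) : root s k = root s (n - 1) := by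
  induction n using Nat.strong_induction_on generalizing k with
  | _ n ih =>
    cases n with
    | zero => simp at ho
    | succ n =>
      obtain ⟨m, p, h⟩ := exists_getElem? (s := s) (i := n) (by omega)
      have he : Even n := by rwa [Nat.even_add_one, not_not] at ho
      cases p with
      | none =>
        rw [pviewIdx_of_none h (hs.role_O h he)] at hk
        simp_all
      | some j =>
        obtain ⟨h1, h2⟩ := hs.odd_ptr_of_O h he
        rw [pviewIdx_of_O h (hs.role_O h he) h1] at hk
        rw [Nat.add_sub_cancel, root_of_some h h1]
        obtain ⟨m', p', hj⟩ := exists_getElem? (s := s) (i := j) (by omega)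
        obtain ⟨j', rfl, h3, h4⟩ := hs.exists_ptr_of_P hj h2
        have e : root s j = root s (j - 1) := by
          rw [root_of_some hj h3]
          exact ih j (by omega) (by omega) h2 (hs.visible_P _ _ _ hj (hs.role_P hj h2))
        simp only [List.mem_append, List.mem_cons, List.not_mem_nil, or_false] at hk
        rcases hk with hk | rfl | rfl
        · rw [ih j (by omega) (by omega) h2 hk, e]
        · rfl
        · exact root_of_some h h1

/-- Player answers Opponent in the same thread. -/
theorem Legal.root_succ (hs : Legal A s) {i : ℕ} (hi : i + 1 < s.length) (he : Even i) :
    root s (i + 1) = root s i := by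
  have ho : ¬ Even (i + 1) := by rwa [Nat.even_add_one, not_not]
  obtain ⟨m, p, h⟩ := exists_getElem? hi
  obtain ⟨j, rfl, h1, h2⟩ := hs.exists_ptr_of_P h ho
  rw [root_of_some h h1]
  exact hs.root_of_mem_pviewIdx hi.le ho (hs.visible_P _ _ _ h (hs.role_P h ho))

/-- If the moves at odd positions belong to the same threads as their predecessors, every thread
consists of pairs of adjacent moves. -/
theorem even_threadCount (hr : ∀ i, i + 1 < s.length → Even i → root s (i + 1) = root s i)
    {n : ℕ} (hn : n ≤ s.length) (he : Even n) : Even (threadCount s r n) := by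
  induction n using Nat.strong_induction_on with
  | _ n ih =>
    rcases n with _ | _ | n
    · simp [threadCount]
    · simp at he
    · have he' : Even n := by rwa [Nat.even_add_one, Nat.even_add_one, not_not] at he
      have := ih n (by omega) (by omega) he'
      have e := hr n (by omega) he'
      by_cases h : root s n = r
      · rw [threadCount_succ_of_eq (e.trans h), threadCount_succ_of_eq h, Nat.even_add_one,
          Nat.even_add_one, not_not]
        exact this
      · rw [threadCount_succ_of_ne (e ▸ h), threadCount_succ_of_ne h]
        exact this

theorem even_threadCount_iff (hr : ∀ i, i + 1 < s.length → Even i → root s (i + 1) = root s i)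
    {i : ℕ} (hi : i < s.length) (h : root s i = r) : Even (threadCount s r i) ↔ Even i := by
  constructor
  · intro h1
    by_contra ho
    obtain ⟨k, rfl⟩ := Nat.exists_eq_succ_of_ne_zero (n := i) (by rintro rfl; simp at ho)
    have hk : Even k := by rwa [Nat.even_add_one, not_not] at ho
    rw [Nat.succ_eq_add_one, threadCount_succ_of_eq ((hr k hi hk).symm.trans h),
      Nat.even_add_one] at h1
    exact h1 (even_threadCount hr (by omega) hk)
  · exact even_threadCount hr hi.le

theorem Legal.even_threadCount_iff (hs : Legal A s) {i : ℕ} (hi : i < s.length)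
    (h : root s i = r) : Even (threadCount s r i) ↔ Even i :=
  InnocentGames.even_threadCount_iff (fun _ => hs.root_succ) hi h

/-- The P-views of a thread are those of the whole. -/
theorem Legal.pviewIdx_thread (hs : Legal A s) {i : ℕ} (hi : i < s.length) (hr : root s i = r) :
    pviewIdx A (thread s r) (threadCount s r i + 1) =
      (pviewIdx A s (i + 1)).map (threadCount s r) := by
  induction i using Nat.strong_induction_on with
  | _ i ih =>
    obtain ⟨m, p, h⟩ := exists_getElem? hi
    have ht := getElem?_thread hs.ptrLt h hr
    by_cases he : Even i
    · have hm := hs.role_O h he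
      cases p with
      | none =>
        rw [pviewIdx_of_none h hm, pviewIdx_of_none ht hm]; rfl
      | some j =>
        obtain ⟨h1, h2⟩ := hs.odd_ptr_of_O h he
        have hjr : root s j = r := by rw [← root_of_some h h1, hr]
        rw [pviewIdx_of_O h hm h1, pviewIdx_of_O ht hm (threadCount_lt hjr h1)]
        obtain ⟨k, rfl⟩ := Nat.exists_eq_succ_of_ne_zero (n := j) (by rintro rfl; simp at h2)
        have hk : Even k := by rwa [Nat.even_add_one, not_not] at h2
        have hkr : root s k = r := (hs.root_succ (by omega) hk).symm.trans hjr
        have := ih k (by omega) (by omega) hkr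
        rw [← threadCount_succ_of_eq hkr] at this
        simp [this]
    · have hm := hs.role_P h he
      rw [pviewIdx_of_P h hm, pviewIdx_of_P ht hm]
      obtain ⟨k, rfl⟩ := Nat.exists_eq_succ_of_ne_zero (n := i) (by rintro rfl; simp at he)
      have hk : Even k := by rwa [Nat.even_add_one, not_not] at he
      have hkr : root s k = r := (hs.root_succ (by omega) hk).symm.trans hr
      have := ih k (by omega) (by omega) hkr
      rw [← threadCount_succ_of_eq hkr] at this
      simp [this]

theorem Legal.pv_thread (hs : Legal A s) {i : ℕ} (hi : i < s.length) (hr : root s i = r) :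
    pv A (thread s r) (threadCount s r i + 1) = pv A s (i + 1) := by
  rw [pv, hs.pviewIdx_thread hi hr, pv]
  have hmem : ∀ k ∈ pviewIdx A s (i + 1), root s k = r := by
    intro k hk
    by_cases he : Even i
    · rw [hs.root_of_mem_pviewIdx hi (by rwa [Nat.even_add_one, not_not]) hk]
      exact hr
    · obtain ⟨m, p, h⟩ := exists_getElem? hi
      rw [pviewIdx_of_P h (hs.role_P h he), List.mem_append] at hk
      rcases hk with hk | hk
      · obtain ⟨k', rfl⟩ := Nat.exists_eq_succ_of_ne_zero (n := i) (by rintro rfl; simp at he)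
        have hk' : Even k' := by rwa [Nat.even_add_one, not_not] at he
        rw [hs.root_of_mem_pviewIdx hi.le he hk]
        exact (hs.root_succ hi hk').symm.trans hr
      · simp at hk; rw [hk, hr]
  refine select_map (S := {k | root s k = r}) (fun a ha b hb h => threadCount_inj ha hb h) hmem ?_
  intro k hk
  obtain ⟨m, p, h⟩ := exists_getElem? (s := s) (i := k) (by
    have := lt_of_mem_pviewIdx hk; omega)
  refine ⟨m, p, h, ?_, getElem?_thread hs.ptrLt h (hmem k hk)⟩
  rintro j rfl
  exact (root_of_some h (hs.ptrLt _ _ _ h)).symm.trans (hmem k hk)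

/-- Between a pending question and the present, everything that has been asked in a thread has
been answered. -/
theorem Legal.pending_thread_between (hs : Legal A s) {n j : ℕ} (hn : n ≤ s.length)
    (h : pending A s n = some j) :
    pending A (thread s r) (threadCount s r n) =
      pending A (thread s r) (threadCount s r (j + 1)) := by
  induction n using Nat.strong_induction_on generalizing j with
  | _ n ih =>
    cases n with
    | zero => simp [pending] at h
    | succ n =>
      rcases hs.pending_succ hn with ⟨m, p, h1, h2, h3⟩ | ⟨m, k, h1, h2, h3, h4, h5⟩
      · rw [h3] at h; cases h; rfl
      · rw [h5] at h
        have e1 := ih n (by omega) (by omega) h4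
        have e2 := ih k (by omega) (by omega) h
        have e3 := root_of_some h1 h3
        by_cases hr : root s n = r
        · have := getElem?_thread hs.ptrLt h1 hr
          rw [threadCount_succ_of_eq hr,
            pending_of_answer this h2 (threadCount_lt (e3.symm.trans hr) h3), e2]
        · rw [threadCount_succ_of_ne hr, e1, threadCount_succ_of_ne (e3 ▸ hr), e2]

theorem Legal.pending_thread (hs : Legal A s) {n j : ℕ} (hn : n ≤ s.length)
    (h : pending A s n = some j) (hj : root s j = r) :
    pending A (thread s r) (threadCount s r n) = some (threadCount s r j) := by
  rw [hs.pending_thread_between hn h, threadCount_succ_of_eq hj]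
  obtain ⟨-, m, p, h1, h2⟩ := hs.pending_spec hn h
  exact pending_of_question (getElem?_thread hs.ptrLt h1 hj) h2

theorem Legal.complete_thread (hs : Legal A s) (hc : Complete A s) :
    Complete A (thread s r) := by
  intro k m p hk hm
  obtain ⟨i, hi, hr, rfl⟩ := exists_of_lt_length_thread (lt_length_of_getElem? hk)
  obtain ⟨m', p', h⟩ := exists_getElem? hi
  have h1 := getElem?_thread hs.ptrLt h hr
  rw [hk] at h1
  cases h1
  obtain ⟨l, n, h2, h3⟩ := hc i m p' h hm
  have hl : root s l = r := (root_of_some h2 (hs.ptrLt _ _ _ h2)).trans hr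
  exact ⟨_, n, getElem?_thread hs.ptrLt h2 hl, h3⟩

end Threads

/-! ### The core of a position relative to a thread -/

section Core

variable {M : Type*} {A : Arena M} {s t x y w : JSeq M} {r n : ℕ} {e : ℕ → ℕ}

/-- `x`, embedded by `e`, is the core of the prefix of `s` of length `n`, relative to the thread
that begins at `r`: the subsequence of the positions reached from the last one by going from a
Player's move of this thread to its justifier, and from any other move to its predecessor. It is
described from outside: its moves follow each other as in `s` but for Player's moves of the thread,
which follow their justifiers. The last field says that the core meets the thread in the O-view of
the thread. -/
structure IsCore (A : Arena M) (s : JSeq M) (r n : ℕ) (x : JSeq M) (e : ℕ → ℕ) : Prop where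
  lt_length : r < x.length
  map_length : e x.length = n
  mono : ∀ i j, i < j → j ≤ x.length → e i < e j
  map_init : ∀ i ≤ r, e i = i
  getElem? : ∀ i m p, x[i]? = some (m, p) → s[e i]? = some (m, p.map e)
  ptrLt : PtrLt x
  even : ∀ i ≤ x.length, Even (e i) ↔ Even i
  map_succ : ∀ i, i + 1 < x.length → Even (i + 1) ∨ root x (i + 1) ≠ r → e (i + 1) = e i + 1
  map_last : e x.length = e (x.length - 1) + 1
  ptr_eq : ∀ i m p, x[i]? = some (m, p) → ¬ Even i → root x i = r → p = some (i - 1)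
  oviewIdx_thread : oviewIdx A (thread s r) (threadCount s r n) =
    ((List.range x.length).filter fun i => root x i = r).map fun i => threadCount s r (e i)

namespace IsCore

theorem injOn (h : IsCore A s r n x e) : Set.InjOn e {i | i ≤ x.length} := by
  intro i hi j hj hij
  rcases lt_trichotomy i j with hlt | rfl | hlt
  · have := h.mono i j hlt hj; omega
  · rfl
  · have := h.mono j i hlt hi; omega

theorem exists_getElem? (h : IsCore A s r n x e) {i : ℕ} (hi : i < x.length) :
    ∃ m p, x[i]? = some (m, p) ∧ s[e i]? = some (m, p.map e) := by
  obtain ⟨m, p, h1⟩ := InnocentGames.exists_getElem? hi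
  exact ⟨m, p, h1, h.getElem? i m p h1⟩

theorem le_length (h : IsCore A s r n x e) : n ≤ s.length := by
  have h0 := h.lt_length
  obtain ⟨m, p, -, h1⟩ := h.exists_getElem? (i := x.length - 1) (by omega)
  have h2 := lt_length_of_getElem? h1
  have h3 := h.map_last
  have h4 := h.map_length
  omega

theorem root_map (h : IsCore A s r n x e) {i : ℕ} (hi : i < x.length) :
    root s (e i) = e (root x i) := by
  induction i using Nat.strong_induction_on with
  | _ i ih =>
    obtain ⟨m, p, h1, h2⟩ := h.exists_getElem? hi
    cases p with
    | none => rw [root_of_none h1, root_of_none h2]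
    | some j =>
      have hj := h.ptrLt _ _ _ h1
      rw [root_of_some h1 hj, root_of_some h2 (h.mono j i hj hi.le), ih j hj (by omega)]

theorem root_eq_iff (h : IsCore A s r n x e) {i : ℕ} (hi : i < x.length) :
    root s (e i) = r ↔ root x i = r := by
  rw [h.root_map hi]
  constructor
  · intro hr
    rw [← h.map_init r le_rfl] at hr
    exact h.injOn ((root_le i).trans hi.le) h.lt_length.le hr
  · intro hr; rw [hr, h.map_init r le_rfl]

theorem root_lt_iff (h : IsCore A s r n x e) {i : ℕ} (hi : i < x.length) :
    root s (e i) < r ↔ root x i < r := by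
  rw [h.root_map hi]
  constructor
  · intro hr
    by_contra hc
    rcases eq_or_lt_of_le (Nat.le_of_not_lt hc) with h1 | h1
    · rw [← h1, h.map_init r le_rfl] at hr; omega
    · have := h.mono r _ h1 ((root_le i).trans hi.le)
      rw [h.map_init r le_rfl] at this; omega
  · intro hr; rwa [h.map_init _ hr.le]

theorem role_iff (h : IsCore A s r n x e) (hs : Legal A s) {i : ℕ} {m : M} {p : Option ℕ}
    (hi : x[i]? = some (m, p)) : A.role m = .O ↔ Even i := by
  rw [hs.role_iff (h.getElem? i m p hi), h.even i (lt_length_of_getElem? hi).le]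

theorem root_succ (h : IsCore A s r n x e) (hs : Legal A s) {i : ℕ} (hi : i + 1 < x.length)
    (he : Even i) : root x (i + 1) = root x i := by
  by_cases hr : root x (i + 1) = r
  · obtain ⟨m, p, h1, -⟩ := h.exists_getElem? hi
    have := h.ptr_eq _ m p h1 (by rwa [Nat.even_add_one, not_not]) hr
    subst this
    rw [root_of_some h1 (by omega), Nat.add_sub_cancel]
  · have h1 := h.map_succ i hi (Or.inr hr)
    obtain ⟨m, p, -, h2⟩ := h.exists_getElem? hi
    have h3 := lt_length_of_getElem? h2
    have h4 := hs.root_succ (i := e i) (by omega) ((h.even i (by omega)).2 he)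
    rw [← h1, h.root_map hi, h.root_map (by omega)] at h4
    exact h.injOn ((root_le _).trans hi.le) ((root_le _).trans (by omega)) h4

/-- The O-view at a move of the core lies in the core, and is its O-view there: it goes back from
Opponent's moves to their predecessors and from Player's moves to their justifiers. -/
theorem oviewIdx_map (h : IsCore A s r n x e) (hs : Legal A s) {i : ℕ} (hi : i < x.length) :
    oviewIdx A s (e i + 1) = (oviewIdx A x (i + 1)).map e := by
  induction i using Nat.strong_induction_on with
  | _ i ih =>
    -- The O-view before a move of Opponent is preserved as well.
    have before : ∀ k ≤ i, Even k → oviewIdx A s (e k) = (oviewIdx A x k).map e := by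
      intro k hk hke
      cases k with
      | zero => rw [h.map_init 0 (by omega)]; simp [oviewIdx]
      | succ k => rw [h.map_succ k (by omega) (Or.inl hke), ih k (by omega) (by omega)]
    obtain ⟨m, p, h1, h2⟩ := h.exists_getElem? hi
    by_cases he : Even i
    · have hm := (h.role_iff hs h1).2 he
      rw [oviewIdx_of_O h1 hm, oviewIdx_of_O h2 hm, before i le_rfl he]
      simp
    · have he' := mt (h.even i hi.le).1 he
      have hm := hs.role_P h2 he'
      obtain ⟨j', hp, hj1, hj2⟩ := hs.exists_ptr_of_P h2 he'
      obtain ⟨j, rfl, rfl⟩ := Option.map_eq_some_iff.1 hp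
      have hj := h.ptrLt _ _ _ h1
      rw [oviewIdx_of_P h1 hm hj, oviewIdx_of_P h2 hm hj1,
        before j hj.le ((h.even j (by omega)).1 hj2)]
      simp

theorem oviewIdx_last (h : IsCore A s r n x e) (hs : Legal A s) :
    oviewIdx A s n = (oviewIdx A x x.length).map e := by
  have h0 := h.lt_length
  have := h.oviewIdx_map hs (i := x.length - 1) (by omega)
  rwa [← h.map_last, h.map_length, Nat.sub_add_cancel (by omega)] at this

theorem oviewIdx_of_even (h : IsCore A s r n x e) (hs : Legal A s) {i : ℕ} (hi : i < x.length)
    (he : Even i) : oviewIdx A s (e i) = (oviewIdx A x i).map e := by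
  cases i with
  | zero => rw [h.map_init 0 (by omega)]; simp [oviewIdx]
  | succ k => rw [h.map_succ k hi (Or.inl he), h.oviewIdx_map hs (by omega)]

theorem select_map_eq (h : IsCore A s r n x e) {l : List ℕ} (hl : ∀ i ∈ l, i < x.length) :
    s.select (l.map e) = x.select l := by
  refine select_map (h.injOn.mono (Set.Iio_subset_Iic_self)) hl fun i hi => ?_
  obtain ⟨m, p, h1, h2⟩ := h.exists_getElem? (hl i hi)
  refine ⟨m, p, h1, ?_, h2⟩
  rintro j rfl
  exact (h.ptrLt _ _ _ h1).trans (hl i hi)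

theorem ov_map (h : IsCore A s r n x e) (hs : Legal A s) {i : ℕ} (hi : i < x.length) :
    ov A s (e i + 1) = ov A x (i + 1) := by
  rw [ov, h.oviewIdx_map hs hi, ov]
  exact h.select_map_eq fun k hk => by have := lt_of_mem_oviewIdx hk; omega

theorem ov_last (h : IsCore A s r n x e) (hs : Legal A s) : ov A s n = ov A x x.length := by
  rw [ov, h.oviewIdx_last hs, ov]
  exact h.select_map_eq fun k hk => lt_of_mem_oviewIdx hk

/-- The P-view at a move of the core outside the thread lies in the core, since it does not meet
the thread. -/
theorem pviewIdx_map (h : IsCore A s r n x e) (hs : Legal A s) {i : ℕ} (hi : i < x.length)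
    (hr : root x i ≠ r) : pviewIdx A s (e i + 1) = (pviewIdx A x (i + 1)).map e := by
  induction i using Nat.strong_induction_on with
  | _ i ih =>
    have before : ∀ k ≤ i, ¬ Even k → root x k ≠ r →
        pviewIdx A s (e k) = (pviewIdx A x k).map e := by
      intro k hk hke hkr
      cases k with
      | zero => simp at hke
      | succ k =>
        have hk' : Even k := by rwa [Nat.even_add_one, not_not] at hke
        rw [h.map_succ k (by omega) (Or.inr hkr), ih k (by omega) (by omega)]
        rwa [← h.root_succ hs (by omega) hk']
    obtain ⟨m, p, h1, h2⟩ := h.exists_getElem? hi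
    by_cases he : Even i
    · have hm := (h.role_iff hs h1).2 he
      cases p with
      | none => rw [pviewIdx_of_none h1 hm, pviewIdx_of_none h2 hm]; rfl
      | some j =>
        have hj := h.ptrLt _ _ _ h1
        have hj2 := (hs.odd_ptr_of_O h2 ((h.even i hi.le).2 he)).2
        rw [h.even j (by omega)] at hj2
        rw [pviewIdx_of_O h1 hm hj, pviewIdx_of_O h2 hm (h.mono j i hj hi.le),
          before j hj.le hj2 (by rwa [← root_of_some h1 hj])]
        simp
    · have hm := hs.role_P h2 (mt (h.even i hi.le).1 he)
      rw [pviewIdx_of_P h1 hm, pviewIdx_of_P h2 hm, before i le_rfl he hr]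
      simp

theorem pviewIdx_of_odd (h : IsCore A s r n x e) (hs : Legal A s) {i : ℕ} (hi : i < x.length)
    (ho : ¬ Even i) (hr : root x i ≠ r) : pviewIdx A s (e i) = (pviewIdx A x i).map e := by
  cases i with
  | zero => simp at ho
  | succ k =>
    have hk' : Even k := by rwa [Nat.even_add_one, not_not] at ho
    rw [h.map_succ k hi (Or.inr hr), h.pviewIdx_map hs (by omega)]
    rwa [← h.root_succ hs (by omega) hk']

theorem pv_map (h : IsCore A s r n x e) (hs : Legal A s) {i : ℕ} (hi : i < x.length)
    (hr : root x i ≠ r) : pv A s (e i + 1) = pv A x (i + 1) := by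
  rw [pv, h.pviewIdx_map hs hi hr, pv]
  exact h.select_map_eq fun k hk => by have := lt_of_mem_pviewIdx hk; omega

theorem pviewIdx_last (h : IsCore A s r n x e) (hs : Legal A s) (hr : root s (n - 1) ≠ r) :
    pviewIdx A s n = (pviewIdx A x x.length).map e := by
  have h0 := h.lt_length
  have h1 : n - 1 = e (x.length - 1) := by
    have := h.map_last; have := h.map_length; omega
  rw [h1] at hr
  have := h.pviewIdx_map hs (i := x.length - 1) (by omega)
    (mt (h.root_eq_iff (by omega)).2 hr)
  rwa [← h.map_last, h.map_length, Nat.sub_add_cancel (by omega)] at this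

theorem pv_last (h : IsCore A s r n x e) (hs : Legal A s) (hr : root s (n - 1) ≠ r) :
    pv A s n = pv A x x.length := by
  rw [pv, h.pviewIdx_last hs hr, pv]
  exact h.select_map_eq fun k hk => lt_of_mem_pviewIdx hk

/-- The thread of the core is the O-view of the thread. -/
theorem ov_thread (h : IsCore A s r n x e) (hs : Legal A s) :
    ov A (thread s r) (threadCount s r n) = thread x r := by
  rw [ov, h.oviewIdx_thread]
  change JSeq.select (List.map _ (threadIdx x r)) _ = JSeq.select (threadIdx x r) x
  refine select_map (c := fun i => threadCount s r (e i))
    (S := {i | i < x.length ∧ root x i = r}) ?_ ?_ ?_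
  · rintro a ⟨ha, ha'⟩ b ⟨hb, hb'⟩ hab
    exact h.injOn ha.le hb.le
      (threadCount_inj ((h.root_eq_iff ha).2 ha') ((h.root_eq_iff hb).2 hb') hab)
  · intro i hi
    exact mem_threadIdx.1 hi
  · intro i hi
    obtain ⟨hi1, hi2⟩ := mem_threadIdx.1 hi
    obtain ⟨m, p, h1, h2⟩ := h.exists_getElem? hi1
    refine ⟨m, p, h1, ?_, ?_⟩
    · rintro j rfl
      have hj := h.ptrLt _ _ _ h1
      exact ⟨hj.trans hi1, (root_of_some h1 hj).symm.trans hi2⟩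
    · rw [getElem?_thread hs.ptrLt h2 ((h.root_eq_iff hi1).2 hi2), Option.map_map]
      rfl

/-- Extending the sequence does not change the cores of its prefixes. -/
theorem append (h : IsCore A s r n x e) {l : JSeq M} (hw : PtrLt (s ++ l)) :
    IsCore A (s ++ l) r n x e := by
  have hn := h.le_length
  refine { h with getElem? := ?_, oviewIdx_thread := ?_ }
  · intro i m p hi
    have := h.getElem? i m p hi
    rwa [getElem?_append_lt (lt_length_of_getElem? this)]
  · obtain ⟨l', hl'⟩ := thread_prefix (r := r) hw
    rw [← hl', threadCount_append hn, oviewIdx_append, h.oviewIdx_thread]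
    · refine List.map_congr_left fun i hi => ?_
      have hi' := mem_threadIdx.1 hi
      obtain ⟨m, p, -, h2⟩ := h.exists_getElem? hi'.1
      rw [threadCount_append (lt_length_of_getElem? h2).le]
    · rw [length_thread]; exact threadCount_mono hn

/-- The core after one more move. The core to be extended is that before the move, or, for a
Player's move of the thread, that up to its justifier. -/
theorem snoc {n₀ : ℕ} (h : IsCore A s r n₀ x e) (hn₀ : n₀ ≤ n) {m : M} {p : Option ℕ}
    (hp : ∀ j, p = some j → j < x.length) (hm : s[n]? = some (m, p.map e))
    (hev : Even n ↔ Even x.length)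
    (hpred : (n₀ = n ∧ (Even n ∨ root s n ≠ r)) ∨
      (¬ Even n ∧ root s n = r ∧ p = some (x.length - 1)))
    (hview : oviewIdx A (thread s r) (threadCount s r (n + 1)) =
      oviewIdx A (thread s r) (threadCount s r n₀) ++
        if root s n = r then [threadCount s r n] else []) :
    IsCore A s r (n + 1) (x ++ [(m, p)])
      (fun i => if i < x.length then e i else n + (i - x.length)) := by
  have h0 := h.lt_length
  have hlen : (x ++ [(m, p)]).length = x.length + 1 := by simp
  have hlast : (x ++ [(m, p)])[x.length]? = some (m, p) := by simp
  have hw : PtrLt (x ++ [(m, p)]) := by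
    intro i m' j hi
    rcases Nat.lt_or_ge i x.length with hi' | hi'
    · rw [getElem?_append_lt hi'] at hi; exact h.ptrLt _ _ _ hi
    · have := lt_length_of_getElem? hi
      obtain rfl : i = x.length := by omega
      rw [hlast] at hi; cases hi; exact hp j rfl
  have hmap : ∀ i, i < x.length → ∀ (m : M) (q : Option ℕ), x[i]? = some (m, q) →
      q.map (fun i => if i < x.length then e i else n + (i - x.length)) = q.map e := by
    rintro i hi m (_ | j) h1
    · rfl
    · have := h.ptrLt _ _ _ h1
      simp [this.trans hi]
  have hmap' : p.map (fun i => if i < x.length then e i else n + (i - x.length)) = p.map e := by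
    rcases p with _ | j
    · rfl
    · simp [hp j rfl]
  have hroot : root (x ++ [(m, p)]) x.length = r ↔ root s n = r := by
    cases p with
    | none =>
      rw [root_of_none hlast, root_of_none hm]
      have := h.map_length
      have : n₀ = n := by
        rcases hpred with h1 | h1
        · exact h1.1
        · simp at h1
      have h3 : e r = r := h.map_init r le_rfl
      have := h.mono r x.length h0 le_rfl
      omega
    | some j =>
      have hj := hp j rfl
      have hj' := h.mono j x.length hj le_rfl
      rw [h.map_length] at hj'
      rw [root_of_some hlast hj, root_append hj, root_of_some hm (by simpa using hj'.trans_le hn₀)]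
      exact (h.root_eq_iff hj).symm
  constructor
  · omega
  · simp
  · intro i j hij hj
    rw [hlen] at hj
    by_cases hj' : j < x.length
    · rw [if_pos hj', if_pos (hij.trans hj')]; exact h.mono i j hij hj'.le
    · rw [if_neg hj']
      by_cases hi : i < x.length
      · rw [if_pos hi]
        have := h.mono i x.length hi le_rfl
        rw [h.map_length] at this
        omega
      · rw [if_neg hi]; omega
  · intro i hi
    rw [if_pos (by omega)]; exact h.map_init i hi
  · intro i m' q hi
    rcases Nat.lt_or_ge i x.length with hi' | hi'
    · rw [getElem?_append_lt hi'] at hi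
      rw [if_pos hi', hmap i hi' m' q hi]
      exact h.getElem? i m' q hi
    · have := lt_length_of_getElem? hi
      obtain rfl : i = x.length := by omega
      rw [hlast] at hi; cases hi
      rw [hmap']
      simpa using hm
  · exact hw
  · intro i hi
    rw [hlen] at hi
    by_cases hi' : i < x.length
    · rw [if_pos hi']; exact h.even i hi'.le
    · rw [if_neg hi']
      rcases eq_or_lt_of_le (Nat.le_of_not_lt hi') with rfl | h1
      · simpa using hev
      · obtain rfl : i = x.length + 1 := by omega
        rw [show n + (x.length + 1 - x.length) = n + 1 by omega, Nat.even_add_one,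
          Nat.even_add_one, hev]
  · intro i hi hor
    rw [hlen] at hi
    rcases Nat.lt_or_ge (i + 1) x.length with hi' | hi'
    · rw [if_pos hi', if_pos (by omega)]
      refine h.map_succ i hi' ?_
      rwa [root_append hi'] at hor
    · have hi2 : i + 1 = x.length := by omega
      rw [if_neg (by omega), if_pos (by omega)]
      rcases hpred with ⟨h1, h2⟩ | ⟨h1, h2, h3⟩
      · have := h.map_last
        rw [h.map_length, ← hi2, Nat.add_sub_cancel] at this
        omega
      · rw [hi2, ← hev] at hor
        exact (hor.elim h1 fun hc => hc (hroot.2 h2)).elim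
  · simp
  · intro i m' q hi hio hir
    rcases Nat.lt_or_ge i x.length with hi' | hi'
    · rw [getElem?_append_lt hi'] at hi
      rw [root_append hi'] at hir
      exact h.ptr_eq i m' q hi hio hir
    · have := lt_length_of_getElem? hi
      obtain rfl : i = x.length := by omega
      rw [hlast] at hi; cases hi
      rcases hpred with ⟨-, h2⟩ | ⟨h1, h2, h3⟩
      · rw [hroot] at hir
        rw [← hev] at hio
        exact (h2.elim hio fun hc => hc hir).elim
      · exact h3
  · rw [hview, h.oviewIdx_thread]
    change _ = List.map _ (threadIdx (x ++ [(m, p)]) r)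
    rw [threadIdx_append_singleton, List.map_append]
    congr 1
    · refine List.map_congr_left fun i hi => ?_
      rw [if_pos (mem_threadIdx.1 hi).1]
    · simp only [hroot]
      split <;> simp

end IsCore

/-- Core of the prefix that ends with the first move of the thread. -/
theorem Legal.isCore_init (hs : Legal A s) {m : M} (hr : s[r]? = some (m, none)) :
    IsCore A s r (r + 1) (s.take (r + 1)) id := by
  have hlt := lt_length_of_getElem? hr
  have hlen : (s.take (r + 1)).length = r + 1 := by
    rw [List.length_take]; omega
  have hroot : ∀ i < r + 1, root (s.take (r + 1)) i = root s i := fun i hi =>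
    root_congr fun k hk => getElem?_take_lt (by omega)
  have hrr := root_of_none hr
  have hne : ∀ i < r, root s i ≠ r := fun i hi => by have := root_le (s := s) i; omega
  have hcount : threadCount s r r = 0 := Nat.count_of_forall_not fun i hi => hne i hi
  have hO : A.role m = .O := A.init_role m ((hs.init_iff hr).2 rfl)
  have hre : Even r := (hs.role_iff hr).1 hO
  constructor
  · omega
  · simpa using hlen
  · intro i j h _; exact h
  · intro i _; rfl
  · intro i m p h
    rw [getElem?_take_lt (by have := lt_length_of_getElem? h; omega)] at h
    rw [Option.map_id]; exact h
  · exact (hs.take _).ptrLt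
  · intro i _; rfl
  · intro i _ _; rfl
  · simp [hlen]
  · intro i m p h ho hi
    have hi' := lt_length_of_getElem? h
    rw [hroot i (by omega)] at hi
    obtain rfl : i = r := by
      by_contra hc
      exact hne i (by omega) hi
    exact absurd hre ho
  · have h1 := getElem?_thread hs.ptrLt hr hrr
    rw [hcount] at h1
    rw [threadCount_succ_of_eq hrr, hcount, oviewIdx_of_O h1 hO, hlen, List.range_succ,
      List.filter_append, List.filter_eq_nil_iff.2 fun i hi => by
        rw [hroot i (by have := List.mem_range.1 hi; omega)]
        simpa using hne i (List.mem_range.1 hi)]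
    simp [oviewIdx, hroot, hrr, hcount]

/-- By visibility, the next move points into the core, unless it is a Player's move of the
thread. -/
theorem Legal.exists_ptr_core (hs : Legal A s) (h : IsCore A s r n x e) {m : M} {p : Option ℕ}
    (hm : s[n]? = some (m, p)) (ht : Even n ∨ root s n ≠ r) :
    ∃ p' : Option ℕ, p = p'.map e ∧ (∀ j, p' = some j → j < x.length) ∧
      (Even n → ∀ j, p' = some j → j ∈ oviewIdx A x x.length) ∧
      (¬ Even n → ∀ j, p' = some j → j ∈ pviewIdx A x x.length) := by
  have hn := lt_length_of_getElem? hm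
  by_cases he : Even n
  · cases p with
    | none => exact ⟨none, rfl, by simp, by simp, by simp⟩
    | some j =>
      have := hs.visible_O _ _ _ hm (hs.role_O hm he)
      rw [h.oviewIdx_last hs, List.mem_map] at this
      obtain ⟨k, hk, rfl⟩ := this
      exact ⟨some k, rfl, by rintro _ ⟨⟩; exact lt_of_mem_oviewIdx hk, by rintro _ _ ⟨⟩; exact hk,
        fun h => absurd he h⟩
  · obtain ⟨j, rfl, -, -⟩ := hs.exists_ptr_of_P hm he
    have hr : root s n ≠ r := by simpa [he] using ht
    obtain ⟨k, rfl⟩ := Nat.exists_eq_succ_of_ne_zero (n := n) (by rintro rfl; simp at he)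
    have hk : Even k := by rwa [Nat.even_add_one, not_not] at he
    have := hs.visible_P _ _ _ hm (hs.role_P hm he)
    rw [h.pviewIdx_last hs (by rwa [Nat.succ_sub_one, ← hs.root_succ hn hk]), List.mem_map] at this
    obtain ⟨k, hk, rfl⟩ := this
    exact ⟨some k, rfl, by rintro _ ⟨⟩; exact lt_of_mem_pviewIdx hk, fun h => absurd h he,
      by rintro _ _ ⟨⟩; exact hk⟩

theorem Legal.oviewIdx_thread_succ (hs : Legal A s) (hn : n < s.length)
    (ht : Even n ∨ root s n ≠ r) :
    oviewIdx A (thread s r) (threadCount s r (n + 1)) =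
      oviewIdx A (thread s r) (threadCount s r n) ++
        if root s n = r then [threadCount s r n] else [] := by
  by_cases hr : root s n = r
  · obtain ⟨m, p, h⟩ := exists_getElem? hn
    have he : Even n := by simpa [hr] using ht
    rw [threadCount_succ_of_eq hr, oviewIdx_of_O (getElem?_thread hs.ptrLt h hr)
      (hs.role_O h he), if_pos hr]
  · rw [threadCount_succ_of_ne hr, if_neg hr, List.append_nil]

/-- The core grows by a move that is not a Player's move of the thread. -/
theorem IsCore.step (h : IsCore A s r n x e) (hs : Legal A s) {m : M} {p : Option ℕ}
    (hp : ∀ j, p = some j → j < x.length) (hm : s[n]? = some (m, p.map e))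
    (ht : Even n ∨ root s n ≠ r) :
    IsCore A s r (n + 1) (x ++ [(m, p)])
      (fun i => if i < x.length then e i else n + (i - x.length)) := by
  refine h.snoc le_rfl hp hm ?_ (Or.inl ⟨rfl, ht⟩)
    (hs.oviewIdx_thread_succ (lt_length_of_getElem? hm) ht)
  have := h.even x.length le_rfl
  rwa [h.map_length] at this

theorem Legal.exists_isCore (hs : Legal A s) {m₀ : M} (hr : s[r]? = some (m₀, none)) (hn : r < n)
    (hns : n ≤ s.length) : ∃ x e, IsCore A s r n x e := by
  induction n using Nat.strong_induction_on with
  | _ n ih =>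
    cases n with
    | zero => omega
    | succ n =>
      rcases eq_or_lt_of_le (Nat.lt_succ_iff.1 hn) with rfl | hn'
      · exact ⟨_, _, hs.isCore_init hr⟩
      · obtain ⟨m, p, hm⟩ := exists_getElem? (s := s) (i := n) (by omega)
        by_cases ht : Even n ∨ root s n ≠ r
        · obtain ⟨x, e, h⟩ := ih n (by omega) hn' (by omega)
          obtain ⟨p', rfl, hp', -, -⟩ := hs.exists_ptr_core h hm ht
          exact ⟨_, _, h.step hs hp' hm ht⟩
        · push Not at ht
          obtain ⟨ho, hrn⟩ := ht
          -- For a Player's move of the thread, the core goes on at its justifier.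
          obtain ⟨j, rfl, h1, h2⟩ := hs.exists_ptr_of_P hm ho
          have hjr : root s j = r := by rw [← root_of_some hm h1, hrn]
          have hrj : r ≤ j := hjr ▸ root_le j
          obtain ⟨x, e, h⟩ := ih (j + 1) (by omega) (by omega) (by omega)
          have h0 := h.lt_length
          have hej : e (x.length - 1) = j := by
            have := h.map_last; have := h.map_length; omega
          have hxe : ¬ Even x.length := by
            rw [← h.even _ le_rfl, h.map_length, Nat.even_add_one, not_not]; exact h2
          obtain ⟨mj, pj, hj⟩ := exists_getElem? (s := s) (i := j) (by omega)
          refine ⟨x ++ [(m, some (x.length - 1))], _, h.snoc (n := n) (by omega) ?_ ?_ ?_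
            (Or.inr ⟨ho, hrn, rfl⟩) ?_⟩
          · rintro _ ⟨⟩; omega
          · rw [Option.map_some, hej]; exact hm
          · simp [ho, hxe]
          · have hmt := getElem?_thread hs.ptrLt hm hrn
            rw [if_pos hrn, threadCount_succ_of_eq hrn, threadCount_succ_of_eq hjr,
              oviewIdx_of_P hmt (hs.role_P hm ho) (threadCount_lt hjr h1),
              oviewIdx_of_O (getElem?_thread hs.ptrLt hj hjr) (hs.role_O hj h2)]
            simp

/-- A thread of a play is a play. -/
theorem Legal.thread (hs : Legal A s) {m₀ : M} (hr : s[r]? = some (m₀, none)) :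
    Legal A (thread s r) := by
  have key : ∀ k m p, (InnocentGames.thread s r)[k]? = some (m, p) → ∃ i p', s[i]? = some (m, p') ∧
      root s i = r ∧ threadCount s r i = k ∧ p = p'.map (threadCount s r) := by
    intro k m p hk
    obtain ⟨i, hi, hir, rfl⟩ := exists_of_lt_length_thread (lt_length_of_getElem? hk)
    obtain ⟨m', p', h⟩ := exists_getElem? hi
    rw [getElem?_thread hs.ptrLt h hir] at hk
    cases hk
    exact ⟨i, p', h, hir, rfl, rfl⟩
  have root_ptr : ∀ {i m j}, s[i]? = some (m, some j) → root s i = r → root s j = r :=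
    fun h hi => (root_of_some h (hs.ptrLt _ _ _ h)).symm.trans hi
  constructor
  · intro k m p hk
    obtain ⟨i, p', h, hir, rfl, rfl⟩ := key k m p hk
    rcases hs.justified i m p' h with ⟨h1, rfl⟩ | ⟨j, m', q, rfl, h2, h3, h4⟩
    · exact Or.inl ⟨h1, rfl⟩
    · have hjr := root_ptr h hir
      exact Or.inr ⟨_, m', _, rfl, threadCount_lt hjr h2, getElem?_thread hs.ptrLt h3 hjr, h4⟩
  · rintro k ⟨m, p⟩ ⟨m', p'⟩ hk hk'
    obtain ⟨i, q, h, hir, rfl, rfl⟩ := key k m p hk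
    obtain ⟨i', q', h', hir', hc, rfl⟩ := key _ m' p' hk'
    have e1 := hs.even_threadCount_iff (lt_length_of_getElem? h) hir
    have e2 := hs.even_threadCount_iff (lt_length_of_getElem? h') hir'
    rw [hc, Nat.even_add_one, e1, ← hs.role_iff h, ← hs.role_iff h'] at e2
    intro heq
    simp only at heq
    rw [heq] at e2
    simp at e2
  · intro k m j hk hm
    obtain ⟨i, p', h, hir, rfl, hp⟩ := key k m _ hk
    obtain ⟨j, rfl, rfl⟩ := Option.map_eq_some_iff.1 hp.symm
    have hio : ¬ Even i := fun he => by rw [hs.role_O h he] at hm; cases hm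
    obtain ⟨l, rfl⟩ := Nat.exists_eq_succ_of_ne_zero (n := i) (by rintro rfl; simp at hio)
    have hl : Even l := by rwa [Nat.even_add_one, not_not] at hio
    have hlt := lt_length_of_getElem? h
    have hlr : root s l = r := (hs.root_succ hlt hl).symm.trans hir
    rw [Nat.succ_eq_add_one, threadCount_succ_of_eq hlr, hs.pviewIdx_thread (by omega) hlr]
    exact List.mem_map_of_mem (hs.visible_P _ _ _ h hm)
  · intro k m j hk hm
    obtain ⟨i, p', h, hir, rfl, hp⟩ := key k m _ hk
    obtain ⟨j, rfl, rfl⟩ := Option.map_eq_some_iff.1 hp.symm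
    have hjr := root_ptr h hir
    have hji := hs.ptrLt _ _ _ h
    have hrj : r ≤ j := hjr ▸ root_le j
    obtain ⟨x, e, hx⟩ := hs.exists_isCore hr (n := i) (by omega) (lt_length_of_getElem? h).le
    have := hs.visible_O _ _ _ h hm
    rw [hx.oviewIdx_last hs, List.mem_map] at this
    obtain ⟨l, hl, rfl⟩ := this
    have hkx := lt_of_mem_oviewIdx hl
    -- The core meets the thread in the O-view of the thread.
    rw [hx.oviewIdx_thread]
    exact List.mem_map.2 ⟨l, mem_threadIdx.2 ⟨hkx, (hx.root_eq_iff hkx).1 hjr⟩, rfl⟩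
  · intro k m j hk hm
    obtain ⟨i, p', h, hir, rfl, hp⟩ := key k m _ hk
    obtain ⟨j, rfl, rfl⟩ := Option.map_eq_some_iff.1 hp.symm
    exact hs.pending_thread (lt_length_of_getElem? h).le (hs.bracketed _ _ _ h hm)
      (root_ptr h hir)

end Core

/-! ### Interactions relative to a thread -/

section Runs

variable {M : Type*} {A : Arena M} {s t x y w : JSeq M} {r n : ℕ} {e e' : ℕ → ℕ}
  {V Φ₁ Φ₂ : Set (JSeq M)}

/-- A position in which Opponent follows the O-views in `V`, and Player, outside the thread that
begins at `r`, follows `Φ₁` in the earlier threads and `Φ₂` in the later ones. -/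
structure IsRun (A : Arena M) (V Φ₁ Φ₂ : Set (JSeq M)) (r : ℕ) (s : JSeq M) : Prop where
  legal : Legal A s
  oOk : OOk A V s
  pOk : ∀ i < s.length, ¬ Even i → root s i ≠ r → pv A s (i + 1) ∈ if root s i < r then Φ₁ else Φ₂

theorem IsRun.append_left {l : JSeq M} (h : IsRun A V Φ₁ Φ₂ r (s ++ l)) :
    IsRun A V Φ₁ Φ₂ r s where
  legal := h.legal.append_left
  oOk i hi he := by
    have := h.oOk i (by simp; omega) he
    rwa [ov_append hi] at this
  pOk i hi ho hr := by
    have := h.pOk i (by simp; omega) ho (by rwa [root_append hi])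
    rwa [pv_append hi, root_append hi] at this

theorem IsRun.snoc {z : M × Option ℕ} (h : IsRun A V Φ₁ Φ₂ r w) (hL : Legal A (w ++ [z]))
    (hO : Even w.length → ov A (w ++ [z]) (w.length + 1) ∈ V)
    (hP : ¬ Even w.length → root (w ++ [z]) w.length ≠ r →
      pv A (w ++ [z]) (w.length + 1) ∈ if root (w ++ [z]) w.length < r then Φ₁ else Φ₂) :
    IsRun A V Φ₁ Φ₂ r (w ++ [z]) where
  legal := hL
  oOk i hi he := by
    rcases Nat.lt_or_ge i w.length with hi' | hi'
    · rw [ov_append hi']; exact h.oOk i hi' he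
    · obtain rfl : i = w.length := by simp at hi; omega
      exact hO he
  pOk i hi ho hr := by
    rcases Nat.lt_or_ge i w.length with hi' | hi'
    · rw [pv_append hi', root_append hi']
      exact h.pOk i hi' ho (by rwa [root_append hi'] at hr)
    · obtain rfl : i = w.length := by simp at hi; omega
      exact hP ho hr

/-- What remains true of a run when it is replaced by its core. In the thread itself, Player's moves
point to their predecessors. -/
structure IsCoreRun (A : Arena M) (V Φ₁ Φ₂ : Set (JSeq M)) (r : ℕ) (x : JSeq M) : Prop where
  ptrLt : PtrLt x
  role_iff : ∀ (i : ℕ) (m : M) (p : Option ℕ), x[i]? = some (m, p) → (A.role m = .O ↔ Even i)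
  visible_O : ∀ (i : ℕ) (m : M) (j : ℕ), x[i]? = some (m, some j) → Even i → j ∈ oviewIdx A x i
  visible_P : ∀ (i : ℕ) (m : M) (j : ℕ), x[i]? = some (m, some j) → ¬ Even i → root x i ≠ r →
    j ∈ pviewIdx A x i
  root_succ : ∀ i, i + 1 < x.length → Even i → root x (i + 1) = root x i
  ov_mem : ∀ i < x.length, Even i → ov A x (i + 1) ∈ V
  pv_mem : ∀ i < x.length, ¬ Even i → root x i ≠ r →
    pv A x (i + 1) ∈ if root x i < r then Φ₁ else Φ₂
  ptr_eq : ∀ (i : ℕ) (m : M) (p : Option ℕ), x[i]? = some (m, p) → ¬ Even i → root x i = r →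
    p = some (i - 1)

theorem IsCore.isCoreRun (h : IsCore A s r n x e) (hs : IsRun A V Φ₁ Φ₂ r s) :
    IsCoreRun A V Φ₁ Φ₂ r x := by
  have hL := hs.legal
  have inj : ∀ {l : List ℕ} {i j : ℕ}, (∀ k ∈ l, k ≤ x.length) → j ≤ x.length →
      e j ∈ l.map e → j ∈ l := by
    intro l i j hl hj hm
    obtain ⟨k, hk, hkj⟩ := List.mem_map.1 hm
    rwa [← h.injOn (hl k hk) hj hkj]
  have lt : ∀ {i : ℕ}, i < x.length → e i < s.length := by
    intro i hi
    obtain ⟨m, p, -, h2⟩ := h.exists_getElem? hi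
    exact lt_length_of_getElem? h2
  constructor
  · exact h.ptrLt
  · exact fun i m p => h.role_iff hL
  · intro i m j hi he
    have hlt := lt_length_of_getElem? hi
    have hj := h.ptrLt _ _ _ hi
    have h2 := h.getElem? _ _ _ hi
    have := hL.visible_O _ _ _ h2 (hL.role_O h2 ((h.even i hlt.le).2 he))
    rw [h.oviewIdx_of_even hL hlt he] at this
    exact inj (i := i) (fun k hk => by have := lt_of_mem_oviewIdx hk; omega) (by omega) this
  · intro i m j hi ho hr
    have hlt := lt_length_of_getElem? hi
    have hj := h.ptrLt _ _ _ hi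
    have h2 := h.getElem? _ _ _ hi
    have := hL.visible_P _ _ _ h2 (hL.role_P h2 (mt (h.even i hlt.le).1 ho))
    rw [h.pviewIdx_of_odd hL hlt ho hr] at this
    exact inj (i := i) (fun k hk => by have := lt_of_mem_pviewIdx hk; omega) (by omega) this
  · exact fun i hi he => h.root_succ hL hi he
  · intro i hi he
    rw [← h.ov_map hL hi]
    exact hs.oOk _ (lt hi) ((h.even i hi.le).2 he)
  · intro i hi ho hr
    rw [← h.pv_map hL hi hr]
    have := hs.pOk _ (lt hi) (mt (h.even i hi.le).1 ho) (mt (h.root_eq_iff hi).1 hr)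
    simpa only [h.root_lt_iff hi] using this
  · exact h.ptr_eq

/-- Cores are determined by Player's moves in the thread. -/
theorem IsCoreRun.getElem?_eq (hV : ViewDet V) (h₁ : ViewDet Φ₁) (h₂ : ViewDet Φ₂)
    (hx : IsCoreRun A V Φ₁ Φ₂ r x) (hy : IsCoreRun A V Φ₁ Φ₂ r y)
    (hxy : ∀ k, ¬ Even k → k < (thread x r).length → k < (thread y r).length →
      (thread x r)[k]? = (thread y r)[k]?) (n : ℕ) (hnx : n < x.length) (hny : n < y.length) :
    x[n]? = y[n]? := by
  induction n using Nat.strong_induction_on with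
  | _ n ih =>
    have hst : ∀ i < n, x[i]? = y[i]? := fun i hi => ih i hi (by omega) (by omega)
    obtain ⟨m, p, h⟩ := exists_getElem? hnx
    obtain ⟨m', p', h'⟩ := exists_getElem? hny
    rw [h, h']
    by_cases he : Even n
    · have hm := (hx.role_iff _ _ _ h).2 he
      have hm' := (hy.role_iff _ _ _ h').2 he
      rw [eq_of_ov_mem hV hx.ptrLt hy.ptrLt hst h h' hm hm'
        (by rintro j rfl; exact hx.visible_O _ _ _ h he)
        (by rintro j rfl; exact hy.visible_O _ _ _ h' he) (hx.ov_mem n hnx he)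
        (hy.ov_mem n hny he)]
    · have role_P : ∀ {m : M}, (A.role m = .O ↔ Even n) → A.role m = .P := by
        intro m hm
        have := mt hm.1 he
        cases h : A.role m <;> simp_all
      have hroot : root x n = root y n := by
        obtain ⟨k, rfl⟩ := Nat.exists_eq_succ_of_ne_zero (n := n) (by rintro rfl; simp at he)
        have hk : Even k := by rwa [Nat.even_add_one, not_not] at he
        rw [Nat.succ_eq_add_one, hx.root_succ k hnx hk, hy.root_succ k hny hk]
        exact root_congr fun i hi => hst i (by omega)
      by_cases hr : root x n = r
      · have hr' := hroot ▸ hr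
        have e1 := getElem?_thread hx.ptrLt h hr
        have e2 := getElem?_thread hy.ptrLt h' hr'
        have ec : threadCount x r n = threadCount y r n := threadCount_congr hst
        have := hxy _ (mt (even_threadCount_iff hx.root_succ hnx hr).1 he)
          (lt_length_of_getElem? e1) (ec ▸ lt_length_of_getElem? e2)
        rw [e1, ec, e2] at this
        rw [(Prod.mk.inj (Option.some.inj this)).1, hx.ptr_eq _ _ _ h he hr,
          hy.ptr_eq _ _ _ h' he hr']
      · have hr' : root y n ≠ r := hroot ▸ hr
        have hpx := hx.pv_mem n hnx he hr
        have hpy := hy.pv_mem n hny he hr'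
        rw [← hroot] at hpy
        have hdet : ViewDet (if root x n < r then Φ₁ else Φ₂) := by
          split
          · exact h₁
          · exact h₂
        rw [eq_of_pv_mem hdet hx.ptrLt hy.ptrLt hst h h' (role_P (hx.role_iff _ _ _ h))
          (role_P (hy.role_iff _ _ _ h'))
          (by rintro j rfl; exact hx.visible_P _ _ _ h he hr)
          (by rintro j rfl; exact hy.visible_P _ _ _ h' he hr') hpx hpy]

/-- Two cores that end in the thread are equal if their threads have the same length and the same
moves of Player. -/
theorem IsCoreRun.eq (hV : ViewDet V) (h₁ : ViewDet Φ₁) (h₂ : ViewDet Φ₂)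
    (hx : IsCoreRun A V Φ₁ Φ₂ r x) (hy : IsCoreRun A V Φ₁ Φ₂ r y)
    (hlx : root x (x.length - 1) = r) (hly : root y (y.length - 1) = r)
    (hlen : (thread x r).length = (thread y r).length)
    (hxy : ∀ k : ℕ, ¬ Even k → (thread x r)[k]? = (thread y r)[k]?) : x = y := by
  have key := hx.getElem?_eq hV h₁ h₂ hy fun k hk _ _ => hxy k hk
  rw [length_thread, length_thread] at hlen
  have aux : ∀ {x y : JSeq M}, root y (y.length - 1) = r → x.length < y.length →
      (∀ i < x.length, x[i]? = y[i]?) →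
      threadCount x r x.length ≠ threadCount y r y.length := by
    intro x y hy hlt hxy hc
    rw [threadCount_congr hxy] at hc
    have h1 := threadCount_mono (s := y) (r := r) (i := x.length) (j := y.length - 1) (by omega)
    have h2 := threadCount_lt hy (j := y.length) (by omega)
    omega
  have hlen' : x.length = y.length := by
    rcases lt_trichotomy x.length y.length with h | h | h
    · exact absurd hlen (aux hly h fun i hi => key i hi (by omega))
    · exact h
    · exact absurd hlen.symm (aux hlx h fun i hi => (key i (by omega) hi).symm)
  refine List.ext_getElem? fun n => ?_
  rcases Nat.lt_or_ge n x.length with hn | hn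
  · exact key n hn (by omega)
  · rw [List.getElem?_eq_none hn, List.getElem?_eq_none (by omega)]

theorem IsCore.root_last (h : IsCore A s r (n + 1) x e) (hn : root s n = r) :
    root x (x.length - 1) = r := by
  have h0 := h.lt_length
  have h1 := h.map_last
  rw [h.map_length] at h1
  rw [← h.root_eq_iff (by omega), ← Nat.succ.inj h1, hn]

/-- In a run, Opponent's moves in the thread depend only on the O-view of the thread. -/
theorem IsRun.viewDet_thread (hV : ViewDet V) (h₁ : ViewDet Φ₁) (h₂ : ViewDet Φ₂)
    (hs : IsRun A V Φ₁ Φ₂ r s) {m₀ : M} (hr : s[r]? = some (m₀, none)) :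
    ViewDet (oViews A (thread s r)) := by
  have ht := hs.legal.thread hr
  have key : ∀ v z, v ++ [z] ∈ oViews A (thread s r) → Even v.length ∧
      ∃ x, IsCoreRun A V Φ₁ Φ₂ r x ∧ thread x r = v ++ [z] ∧ root x (x.length - 1) = r := by
    rintro v z ⟨k, hk, hke, hv⟩
    obtain ⟨z', hz'⟩ := ht.exists_ov_succ hk hke
    obtain ⟨rfl, -⟩ := List.append_inj' (hv.trans hz') rfl
    refine ⟨(ht.even_length_ov hk.le).2 hke, ?_⟩
    obtain ⟨i, hi, hir, rfl⟩ := exists_of_lt_length_thread hk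
    have hri : r ≤ i := hir ▸ root_le i
    obtain ⟨x, e, hx⟩ := hs.legal.exists_isCore hr (n := i + 1) (by omega) hi
    refine ⟨x, hx.isCoreRun hs, ?_, hx.root_last hir⟩
    rw [← hx.ov_thread hs.legal, threadCount_succ_of_eq hir, hv]
  intro v z z' hz hz'
  obtain ⟨hev, x, hx, hxt, hxl⟩ := key v z hz
  obtain ⟨-, y, hy, hyt, hyl⟩ := key v z' hz'
  have : x = y := by
    refine hx.eq hV h₁ h₂ hy hxl hyl (by simp [hxt, hyt]) fun k hk => ?_
    rw [hxt, hyt]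
    rcases lt_trichotomy k v.length with h | rfl | h
    · rw [getElem?_append_lt h, getElem?_append_lt h]
    · exact absurd hev hk
    · rw [List.getElem?_eq_none (by simp; omega), List.getElem?_eq_none (by simp; omega)]
  rw [this, hyt] at hxt
  simpa using hxt.symm

/-- Two runs with the same core go on in the same way, up to Player's next move in the thread. -/
theorem IsCore.exists_step (hs : IsRun A V Φ₁ Φ₂ r s) (hw : IsRun A V Φ₁ Φ₂ r w)
    (h : IsCore A s r n x e) (h' : IsCore A w r w.length x e') (hn : n < s.length)
    (ht : Even n ∨ root s n ≠ r) :
    ∃ z x' e₁ e₂, IsRun A V Φ₁ Φ₂ r (w ++ [z]) ∧ IsCore A s r (n + 1) x' e₁ ∧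
      IsCore A (w ++ [z]) r (w.length + 1) x' e₂ ∧
      (root (w ++ [z]) w.length = r ↔ root s n = r) := by
  have hL := hs.legal
  have hLw := hw.legal
  have h0 := h.lt_length
  obtain ⟨m, p, hm⟩ := InnocentGames.exists_getElem? hn
  obtain ⟨p', rfl, hp', hpO, hpP⟩ := hL.exists_ptr_core h hm ht
  have hev : Even n ↔ Even w.length := by
    have e1 := h.even x.length le_rfl
    have e2 := h'.even x.length le_rfl
    rw [h.map_length] at e1
    rw [h'.map_length] at e2
    rw [e1, e2]
  -- The pointers of the two continuations correspond in the core.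
  have hidx : ∀ (l : List ℕ) (k j : ℕ), (∀ i ∈ l, i < x.length) → k ∈ l → j ∈ l.map e' →
      (l.map e').idxOf? j = (l.map e).idxOf? (e k) → j = e' k := by
    intro l k j hl hk hj hi
    refine idxOf?_inj hj (hi.trans ?_)
    rw [idxOf?_map_of_injOn h.injOn (fun i hi => (hl i hi).le) (hl k hk).le,
      idxOf?_map_of_injOn h'.injOn (fun i hi => (hl i hi).le) (hl k hk).le]
  have hwr : r < w.length := by
    have := h'.mono r x.length h0 le_rfl
    rwa [h'.map_init r le_rfl, h'.map_length] at this
  have hsr : r < n := by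
    have := h.mono r x.length h0 le_rfl
    rwa [h.map_init r le_rfl, h.map_length] at this
  have hlt : ∀ j, p' = some j → e' j < w.length := by
    intro j hj
    have := h'.mono j x.length (hp' j hj) le_rfl
    rwa [h'.map_length] at this
  have hroot : (root (w ++ [(m, p'.map e')]) w.length = r ↔ root s n = r) ∧
      ((∃ j, p' = some j) → (root (w ++ [(m, p'.map e')]) w.length < r ↔ root s n < r)) := by
    have hlast : (w ++ [(m, p'.map e')])[w.length]? = some (m, p'.map e') := by simp
    cases p' with
    | none =>
      rw [root_of_none hlast, root_of_none hm]
      refine ⟨by omega, ?_⟩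
      rintro ⟨j, hj⟩; cases hj
    | some k =>
      have hk := hlt k rfl
      rw [root_of_some hlast hk, root_append hk, root_of_some hm (hL.ptrLt _ _ _ hm),
        h.root_eq_iff (hp' k rfl), h'.root_eq_iff (hp' k rfl), h.root_lt_iff (hp' k rfl),
        h'.root_lt_iff (hp' k rfl)]
      exact ⟨Iff.rfl, fun _ => Iff.rfl⟩
  have fin : IsRun A V Φ₁ Φ₂ r (w ++ [(m, p'.map e')]) →
      ∃ z x' e₁ e₂, IsRun A V Φ₁ Φ₂ r (w ++ [z]) ∧ IsCore A s r (n + 1) x' e₁ ∧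
      IsCore A (w ++ [z]) r (w.length + 1) x' e₂ ∧
      (root (w ++ [z]) w.length = r ↔ root s n = r) := by
    intro hrun
    refine ⟨(m, p'.map e'), x ++ [(m, p')], _, _, hrun, h.step hL hp' hm ht,
      (h'.append hrun.legal.ptrLt).step hrun.legal hp' (by simp) ?_, hroot.1⟩
    rwa [← hev, ne_eq, hroot.1]
  apply fin
  by_cases he : Even n
  · obtain ⟨q, hq1, hq2, hq3⟩ := hL.exists_snoc_of_ov_eq hLw he (hev.1 he)
      (by rw [h.ov_last hL, h'.ov_last hLw]) hm
    have hq : q = p'.map e' := by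
      rcases hq3 with ⟨h1, rfl⟩ | ⟨j, j', h1, rfl, h3, h4, h5⟩
      · rw [Option.map_eq_none_iff] at h1; rw [h1]; rfl
      · obtain ⟨k, rfl, rfl⟩ := Option.map_eq_some_iff.1 h1
        rw [h.oviewIdx_last hL, h'.oviewIdx_last hLw] at h5
        rw [h'.oviewIdx_last hLw] at h4
        rw [hidx _ k j' (fun i hi => lt_of_mem_oviewIdx hi) (hpO he k rfl) h4 h5]
        rfl
    subst hq
    refine hw.snoc hq1 (fun _ => ?_) (fun hc => absurd (hev.1 he) hc)
    rw [hq2]; exact hs.oOk n hn he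
  · have hr : root s n ≠ r := by simpa [he] using ht
    have hwe := mt hev.2 he
    have hpred : ∀ {u : JSeq M} {k : ℕ}, Legal A u → k < u.length → ¬ Even k → root u k ≠ r →
        root u (k - 1) ≠ r := by
      intro u k hu hk hko hkr
      obtain ⟨l, rfl⟩ := Nat.exists_eq_succ_of_ne_zero (n := k) (by rintro rfl; simp at hko)
      have hl : Even l := by rwa [Nat.even_add_one, not_not] at hko
      rwa [Nat.succ_sub_one, ← hu.root_succ hk hl]
    have hsl := hpred hL hn he hr
    have hwl : root w (w.length - 1) ≠ r := by
      have e1 := h.map_last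
      have e2 := h'.map_last
      rw [h.map_length] at e1
      rw [h'.map_length] at e2
      rw [show w.length - 1 = e' (x.length - 1) by omega, ne_eq, h'.root_eq_iff (by omega),
        ← h.root_eq_iff (by omega), show e (x.length - 1) = n - 1 by omega]
      exact hsl
    obtain ⟨j, j', hq1, hq2, h1, h3, h4, h5⟩ := hL.exists_snoc_of_pv_eq hLw he hwe
      (by rw [h.pv_last hL hsl, h'.pv_last hLw hwl]) hm
    obtain ⟨k, rfl, rfl⟩ := Option.map_eq_some_iff.1 h1
    rw [h.pviewIdx_last hL hsl, h'.pviewIdx_last hLw hwl] at h5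
    rw [h'.pviewIdx_last hLw hwl] at h4
    obtain rfl := hidx _ k j' (fun i hi => lt_of_mem_pviewIdx hi) (hpP he k rfl) h4 h5
    refine hw.snoc hq1 (fun hc => absurd hc hwe) (fun _ _ => ?_)
    have := hs.pOk n hn he hr
    rw [← hq2] at this
    have h6 := hroot.2 ⟨k, rfl⟩
    simp only [Option.map_some] at h6 ⊢
    simpa only [h6] using this

/-- Two runs with the same core go on in the same way outside the thread. -/
theorem IsCore.exists_steps (hs : IsRun A V Φ₁ Φ₂ r s) (hw : IsRun A V Φ₁ Φ₂ r w)
    (h : IsCore A s r n x e) (h' : IsCore A w r w.length x e') {n' : ℕ} (hn : n ≤ n')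
    (hn' : n' ≤ s.length) (ht : ∀ k, n ≤ k → k < n' → root s k ≠ r) :
    ∃ w' x' e₁ e₂, IsRun A V Φ₁ Φ₂ r w' ∧ IsCore A s r n' x' e₁ ∧
      IsCore A w' r w'.length x' e₂ ∧ thread w' r = thread w r ∧ w <+: w' := by
  induction n' with
  | zero =>
    obtain rfl : n = 0 := by omega
    exact ⟨w, x, e, e', hw, h, h', rfl, List.prefix_refl w⟩
  | succ n' ih =>
    rcases eq_or_lt_of_le hn with rfl | hn
    · exact ⟨w, x, e, e', hw, h, h', rfl, List.prefix_refl w⟩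
    · obtain ⟨w₁, x₁, e₁, e₁', h1, h2, h3, h4, h5⟩ :=
        ih (by omega) (by omega) fun k hk hk' => ht k hk (by omega)
      have hr := ht n' (by omega) (by omega)
      obtain ⟨z, x₂, e₂, e₂', g1, g2, g3, g4⟩ := h2.exists_step hs h1 h3 hn' (Or.inr hr)
      refine ⟨_, x₂, e₂, e₂', g1, g2, by simpa using g3, ?_, h5.trans (List.prefix_append _ _)⟩
      rw [thread_append_of_ne (mt g4.1 hr), h4]

/-- A run that ends in the thread, with an O-view of the thread that is reached in `s`, has the
same core as `s` at the corresponding position. -/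
theorem IsRun.exists_core_match (hV : ViewDet V) (h₁ : ViewDet Φ₁) (h₂ : ViewDet Φ₂)
    (hs : IsRun A V Φ₁ Φ₂ r s) (hw : IsRun A V Φ₁ Φ₂ r w) {m₀ m₁ : M}
    (hr : s[r]? = some (m₀, none)) (hr' : w[r]? = some (m₁, none))
    (hlast : root w (w.length - 1) = r) {i : ℕ} (hi : i < s.length) (hir : root s i = r)
    (hv : ov A (thread w r) (thread w r).length = ov A (thread s r) (threadCount s r (i + 1))) :
    ∃ x e e', IsCore A s r (i + 1) x e ∧ IsCore A w r w.length x e' := by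
  have hri : r ≤ i := hir ▸ root_le i
  have hrw := lt_length_of_getElem? hr'
  obtain ⟨x, e, hx⟩ := hs.legal.exists_isCore hr (n := i + 1) (by omega) hi
  obtain ⟨y, e', hy⟩ := hw.legal.exists_isCore hr' hrw le_rfl
  have hyl : root y (y.length - 1) = r := by
    have hy' := hy
    rw [show w.length = w.length - 1 + 1 by omega] at hy'
    exact hy'.root_last hlast
  have ht : thread x r = thread y r := by
    rw [← hx.ov_thread hs.legal, ← hy.ov_thread hw.legal, ← length_thread, hv]
  obtain rfl := (hx.isCoreRun hs).eq hV h₁ h₂ (hy.isCoreRun hw) (hx.root_last hir) hyl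
    (by rw [ht]) fun k _ => by rw [ht]
  exact ⟨x, e, e', hx, hy⟩

end Runs

/-! ### Replacing a thread -/

section Replace

variable {M : Type*} {A : Arena M} {s t t' w : JSeq M} {r n : ℕ} {V Φ₁ Φ₂ : Set (JSeq M)}

/-- If the O-views of `t'` are among those of `t`, so are Opponent's moves, up to the rest of the
play. -/
theorem Legal.exists_ov_eq_of_ovw_subset (ht' : Legal A t') (ht : Legal A t)
    (h : ovw A t' ⊆ ovw A t) {n : ℕ} (hn : n < t'.length) (he : Even n) :
    ∃ k < t.length, Even k ∧ ov A t' n = ov A t k ∧ ov A t' (n + 1) = ov A t (k + 1) := by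
  obtain ⟨l, hl, hv⟩ := mem_ovw_iff.1 (h (mem_ovw_iff.2 ⟨n + 1, hn, rfl⟩))
  have hle := ht'.even_iff_of_ov_eq ht hn hl hv
  rw [Nat.even_add_one, not_iff_comm] at hle
  have hlo : ¬ Even l := fun hc => (hle.not.1 (by simpa using hc)) he
  obtain ⟨k, rfl⟩ := Nat.exists_eq_succ_of_ne_zero (n := l) (by rintro rfl; simp at hlo)
  have hk : Even k := by rwa [Nat.even_add_one, not_not] at hlo
  obtain ⟨x, hx⟩ := ht'.exists_ov_succ hn he
  obtain ⟨y, hy⟩ := ht.exists_ov_succ hl hk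
  exact ⟨k, hl, hk, (List.append_inj' (hx.symm.trans (hv.trans hy)) rfl).1, hv⟩

theorem Legal.exists_init_root (hs : Legal A s) {i : ℕ} (hi : i < s.length) (h : root s i = r) :
    ∃ m, s[r]? = some (m, none) := by
  induction i using Nat.strong_induction_on with
  | _ i ih =>
    obtain ⟨m, p, hm⟩ := exists_getElem? hi
    cases p with
    | none => rw [root_of_none hm] at h; exact ⟨m, h ▸ hm⟩
    | some j =>
      have hj := hs.ptrLt _ _ _ hm
      exact ih j hj (by omega) (by rwa [← root_of_some hm hj])

theorem take_append_getElem? {x : M × Option ℕ} (h : t[n]? = some x) :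
    t.take n ++ [x] = t.take (n + 1) := by
  rw [List.take_add_one, h]; rfl

/-- A run that ends in the thread beginning at `r`, where the thread is `u`. -/
structure IsThreadRun (A : Arena M) (V Φ₁ Φ₂ : Set (JSeq M)) (r : ℕ) (u w : JSeq M) : Prop where
  isRun : IsRun A V Φ₁ Φ₂ r w
  exists_init : ∃ m, w[r]? = some (m, none)
  thread_eq : thread w r = u
  root_last : root w (w.length - 1) = r

theorem IsThreadRun.threadCount_last (h : IsThreadRun A V Φ₁ Φ₂ r t w) :
    0 < w.length ∧ threadCount w r (w.length - 1) + 1 = t.length := by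
  obtain ⟨m, hm⟩ := h.exists_init
  have h0 := lt_length_of_getElem? hm
  refine ⟨by omega, ?_⟩
  rw [← threadCount_succ_of_eq h.root_last, Nat.sub_add_cancel (by omega), ← length_thread,
    h.thread_eq]

theorem IsThreadRun.even_length (h : IsThreadRun A V Φ₁ Φ₂ r t w) :
    Even w.length ↔ Even t.length := by
  obtain ⟨h0, h1⟩ := h.threadCount_last
  have := h.isRun.legal.even_threadCount_iff (i := w.length - 1) (by omega) h.root_last
  rw [← h1, Nat.even_add_one, this, ← Nat.even_add_one, Nat.sub_add_cancel (by omega)]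

/-- The run up to the beginning of the thread. -/
theorem IsRun.isThreadRun_init (hs : IsRun A V Φ₁ Φ₂ r s) {m₀ : M} (hr : s[r]? = some (m₀, none))
    (ht' : Legal A t') (h0 : 0 < t'.length) (h : ovw A t' ⊆ ovw A (thread s r)) :
    IsThreadRun A V Φ₁ Φ₂ r (t'.take 1) (s.take (r + 1)) := by
  have hlt := lt_length_of_getElem? hr
  have hrun : IsRun A V Φ₁ Φ₂ r (s.take (r + 1)) :=
    IsRun.append_left (l := s.drop (r + 1)) (by rwa [List.take_append_drop])
  have hlen : (s.take (r + 1)).length = r + 1 := by rw [List.length_take]; omega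
  have hr' : (s.take (r + 1))[r]? = some (m₀, none) := by
    rw [getElem?_take_lt (by omega), hr]
  have hroot := root_of_none hr'
  refine ⟨hrun, ⟨m₀, hr'⟩, ?_, by rw [hlen]; exact hroot⟩
  have hnil : thread (s.take r) r = [] := by
    by_contra hne
    obtain ⟨i, hi, hir, -⟩ := exists_of_lt_length_thread (List.length_pos_iff.2 hne)
    have := root_le (s := s.take r) i
    rw [List.length_take] at hi
    omega
  have hsplit : s.take r ++ [(m₀, none)] = s.take (r + 1) := take_append_getElem? hr
  have hlr : (s.take r).length = r := by rw [List.length_take]; omega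
  have hth : thread (s.take (r + 1)) r = [(m₀, none)] := by
    rw [← hsplit, thread_append_of_eq (by rw [hsplit]; exact hrun.legal.ptrLt)
      (by rw [hsplit, hlr]; exact hroot), hnil]
    rfl
  -- The thread and `t'` begin with the same move, since they have an O-view in common.
  have ht := hs.legal.thread hr
  obtain ⟨k, hk, hke, h1, h2⟩ := ht'.exists_ov_eq_of_ovw_subset ht h h0 (by simp)
  rw [ov_zero] at h1
  obtain rfl := (ht.ov_eq_nil_iff hk.le).1 h1.symm
  obtain ⟨m, hm, -⟩ := ht'.exists_init_zero h0
  have hc : threadCount s r r = 0 := by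
    rw [threadCount_congr (t := s.take r) fun i hi => (getElem?_take_lt hi).symm]
    have := length_thread (s := s.take r) (r := r)
    rw [hnil, hlr] at this
    exact this.symm
  have h3 := getElem?_thread hs.legal.ptrLt hr (root_of_none hr)
  rw [hc] at h3
  have := ht'.eq_of_ov_mem (viewDet_singleton _) ht (n := 0) (by simp) (by simp) hm h3
    (Set.mem_singleton _) h2.symm
  rw [hth, ← take_append_getElem? hm, this]
  rfl

/-- In the thread, Player can move as in any play with the same P-view. -/
theorem IsThreadRun.step_P (h : IsThreadRun A V Φ₁ Φ₂ r (t'.take n) w) (ht' : Legal A t')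
    (hn : n < t'.length) (ho : ¬ Even n) :
    ∃ w', IsThreadRun A V Φ₁ Φ₂ r (t'.take (n + 1)) w' := by
  have hL := h.isRun.legal
  have hlen : (t'.take n).length = n := by rw [List.length_take]; omega
  obtain ⟨h0, hc⟩ := h.threadCount_last
  have hwo := mt h.even_length.1 (by rwa [hlen])
  rw [hlen] at hc
  have hi : w.length - 1 < w.length := by omega
  have hidx : pviewIdx A t' n = (pviewIdx A w w.length).map (threadCount w r) := by
    have := hL.pviewIdx_thread hi h.root_last
    rw [hc, h.thread_eq, Nat.sub_add_cancel h0] at this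
    rw [← this]
    exact pviewIdx_congr fun i hi => (getElem?_take_lt hi).symm
  have hpv : pv A t' n = pv A w w.length := by
    have := hL.pv_thread hi h.root_last
    rw [hc, h.thread_eq, Nat.sub_add_cancel h0] at this
    rw [← this]
    exact pv_congr fun i hi => (getElem?_take_lt hi).symm
  obtain ⟨m, p, hm⟩ := exists_getElem? hn
  obtain ⟨j, j', h1, h2, rfl, h4, h5, h6⟩ := ht'.exists_snoc_of_pv_eq hL ho hwo hpv hm
  have hS : ∀ k ∈ pviewIdx A w w.length, root w k = r := fun k hk =>
    (hL.root_of_mem_pviewIdx le_rfl hwo hk).trans h.root_last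
  have hj : j = threadCount w r j' := by
    refine idxOf?_inj h4 ?_
    rw [← h6, hidx, idxOf?_map_of_injOn (S := {k | root w k = r})
      (fun a ha b hb => threadCount_inj ha hb) hS (hS _ h5)]
  have hj' := lt_of_mem_pviewIdx h5
  have hroot : root (w ++ [(m, some j')]) w.length = r := by
    rw [root_of_some (m := m) (by simp) hj', root_append hj', hS _ h5]
  refine ⟨_, h.isRun.snoc h1 (fun hc => absurd hc hwo) (fun _ hc => absurd hroot hc), ?_, ?_, ?_⟩
  · obtain ⟨m₀, hm₀⟩ := h.exists_init
    exact ⟨m₀, by rw [getElem?_append_lt (lt_length_of_getElem? hm₀), hm₀]⟩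
  · rw [thread_append_of_eq h1.ptrLt hroot, h.thread_eq, Option.map_some, ← hj,
      take_append_getElem? hm]
  · simpa using hroot

/-- If `s` moves on to the next move of the thread, the moves of `s` outside the thread can be
made in any run that has reached the same O-view of the thread. -/
theorem IsThreadRun.exists_steps (hV : ViewDet V) (h₁ : ViewDet Φ₁) (h₂ : ViewDet Φ₂)
    (hs : IsRun A V Φ₁ Φ₂ r s) {m₀ : M} (hr : s[r]? = some (m₀, none))
    (h : IsThreadRun A V Φ₁ Φ₂ r t w) {k n : ℕ} (hk : k < (thread s r).length)
    (hv : ov A t t.length = ov A (thread s r) (k + 1)) (hn : n ≤ s.length)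
    (hc : threadCount s r n = k + 1) :
    ∃ w' x e₁ e₂, IsRun A V Φ₁ Φ₂ r w' ∧ IsCore A s r n x e₁ ∧ IsCore A w' r w'.length x e₂ ∧
      thread w' r = t ∧ w <+: w' := by
  obtain ⟨m₁, hr'⟩ := h.exists_init
  obtain ⟨i, hi, hir, rfl⟩ := exists_of_lt_length_thread hk
  rw [← threadCount_succ_of_eq hir, ← h.thread_eq] at hv
  obtain ⟨x, e, e', hx, hx'⟩ :=
    hs.exists_core_match hV h₁ h₂ h.isRun hr hr' h.root_last hi hir hv
  have hin : i + 1 ≤ n := by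
    by_contra hlt
    have := threadCount_mono (s := s) (r := r) (i := n) (j := i) (by omega)
    omega
  rw [← h.thread_eq]
  refine hx.exists_steps hs h.isRun hx' hin hn fun k hk hkn hkr => ?_
  have h1 := threadCount_lt hir (j := k) (by omega)
  have h2 := threadCount_lt hkr hkn
  omega

/-- Opponent's next move in the thread of a run is determined by the O-view of the thread. -/
theorem IsThreadRun.step_O (hV : ViewDet V) (h₁ : ViewDet Φ₁) (h₂ : ViewDet Φ₂)
    (hs : IsRun A V Φ₁ Φ₂ r s) {m₀ : M} (hr : s[r]? = some (m₀, none))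
    (h : IsThreadRun A V Φ₁ Φ₂ r (t'.take n) w) (ht' : Legal A t')
    (hsub : ovw A t' ⊆ ovw A (thread s r)) (hn : n < t'.length) (hn0 : 0 < n) (he : Even n) :
    ∃ w', IsThreadRun A V Φ₁ Φ₂ r (t'.take (n + 1)) w' := by
  have ht := hs.legal.thread hr
  have hlen : (t'.take n).length = n := by rw [List.length_take]; omega
  obtain ⟨k, hk, hke, hv1, hv2⟩ := ht'.exists_ov_eq_of_ovw_subset ht hsub hn he
  have hk0 : k ≠ 0 := by
    rintro rfl
    rw [ov_zero, ht'.ov_eq_nil_iff hn.le] at hv1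
    omega
  obtain ⟨o, ho, hor, rfl⟩ := exists_of_lt_length_thread hk
  have hoe := (hs.legal.even_threadCount_iff ho hor).1 hke
  obtain ⟨w', x, e₁, e₂, g1, g2, g3, g4, g5⟩ := h.exists_steps hV h₁ h₂ hs hr
    (k := threadCount s r o - 1) (n := o) (by omega)
    (by rw [hlen, Nat.sub_add_cancel (by omega), ← hv1]
        exact ov_congr fun i hi => getElem?_take_lt hi) ho.le (by omega)
  obtain ⟨⟨m, p⟩, x', e₁', e₂', f1, f2, f3, f4⟩ := g2.exists_step hs g1 g3 ho (Or.inl hoe)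
  have hroot := f4.2 hor
  have hthr := thread_append_of_eq f1.legal.ptrLt hroot
  rw [g4] at hthr
  obtain ⟨m₁, hr'⟩ := h.exists_init
  have hinit : (w' ++ [(m, p)])[r]? = some (m₁, none) := by
    obtain ⟨l, rfl⟩ := g5
    rw [List.append_assoc, getElem?_append_lt (lt_length_of_getElem? hr'), hr']
  have hLt := f1.legal.thread hinit
  have hlen' : (thread (w' ++ [(m, p)]) r).length = n + 1 := by
    rw [hthr, List.length_append, hlen]; rfl
  have hov : ov A (thread (w' ++ [(m, p)]) r) (n + 1) = ov A t' (n + 1) := by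
    rw [hv2, ← threadCount_succ_of_eq hor, f2.ov_thread hs.legal, ← f3.ov_thread f1.legal]
    congr 1
    rw [← hlen', length_thread]; simp
  obtain ⟨m', p', hm'⟩ := exists_getElem? hn
  have hlast : (thread (w' ++ [(m, p)]) r)[n]? = some (m, p.map (threadCount w' r)) := by
    rw [hthr, List.getElem?_append_right (by omega), hlen]; simp
  have heq := hLt.eq_of_ov_mem (viewDet_singleton _) ht' he (fun i hi => by
    rw [hthr, getElem?_append_lt (by omega), getElem?_take_lt hi]) hlast hm'
    (Set.mem_singleton _) hov.symm
  exact ⟨_, f1, ⟨m₁, hinit⟩, by rw [hthr, heq, take_append_getElem? hm'], by simpa using hroot⟩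

/-- The thread of a run can be replaced by any play with the same O-views, if it is complete. The
result has the same final O-view. -/
theorem IsRun.exists_replace (hV : ViewDet V) (h₁ : ViewDet Φ₁) (h₂ : ViewDet Φ₂)
    (hs : IsRun A V Φ₁ Φ₂ r s) {m₀ : M} (hr : s[r]? = some (m₀, none)) (ht' : Legal A t')
    (h0 : 0 < t'.length) (he : Even t'.length) (hc : pending A t' t'.length = none)
    (hvw : ovw A t' = ovw A (thread s r)) :
    ∃ w, IsRun A V Φ₁ Φ₂ r w ∧ thread w r = t' ∧ ov A w w.length = ov A s s.length ∧
      (Even w.length ↔ Even s.length) := by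
  have ht := hs.legal.thread hr
  have key : ∀ n, n < t'.length → ∃ w, IsThreadRun A V Φ₁ Φ₂ r (t'.take (n + 1)) w := by
    intro n
    induction n with
    | zero => exact fun _ => ⟨_, hs.isThreadRun_init hr ht' h0 hvw.subset⟩
    | succ n ih =>
      intro hn
      obtain ⟨w, hw⟩ := ih (by omega)
      by_cases hne : Even (n + 1)
      · exact hw.step_O hV h₁ h₂ hs hr ht' hvw.subset hn (by omega) hne
      · exact hw.step_P ht' hn hne
  obtain ⟨w, hw⟩ := key (t'.length - 1) (by omega)
  rw [Nat.sub_add_cancel h0, List.take_length] at hw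
  obtain ⟨i, hi, hvi⟩ := mem_ovw_iff.1 (hvw.subset (mem_ovw_iff.2 ⟨t'.length, le_rfl, rfl⟩))
  have hie := (ht'.even_iff_of_ov_eq ht le_rfl hi hvi).1 he
  -- The O-view of `t'` is that of the whole thread, as it has no extension among the O-views.
  obtain rfl : i = (thread s r).length := by
    rcases eq_or_lt_of_le hi with h | h
    · exact h
    · obtain ⟨k, hk, hke, h1, -⟩ := ht.exists_ov_eq_of_ovw_subset ht' hvw.superset h hie
      exact absurd (h1.symm.trans hvi.symm) (ht'.ov_ne_of_complete hc he hk hke)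
  have hpos : 0 < (thread s r).length := by
    by_contra hz
    rw [Nat.eq_zero_of_not_pos hz, ov_zero, ht'.ov_eq_nil_iff le_rfl] at hvi
    omega
  obtain ⟨w', x, e₁, e₂, g1, g2, g3, g4, -⟩ := hw.exists_steps hV h₁ h₂ hs hr
    (k := (thread s r).length - 1) (n := s.length) (by omega)
    (by rw [Nat.sub_add_cancel hpos, hvi]) le_rfl
    (by rw [Nat.sub_add_cancel hpos, length_thread])
  refine ⟨w', g1, g4, ?_, ?_⟩
  · rw [g3.ov_last g1.legal, g2.ov_last hs.legal]
  · have h1 := g2.even x.length le_rfl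
    have h2 := g3.even x.length le_rfl
    rw [g2.map_length] at h1
    rw [g3.map_length] at h2
    rw [h1, h2]

end Replace

section Converse

variable {M : Type*} {A : Arena M} {σ τ V F : Set (JSeq M)}

/-- If Player follows `σ` in the threads of `s` that begin before `r`, and `τ` in the others, then
there is a play of `τ` with the same final O-view, against the same Opponent. The threads of `σ`
are observable plays of `σ`, and are replaced one at a time, the last one first, by plays of `τ`
with the same O-views. -/
theorem exists_run_of_obs_subset (hσ : IsInnocentStrategy A (plays A) σ)
    (hτ : IsInnocentStrategy A (plays A) τ) (h : obs A σ ⊆ obs A τ) (hV : ViewDet V) (r : ℕ)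
    {s : JSeq M} (hs : Legal A s) (he : Even s.length) (hc : pending A s s.length = none)
    (hO : OOk A V s) (hP : ∀ i < s.length, ¬ Even i →
      pv A s (i + 1) ∈ if root s i < r then pview A '' σ else pview A '' τ) :
    ∃ w ∈ τ, OOk A V w ∧ ov A w w.length = ov A s s.length ∧ pending A w w.length = none := by
  have hG : ∀ s l, s ++ l ∈ plays A → s ∈ plays A := fun _ _ h => plays_append h
  have h₁ := hσ.viewDet subset_rfl hG
  have h₂ := hτ.viewDet subset_rfl hG
  induction r generalizing s with
  | zero =>
    exact ⟨s, (hτ.mem_iff subset_rfl hG).2 ⟨hs, he, fun i hi ho => by simpa using hP i hi ho⟩,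
      hO, rfl, hc⟩
  | succ r ih =>
    by_cases hr : ∃ m₀, s[r]? = some (m₀, none)
    · obtain ⟨m₀, hr⟩ := hr
      have hrun : IsRun A V (pview A '' σ) (pview A '' τ) r s := by
        refine ⟨hs, hO, fun i hi ho hne => ?_⟩
        have := hP i hi ho
        simpa only [show root s i < r + 1 ↔ root s i < r by omega] using this
      have hL := hs.thread hr
      have htσ : thread s r ∈ σ := by
        refine (hσ.mem_iff subset_rfl hG).2 ⟨hL, ?_, ?_⟩
        · rw [length_thread]
          exact even_threadCount (fun _ => hs.root_succ) le_rfl he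
        · intro k hk ho
          obtain ⟨i, hi, hir, rfl⟩ := exists_of_lt_length_thread hk
          rw [hs.even_threadCount_iff hi hir] at ho
          have := hP i hi ho
          rwa [if_pos (by omega), ← hs.pv_thread hi hir] at this
      have hst : SingleThreaded A (thread s r) := by
        have hlt := lt_length_of_getElem? hr
        refine hL.singleThreaded_iff.2 ⟨?_, fun k m hk => ?_⟩
        · rw [length_thread]
          have := threadCount_lt (root_of_none hr) hlt
          omega
        · obtain ⟨i, hi, hir, rfl⟩ := exists_of_lt_length_thread (lt_length_of_getElem? hk)
          obtain ⟨m', p, hi'⟩ := exists_getElem? hi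
          rw [getElem?_thread hs.ptrLt hi' hir] at hk
          obtain rfl : p = none := by simpa using congrArg (Option.map Prod.snd) hk
          rw [root_of_none hi'] at hir
          subst hir
          by_contra hne
          have hm := (hs.init_iff hi').2 rfl
          obtain ⟨j, hj, hjr, hj0⟩ := exists_of_lt_length_thread (s := s) (r := i) (k := 0) (by
            rw [length_thread]
            have := threadCount_lt (root_of_none hi') hi
            omega)
          have := root_le (s := s) j
          have := threadCount_mono (s := s) (r := i) (i := i) (j := j) (by omega)
          omega
      obtain ⟨t', ht', hc', -, hs', hvw⟩ := h ⟨_, htσ, hs.complete_thread (hs.complete_iff.2 hc),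
        hL.oInnocent_iff.2 (hrun.viewDet_thread hV h₁ h₂ hr), hst, rfl⟩
      have hL' : Legal A t' := hτ.subset_plays ht'
      obtain ⟨w, g1, g2, g3, g4⟩ := hrun.exists_replace hV h₁ h₂ hr hL'
        (hL'.singleThreaded_iff.1 hs').1 (hτ.even_length _ ht') (hL'.complete_iff.1 hc') hvw.symm
      have hwe := g4.2 he
      have hwc := hs.pending_eq_none_of_ov_eq g1.legal le_rfl le_rfl he hwe g3.symm hc
      rw [← g3]
      refine ih g1.legal hwe hwc g1.oOk fun i hi ho => ?_
      by_cases hir : root w i = r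
      · rw [if_neg (by omega), ← g1.legal.pv_thread hi hir, g2]
        refine ((hτ.mem_iff subset_rfl hG).1 ht').2.2 _ ?_ ?_
        · rw [← g2, length_thread]
          exact threadCount_lt hir hi
        · rwa [g1.legal.even_threadCount_iff hi hir]
      · exact g1.pOk i hi ho hir
    · -- No thread begins at `r`.
      refine ih hs he hc hO fun i hi ho => ?_
      have hne : root s i ≠ r := fun hir => hr (hs.exists_init_root hi hir)
      have := hP i hi ho
      simpa only [show root s i < r + 1 ↔ root s i < r by omega] using this

theorem obsLE_of_obs_subset (hσ : IsInnocentStrategy A (plays A) σ)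
    (hτ : IsInnocentStrategy A (plays A) τ) (h : obs A σ ⊆ obs A τ) : ObsLE A σ τ := by
  intro α hα hσα
  have hG : ∀ s l, s ++ l ∈ plays A → s ∈ plays A := fun _ _ h => plays_append h
  rw [comp_eq_sigmaTop_iff hσ hα] at hσα
  rw [comp_eq_sigmaTop_iff hτ hα]
  obtain ⟨s, hs, hsα⟩ := hσα
  obtain ⟨hL, he, hP⟩ := (hσ.mem_iff subset_rfl hG).1 hs
  obtain ⟨hO, hF, hc⟩ := (append_finalEntry_mem_iff hα hL he).1 hsα
  obtain ⟨w, hw, hwO, hwv, hwc⟩ := exists_run_of_obs_subset hσ hτ h (viewDet_testViews hα)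
    s.length hL he hc hO fun i hi ho => by
      rw [if_pos ((root_le i).trans_lt hi)]
      exact hP i hi ho
  refine ⟨w, hw, (append_finalEntry_mem_iff hα (hτ.subset_plays hw) (hτ.even_length w hw)).2
    ⟨hwO, ?_, hwc⟩⟩
  change ov A w w.length ∈ _
  rw [hwv]
  exact hF

end Converse

end InnocentGames

theorem mainTheorem1 {M : Type*} (A : Arena M) (σ τ : Set (JSeq M))
    (hσ : IsInnocentStrategy A (plays A) σ) (hτ : IsInnocentStrategy A (plays A) τ) :
    ObsEquiv A σ τ ↔ obs A σ = obs A τ :=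
  ⟨fun h => (obs_subset_of_obsEquiv hσ hτ h).antisymm (obs_subset_of_obsEquiv hτ hσ h.symm),
    fun h => ⟨obsLE_of_obs_subset hσ hτ h.subset, obsLE_of_obs_subset hτ hσ h.superset⟩⟩
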